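/- An algorithm is a deterministic multi-stack (equivalently, up to polynomial factors, multitape) Turing machine, and running times are worst-case times over all inputs. Graphs are finite, simple and undirected, and are given by their adjacency matrices; numbers are given in unary. Hypothesis. Suppose that there are constants $C\in\mathbb N$ and $0<\varepsilon<1$ such that no algorithm running in time $2^{o(n)}$ can, given a graph $G$ whose vertex set is divided into $n$ groups, each with at most $C$ vertices and each forming an independent set of $G$, distinguish between the following two cases: - (Completeness) $G$ has a clique of size $n$; - (Soundness) $G$ has no clique of size at least $\varepsilon n$. Conclusion. Let $\rho:\mathbb N\to\mathbb R$ be computable (that is, $\rho(k)$ can be computed within any prescribed error $1/(m+1)$ from $k$ and $m$), with $\rho(k)\ge 1$ for all $k\ge 1$ and $\rho(k)=o(k)$. Then $k$-Clique cannot be approximated within ratio $\rho$ in time $f(k)\cdot N^{o(k/\rho(k))}$, where $N\ge 1$ is the number of vertices. Precisely, let $f:\mathbb N\to\mathbb N$ be any computable function and let $g:\mathbb N\to\mathbb R$ be any function with $g(k)=o(k/\rho(k))$ as $k\to\infty$. Then: 1. no algorithm that runs in time at most $f(k)\cdot N^{g(k)}$ on every $k$ and every graph $G$ with $N\ge1$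 vertices outputs a set of vertices of $G$ that is a clique of size at least $k/\rho(k)$ whenever $G$ has a clique of size $k$; 2. no algorithm that runs in time at most $f(k)\cdot N^{g(k)}$ on every $k$ and every graph $G$ with $N\ge1$ vertices distinguishes the graphs that have a clique of size $k$ from those that have no clique of size at least $k/\rho(k)$. -/

import Mathlib

open Filter Asymptotics

/-! ### Input and output encodings

Inputs are words over the three-letter alphabet `Option Bool`: bits, and the separator `none`. -/

/-- A natural number in unary, followed by a separator. -/
def encodeUnary (m : ℕ) : List (Option Bool) :=
  List.replicate m (some true) ++ [none]

open Classical in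
/-- The number of vertices in unary, followed by the rows of the adjacency matrix, each row
followed by a separator. -/
noncomputable def encodeGraph {N : ℕ} (G : SimpleGraph (Fin N)) : List (Option Bool) :=
  encodeUnary N ++
    (List.finRange N).flatMap fun u =>
      ((List.finRange N).map fun v => some (decide (G.Adj u v))) ++ [none]

/-- An instance of the parameterized clique problem: the parameter `k` and the graph. -/
noncomputable def encodeCliqueInput (k : ℕ) {N : ℕ} (G : SimpleGraph (Fin N)) :
    List (Option Bool) :=
  encodeUnary k ++ encodeGraph G

/-- An instance of the grouped clique problem: the number `n` of groups, the graph, and for every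
vertex the index of its group. -/
noncomputable def encodeGroupedInput {n N : ℕ} (G : SimpleGraph (Fin N)) (group : Fin N → Fin n) :
    List (Option Bool) :=
  encodeUnary n ++ encodeGraph G ++
    (List.finRange N).flatMap fun v => encodeUnary (group v).val

/-- A set of vertices, as its characteristic vector. -/
def encodeVertexSet {N : ℕ} (S : Finset (Fin N)) : List Bool :=
  (List.finRange N).map fun v => decide (v ∈ S)

/-! ### Machines and running times -/

/-- Deterministic multi-stack Turing machines that read words over `Option Bool` and write words
over `Bool`. -/
abbrev Machine := Turing.TM2ComputableAux (Option Bool) Bool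

/-- On input `x`, the machine `M` halts with output `y` after at most `T` steps. -/
def OutputsWithin (M : Machine) (x : List (Option Bool)) (y : List Bool) (T : ℝ) : Prop :=
  ∃ m : ℕ, (m : ℝ) ≤ T ∧
    Nonempty (Turing.TM2OutputsInTime M.tm (x.map M.inputAlphabet.invFun)
      (some (y.map M.outputAlphabet.invFun)) m)

/-! ### Cliques -/

/-- `G` has a clique with exactly `s` vertices. -/
def HasCliqueOfSize {N : ℕ} (G : SimpleGraph (Fin N)) (s : ℕ) : Prop :=
  ∃ S : Finset (Fin N), G.IsNClique s S

/-- `G` has a clique with at least `r` vertices, where `r` is a real number. -/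
def HasCliqueOfSizeAtLeast {N : ℕ} (G : SimpleGraph (Fin N)) (r : ℝ) : Prop :=
  ∃ S : Finset (Fin N), G.IsClique (S : Set (Fin N)) ∧ r ≤ (S.card : ℝ)

/-! ### The gap clique problem on groups of bounded size -/

open Classical in
/-- The map `group` divides the vertices of `G` into `n` groups, each of which has at most `C`
vertices and is an independent set. -/
def IsGrouping (C : ℕ) {n N : ℕ} (G : SimpleGraph (Fin N)) (group : Fin N → Fin n) : Prop :=
  (∀ i : Fin n, (Finset.univ.filter fun v => group v = i).card ≤ C) ∧
    ∀ u v : Fin N, group u = group v → ¬ G.Adj u v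

/-- Some algorithm runs in time `2 ^ o(n)` on graphs with `n` independent groups of at most `C`
vertices, and tells those that have a clique of size `n` from those that have no clique of size
`ε n`. -/
def GapGroupedCliqueInSubexpTime (C : ℕ) (ε : ℝ) : Prop :=
  ∃ (M : Machine) (t : ℕ → ℝ), t =o[atTop] (fun n : ℕ => (n : ℝ)) ∧
    ∀ (n N : ℕ) (G : SimpleGraph (Fin N)) (group : Fin N → Fin n), IsGrouping C G group →
      ∃ b : Bool,
        OutputsWithin M (encodeGroupedInput G group) [b] ((2 : ℝ) ^ t n) ∧
        (HasCliqueOfSize G n → b = true) ∧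
        (¬ HasCliqueOfSizeAtLeast G (ε * n) → b = false)

/-! ### Approximating the parameterized clique problem -/

/-- `ρ` is a computable sequence of real numbers: there is an algorithm that, given `k` and `m`,
approximates `ρ k` within `1 / (m + 1)` by a fraction with denominator `m + 1`. -/
def IsComputableRealSeq (ρ : ℕ → ℝ) : Prop :=
  ∃ a : ℕ → ℕ → ℤ, Computable₂ a ∧
    ∀ k m : ℕ, |ρ k - (a k m : ℝ) / ((m : ℝ) + 1)| ≤ 1 / ((m : ℝ) + 1)

/-- The time bound `(k, N) ↦ T k N` is of the form `f(k) * N ^ o(k / ρ(k))` with `f` computable. -/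
def IsParamTimeBound (ρ : ℕ → ℝ) (T : ℕ → ℕ → ℝ) : Prop :=
  ∃ (f : ℕ → ℕ) (g : ℕ → ℝ), Computable f ∧
    g =o[atTop] (fun k : ℕ => (k : ℝ) / ρ k) ∧
    ∀ k N : ℕ, T k N = (f k : ℝ) * (N : ℝ) ^ g k

/-- Some algorithm runs in time `f(k) * N ^ o(k / ρ(k))` on graphs with `N` vertices, and outputs a
clique of size at least `k / ρ(k)` whenever the graph has a clique of size `k`. -/
def CliqueApproximable (ρ : ℕ → ℝ) : Prop :=
  ∃ (M : Machine) (T : ℕ → ℕ → ℝ), IsParamTimeBound ρ T ∧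
    ∀ (k N : ℕ), 0 < N → ∀ G : SimpleGraph (Fin N),
      ∃ S : Finset (Fin N),
        OutputsWithin M (encodeCliqueInput k G) (encodeVertexSet S) (T k N) ∧
        (HasCliqueOfSize G k →
          G.IsClique (S : Set (Fin N)) ∧ (k : ℝ) / ρ k ≤ (S.card : ℝ))

/-- Some algorithm runs in time `f(k) * N ^ o(k / ρ(k))` on graphs with `N` vertices, and tells
those that have a clique of size `k` from those that have no clique of size `k / ρ(k)`. -/
def CliqueGapDecidable (ρ : ℕ → ℝ) : Prop :=
  ∃ (M : Machine) (T : ℕ → ℕ → ℝ), IsParamTimeBound ρ T ∧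
    ∀ (k N : ℕ), 0 < N → ∀ G : SimpleGraph (Fin N),
      ∃ b : Bool,
        OutputsWithin M (encodeCliqueInput k G) [b] (T k N) ∧
        (HasCliqueOfSize G k → b = true) ∧
        (¬ HasCliqueOfSizeAtLeast G ((k : ℝ) / ρ k) → b = false)

/-! Number the groups 0, ..., n - 1 and write the numbers in base `q`. For `i < k`, block `i`
consists of the groups whose digit `i` is zero. If `q ^ k ≤ n`, a block has at most 2n/q groups,
hence at most 2Cn/q vertices (`count_blockVertices_le`). The new graph has as vertices the pairs of
an index `i` and a clique of `G` inside block `i` that meets every group of the block. Two of them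
are adjacent if the indices differ and the union is a clique of `G`. Thus there are at most k * 2 ^
(2Cn/q) vertices.

A clique of `G` with n vertices meets every group, and its restrictions to the k blocks form a
k-clique (`exists_clique_newGraph`). Conversely, the union of a clique of the new graph with r
vertices is a clique of `G` that meets every group with a zero digit at one of r positions
(`exists_mem_unionSet`). The groups that it may miss have nonzero digits at all these positions.
There are at most 2n(1 - 1/q)^r of them, and by Bernoulli's inequality this is at most n/D once r >
0 and r ≥ 2D(q - 1) (`mul_card_nonzero_digits_le`). So the union has at least (1 - 1/D)n ≥ εn
vertices (`le_card_unionSet`).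

It remains to choose k and q (`exists_params`). A computable integer `b k`, between `ρ k` and `3 * ρ
k`, gives q = k / (2D * b k). Then 2Dq ≤ k/ρ(k) ≤ 12Dq, so a clique of size k/ρ(k) is large enough,
and q tends to infinity because ρ(k) = o(k). If k tends to infinity so slowly with n that f(k), k^k
and q^k are at most n, the query takes time at most f(k) * (k * 2 ^ (2Cn/q)) ^ |g(k)|. This is 2 ^
o(n), since |g(k)| = o(q). Values of k and q of this kind have to be found quickly. For this the
codes of the computable functions involved are evaluated with a clock, and the largest k ≤ n that
passes the test is taken (`eventually_params`).

The rest shows that this reduction is carried out by a machine. Structured programs are compiled to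
stack machines with no loss of time, and a given machine can be run inside a program with constant
slowdown (`runs_machineLoop`). Data are binary trees in a self-delimiting prefix code on one stack.
Polynomial time computability is closed under the usual list operations, by way of a fold whose
intermediate values are bounded (`Eff.foldl'`). `exists_machine_of_query` assembles preprocessing,
one call of the given machine, and postprocessing; `eff_reduction` bounds the preprocessing. -/

/-! ### Structured stack programs -/

/-- Structured programs over a family of stacks with alphabets `Γ` and a register of type `σ`. -/
inductive StackProg {K : Type} (Γ : K → Type) (σ : Type) : Type
  | push (k : K) (f : σ → Γ k) : StackProg Γ σ
  | peek (k : K) (f : σ → Option (Γ k) → σ) : StackProg Γ σ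
  | pop (k : K) (f : σ → Option (Γ k) → σ) : StackProg Γ σ
  | load (f : σ → σ) : StackProg Γ σ
  | seq (P Q : StackProg Γ σ) : StackProg Γ σ
  | ite (p : σ → Bool) (P Q : StackProg Γ σ) : StackProg Γ σ
  | loop (p : σ → Bool) (P : StackProg Γ σ) : StackProg Γ σ

namespace StackProg

open Turing

variable {K : Type} [DecidableEq K] {Γ : K → Type} {σ : Type}

/-- Big-step semantics: the program takes one store to another in the given number of steps. -/
inductive Runs : StackProg Γ σ → σ × (∀ k, List (Γ k)) → ℕ → σ × (∀ k, List (Γ k)) → Prop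
  | push (k f v S) : Runs (push k f) (v, S) 1 (v, Function.update S k (f v :: S k))
  | peek (k f v S) : Runs (peek k f) (v, S) 1 (f v (S k).head?, S)
  | pop (k f v S) : Runs (pop k f) (v, S) 1 (f v (S k).head?, Function.update S k (S k).tail)
  | load (f v S) : Runs (load f) (v, S) 1 (f v, S)
  | seq {P Q s s' s'' t t'} : Runs P s t s' → Runs Q s' t' s'' → Runs (seq P Q) s (t + t') s''
  | ite_true {p P Q s s' t} : p s.1 = true → Runs P s t s' → Runs (ite p P Q) s (t + 1) s'
  | ite_false {p P Q s s' t} : p s.1 = false → Runs Q s t s' → Runs (ite p P Q) s (t + 1) s'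
  | loop_false {p P s} : p s.1 = false → Runs (loop p P) s 1 s
  | loop_true {p P s s' s'' t t'} : p s.1 = true → Runs P s t s' → Runs (loop p P) s' t' s'' →
      Runs (loop p P) s (t + 1 + t') s''

/-- The control points of a program. -/
def Lab : StackProg Γ σ → Type
  | push _ _ => Unit
  | peek _ _ => Unit
  | pop _ _ => Unit
  | load _ => Unit
  | seq P Q => Lab P ⊕ Lab Q
  | ite _ P Q => Option (Lab P ⊕ Lab Q)
  | loop _ P => Option (Lab P)

/-- A program has finitely many control points. -/
noncomputable instance Lab.fintype : (P : StackProg Γ σ) → Fintype (Lab P)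
  | push _ _ => inferInstanceAs (Fintype Unit)
  | peek _ _ => inferInstanceAs (Fintype Unit)
  | pop _ _ => inferInstanceAs (Fintype Unit)
  | load _ => inferInstanceAs (Fintype Unit)
  | seq P Q =>
    let _ := Lab.fintype P
    let _ := Lab.fintype Q
    inferInstanceAs (Fintype (Lab P ⊕ Lab Q))
  | ite _ P Q =>
    let _ := Lab.fintype P
    let _ := Lab.fintype Q
    inferInstanceAs (Fintype (Option (Lab P ⊕ Lab Q)))
  | loop _ P =>
    let _ := Lab.fintype P
    inferInstanceAs (Fintype (Option (Lab P)))

/-- The first control point of a program. -/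
def entry : (P : StackProg Γ σ) → Lab P
  | push _ _ => ()
  | peek _ _ => ()
  | pop _ _ => ()
  | load _ => ()
  | seq P _ => Sum.inl (entry P)
  | ite _ _ _ => none
  | loop _ _ => none

/-- The statements that implement a program, with its control points embedded in `Λ`. -/
def code {Λ : Type} : (P : StackProg Γ σ) → (Lab P → Λ) → Λ → Lab P → TM2.Stmt Γ Λ σ
  | push k f, _, exit, _ => .push k f (.goto fun _ => exit)
  | peek k f, _, exit, _ => .peek k f (.goto fun _ => exit)
  | pop k f, _, exit, _ => .pop k f (.goto fun _ => exit)
  | load f, _, exit, _ => .load f (.goto fun _ => exit)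
  | seq P Q, emb, _, Sum.inl l =>
    code P (fun l => emb (Sum.inl l)) (emb (Sum.inr (entry Q))) l
  | seq _ Q, emb, exit, Sum.inr l => code Q (fun l => emb (Sum.inr l)) exit l
  | ite p P Q, emb, _, none =>
    .branch p (.goto fun _ => emb (some (Sum.inl (entry P))))
      (.goto fun _ => emb (some (Sum.inr (entry Q))))
  | ite _ P _, emb, exit, some (Sum.inl l) => code P (fun l => emb (some (Sum.inl l))) exit l
  | ite _ _ Q, emb, exit, some (Sum.inr l) => code Q (fun l => emb (some (Sum.inr l))) exit l
  | loop p P, emb, exit, none =>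
    .branch p (.goto fun _ => emb (some (entry P))) (.goto fun _ => exit)
  | loop _ P, emb, _, some l => code P (fun l => emb (some l)) (emb none) l

/-- A machine reaches one configuration from another in exactly the given number of steps. -/
def StepsTo {Λ : Type} (m : Λ → TM2.Stmt Γ Λ σ) (c : TM2.Cfg Γ Λ σ) (t : ℕ)
    (c' : TM2.Cfg Γ Λ σ) : Prop :=
  (flip Bind.bind (TM2.step m))^[t] (some c) = some c'

theorem StepsTo.trans {Λ : Type} {m : Λ → TM2.Stmt Γ Λ σ} {c c' c'' : TM2.Cfg Γ Λ σ} {t t' : ℕ}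
    (h : StepsTo m c t c') (h' : StepsTo m c' t' c'') : StepsTo m c (t + t') c'' := by
  unfold StepsTo at *
  rw [add_comm, Function.iterate_add_apply, h, h']

theorem StepsTo.single {Λ : Type} {m : Λ → TM2.Stmt Γ Λ σ} {c c' : TM2.Cfg Γ Λ σ}
    (h : TM2.step m c = some c') : StepsTo m c 1 c' := h

/-- Every compiled statement ends with a jump after one instruction or test, so one unit of cost in
the semantics is one machine step. The embedding and the exit are quantified inside the induction
because a subprogram sits in the machine through a different embedding and leaves to a different
label. -/
theorem Runs.stepsTo {Λ : Type} {m : Λ → TM2.Stmt Γ Λ σ} {P : StackProg Γ σ}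
    {s s' : σ × (∀ k, List (Γ k))} {t : ℕ} (h : Runs P s t s') :
    ∀ (emb : Lab P → Λ) (exit : Λ), (∀ l, m (emb l) = code P emb exit l) →
      StepsTo m ⟨some (emb (entry P)), s.1, s.2⟩ t ⟨some exit, s'.1, s'.2⟩ := by
  induction h with
  | push k f v S | peek k f v S | pop k f v S | load f v S =>
    intro emb exit hm
    apply StepsTo.single
    simp only [TM2.step, hm]
    simp [code]
  | @seq P Q s s' s'' t t' _ _ ih1 ih2 =>
    intro emb exit hm
    exact (ih1 _ _ fun l => hm (Sum.inl l)).trans (ih2 _ _ fun l => hm (Sum.inr l))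
  | @ite_true p P Q s s' t hp _ ih =>
    intro emb exit hm
    rw [add_comm]
    refine StepsTo.trans (StepsTo.single ?_) (ih (fun l => emb (some (Sum.inl l))) exit
      fun l => hm (some (Sum.inl l)))
    have h₀ := hm none
    simp only [code] at h₀
    simp [TM2.step, entry, h₀, TM2.stepAux, hp]
  | @ite_false p P Q s s' t hp _ ih =>
    intro emb exit hm
    rw [add_comm]
    refine StepsTo.trans (StepsTo.single ?_) (ih (fun l => emb (some (Sum.inr l))) exit
      fun l => hm (some (Sum.inr l)))
    have h₀ := hm none
    simp only [code] at h₀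
    simp [TM2.step, entry, h₀, TM2.stepAux, hp]
  | @loop_false p P s hp =>
    intro emb exit hm
    apply StepsTo.single
    have h₀ := hm none
    simp only [code] at h₀
    simp [TM2.step, entry, h₀, TM2.stepAux, hp]
  | @loop_true p P s s' s'' t t' hp _ _ ih1 ih2 =>
    intro emb exit hm
    rw [add_comm t 1]
    refine (StepsTo.trans (StepsTo.single ?_) (ih1 (fun l => emb (some l)) (emb none)
      fun l => hm (some l))).trans (ih2 emb exit hm)
    have h₀ := hm none
    simp only [code] at h₀
    simp [TM2.step, entry, h₀, TM2.stepAux, hp]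

/-! ### Programs that use a given machine -/

variable (M : FinTM2)

/-- The stack alphabets of a machine, together with four stacks of bits. -/
abbrev ExtΓ : Fin 4 ⊕ M.K → Type
  | Sum.inl _ => Bool
  | Sum.inr k => M.Γ k

/-- A register for one input symbol, together with the control state of the machine. -/
abbrev ExtReg : Type := Option (Option Bool) × Option M.Λ × M.σ

/-- Programs that operate on four stacks of bits and the stacks of a machine. -/
abbrev ExtProg : Type := StackProg (ExtΓ M) (ExtReg M)

variable {M}

/-- The contents of the stacks. -/
def stks (a b c d : List Bool) (m : ∀ k, List (M.Γ k)) : ∀ k, List (ExtΓ M k)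
  | Sum.inl 0 => a
  | Sum.inl 1 => b
  | Sum.inl 2 => c
  | Sum.inl 3 => d
  | Sum.inr k => m k

section
variable (a b c d : List Bool) (m : ∀ k, List (M.Γ k))

@[simp] theorem stks_zero : stks a b c d m (Sum.inl 0) = a := rfl
@[simp] theorem stks_one : stks a b c d m (Sum.inl 1) = b := rfl
@[simp] theorem stks_two : stks a b c d m (Sum.inl 2) = c := rfl
@[simp] theorem stks_three : stks a b c d m (Sum.inl 3) = d := rfl
@[simp] theorem stks_inr (k : M.K) : stks a b c d m (Sum.inr k) = m k := rfl

@[simp] theorem update_stks_zero (x : List Bool) :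
    Function.update (stks a b c d m) (Sum.inl 0) x = stks x b c d m := by
  funext k; rcases k with k | k
  · fin_cases k <;> simp [Function.update, stks]
  · simp

@[simp] theorem update_stks_one (x : List Bool) :
    Function.update (stks a b c d m) (Sum.inl 1) x = stks a x c d m := by
  funext k; rcases k with k | k
  · fin_cases k <;> simp [Function.update, stks]
  · simp

@[simp] theorem update_stks_two (x : List Bool) :
    Function.update (stks a b c d m) (Sum.inl 2) x = stks a b x d m := by
  funext k; rcases k with k | k
  · fin_cases k <;> simp [Function.update, stks]
  · simp

@[simp] theorem update_stks_three (x : List Bool) :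
    Function.update (stks a b c d m) (Sum.inl 3) x = stks a b c x m := by
  funext k; rcases k with k | k
  · fin_cases k <;> simp [Function.update, stks]
  · simp

@[simp] theorem update_stks_inr (k : M.K) (x : List (M.Γ k)) :
    Function.update (stks a b c d m) (Sum.inr k) x = stks a b c d (Function.update m k x) := by
  funext j; rcases j with j | j
  · fin_cases j <;> simp [stks]
  · by_cases h : j = k
    · subst h; simp
    · simp [Function.update, h]

end

/-- The program that simulates one statement of the machine. -/
def ofStmt : TM2.Stmt M.Γ M.Λ M.σ → ExtProg M
  | .push k f q => seq (push (Sum.inr k) fun s => f s.2.2) (ofStmt q)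
  | .peek k f q => seq (peek (Sum.inr k) fun s o => (s.1, s.2.1, f s.2.2 o)) (ofStmt q)
  | .pop k f q => seq (pop (Sum.inr k) fun s o => (s.1, s.2.1, f s.2.2 o)) (ofStmt q)
  | .load f q => seq (load fun s => (s.1, s.2.1, f s.2.2)) (ofStmt q)
  | .branch p q₁ q₂ => ite (fun s => p s.2.2) (ofStmt q₁) (ofStmt q₂)
  | .goto l => load fun s => (s.1, some (l s.2.2), s.2.2)
  | .halt => load fun s => (s.1, none, s.2.2)

/-- A statement contains no loop, so its simulation time is bounded independently of the state. This
uniformity makes the slowdown of the whole simulation a constant factor. -/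
theorem runs_ofStmt (q : TM2.Stmt M.Γ M.Λ M.σ) :
    ∃ T, ∀ r l v a b c d m, ∃ t ≤ T, Runs (ofStmt q) ((r, l, v), stks a b c d m) t
      ((r, (TM2.stepAux q v m).l, (TM2.stepAux q v m).var),
        stks a b c d (TM2.stepAux q v m).stk) := by
  induction q with
  | push k f q ih =>
    obtain ⟨T, ih⟩ := ih
    refine ⟨1 + T, fun r l v a b c d m => ?_⟩
    obtain ⟨t, ht, h⟩ := ih r l v a b c d (Function.update m k (f v :: m k))
    exact ⟨1 + t, by omega, Runs.seq (Runs.push _ _ _ _) (by simpa using h)⟩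
  | peek k f q ih =>
    obtain ⟨T, ih⟩ := ih
    refine ⟨1 + T, fun r l v a b c d m => ?_⟩
    obtain ⟨t, ht, h⟩ := ih r l (f v (m k).head?) a b c d m
    exact ⟨1 + t, by omega, Runs.seq (Runs.peek _ _ _ _) (by simpa using h)⟩
  | pop k f q ih =>
    obtain ⟨T, ih⟩ := ih
    refine ⟨1 + T, fun r l v a b c d m => ?_⟩
    obtain ⟨t, ht, h⟩ := ih r l (f v (m k).head?) a b c d (Function.update m k (m k).tail)
    exact ⟨1 + t, by omega, Runs.seq (Runs.pop _ _ _ _) (by simpa using h)⟩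
  | load f q ih =>
    obtain ⟨T, ih⟩ := ih
    refine ⟨1 + T, fun r l v a b c d m => ?_⟩
    obtain ⟨t, ht, h⟩ := ih r l (f v) a b c d m
    exact ⟨1 + t, by omega, Runs.seq (Runs.load _ _ _) (by simpa using h)⟩
  | branch p q₁ q₂ ih₁ ih₂ =>
    obtain ⟨T₁, ih₁⟩ := ih₁
    obtain ⟨T₂, ih₂⟩ := ih₂
    refine ⟨T₁ + T₂ + 1, fun r l v a b c d m => ?_⟩
    cases hp : p v with
    | true =>
      obtain ⟨t, ht, h⟩ := ih₁ r l v a b c d m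
      exact ⟨t + 1, by omega, Runs.ite_true hp (by simpa [TM2.stepAux, hp] using h)⟩
    | false =>
      obtain ⟨t, ht, h⟩ := ih₂ r l v a b c d m
      exact ⟨t + 1, by omega, Runs.ite_false hp (by simpa [TM2.stepAux, hp] using h)⟩
  | goto l => exact ⟨1, fun r _ v a b c d m => ⟨1, le_rfl, Runs.load _ _ _⟩⟩
  | halt => exact ⟨1, fun r _ v a b c d m => ⟨1, le_rfl, Runs.load _ _ _⟩⟩

open Classical in
/-- The program that performs one step of the machine, whose label is in the list. -/
noncomputable def machineStep : List M.Λ → ExtProg M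
  | [] => load id
  | l :: ls => ite (fun s => decide (s.2.1 = some l)) (ofStmt (M.m l)) (machineStep ls)

theorem runs_machineStep (ls : List M.Λ) :
    ∃ T, ∀ l ∈ ls, ∀ r v a b c d m, ∃ t ≤ T, Runs (machineStep ls) ((r, some l, v), stks a b c d m)
      t ((r, (TM2.stepAux (M.m l) v m).l, (TM2.stepAux (M.m l) v m).var),
        stks a b c d (TM2.stepAux (M.m l) v m).stk) := by
  induction ls with
  | nil => exact ⟨0, by simp⟩
  | cons l₀ ls ih =>
    obtain ⟨T, ih⟩ := ih
    obtain ⟨T', h'⟩ := runs_ofStmt (M.m l₀)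
    refine ⟨T + T' + 1, fun l hl r v a b c d m => ?_⟩
    by_cases h : l = l₀
    · subst h
      obtain ⟨t, ht, h⟩ := h' r (some l) v a b c d m
      exact ⟨t + 1, by omega, Runs.ite_true (by simp) h⟩
    · obtain ⟨t, ht, h₂⟩ := ih l (by simpa [h] using hl) r v a b c d m
      exact ⟨t + 1, by omega, Runs.ite_false (by simp [h]) h₂⟩

/-- The program that runs the machine until it halts. -/
noncomputable def machineLoop : ExtProg M :=
  loop (fun s => s.2.1.isSome) (machineStep M.ΛFin.elems.toList)

theorem runs_machineLoop (M : FinTM2) : ∃ T, ∀ n (x y : M.Cfg), y.l = none →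
    (flip Bind.bind M.step)^[n] (some x) = some y → ∀ r a b c d,
      ∃ t ≤ T * n + 1, Runs (machineLoop (M := M)) ((r, x.l, x.var), stks a b c d x.stk) t
        ((r, y.l, y.var), stks a b c d y.stk) := by
  obtain ⟨T, hT⟩ := runs_machineStep (M := M) M.ΛFin.elems.toList
  refine ⟨T + 1, fun n => ?_⟩
  induction n with
  | zero =>
    intro x y hy h r a b c d
    obtain rfl : x = y := by simpa using h
    exact ⟨1, by omega, Runs.loop_false (by simp [hy])⟩
  | succ n ih =>
    intro x y hy h r a b c d
    obtain ⟨l, v, S⟩ := x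
    cases l with
    | none =>
      -- A halted configuration has no successor, so it cannot reach `y` in a positive number of
      -- steps.
      exfalso
      rw [Function.iterate_succ_apply] at h
      have : ∀ k, (flip Bind.bind M.step)^[k] none = (none : Option M.Cfg) := by
        intro k
        induction k with
        | zero => rfl
        | succ k ihk => rw [Function.iterate_succ_apply]; exact ihk
      have h0 : flip Bind.bind M.step (some (⟨none, v, S⟩ : M.Cfg)) = none := rfl
      rw [h0, this] at h
      simp at h
    | some l =>
      rw [Function.iterate_succ_apply] at h
      have h0 : flip Bind.bind M.step (some (⟨some l, v, S⟩ : M.Cfg))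
        = some (TM2.stepAux (M.m l) v S) := rfl
      rw [h0] at h
      obtain ⟨t, ht, h₁⟩ := ih _ y hy h r a b c d
      obtain ⟨t', ht', h₂⟩ := hT l (Finset.mem_toList.2 (M.ΛFin.complete l)) r v a b c d S
      refine ⟨t' + 1 + t, ?_, Runs.loop_true rfl h₂ h₁⟩
      nlinarith

/-! ### From programs to machines -/

/-- The machine that runs a program and halts. -/
noncomputable def toMachine (M : Machine) (P : ExtProg M.tm) : Machine where
  tm :=
    { K := Fin 4 ⊕ M.tm.K
      kFin := @instFintypeSum _ _ _ M.tm.kFin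
      k₀ := Sum.inr M.tm.k₀
      k₁ := Sum.inr M.tm.k₁
      Γ := ExtΓ M.tm
      Λ := Option (Lab P)
      main := some (entry P)
      σ := ExtReg M.tm
      initialState := (none, none, M.tm.initialState)
      σFin :=
        have := M.tm.ΛFin
        have := M.tm.σFin
        inferInstanceAs (Fintype (Option (Option Bool) × Option M.tm.Λ × M.tm.σ))
      Γk₀Fin := M.tm.Γk₀Fin
      m := fun
        | none => .halt
        | some l => code P some none l }
  inputAlphabet := M.inputAlphabet
  outputAlphabet := M.outputAlphabet

/-- All stacks are empty, except for the first one and those of the machine; the machine is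
ready to be started. -/
def conf (M : FinTM2) (a : List Bool) (m : ∀ k, List (M.Γ k)) :
    ExtReg M × (∀ k, List (ExtΓ M k)) :=
  ((none, none, M.initialState), stks a [] [] [] m)

/-- Only one of the stacks of the machine is not empty. -/
def only (M : FinTM2) (k : M.K) (x : List (M.Γ k)) : ∀ k, List (M.Γ k) :=
  Function.update (fun _ => []) k x

theorem initList_stk (M : FinTM2) (x : List (M.Γ M.k₀)) : (initList M x).stk = only M M.k₀ x := by
  funext k
  by_cases h : k = M.k₀
  · subst h; simp [initList, only]
  · simp [initList, only, h]

theorem haltList_stk (M : FinTM2) (x : List (M.Γ M.k₁)) : (haltList M x).stk = only M M.k₁ x := by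
  funext k
  by_cases h : k = M.k₁
  · subst h; simp [haltList, only]
  · simp [haltList, only, h]

/-- A halting configuration must have the initial register and only the output stack nonempty, which
is why the program has to end in a `conf` with empty auxiliary stacks. The additional step executes
the halting statement at the exit label `none`. -/
theorem outputsWithin_toMachine (M : Machine) (P : ExtProg M.tm) (x : List (Option Bool))
    (y : List Bool) (t : ℕ)
    (h : Runs P (conf M.tm [] (only M.tm M.tm.k₀ (x.map M.inputAlphabet.invFun))) t
      (conf M.tm [] (only M.tm M.tm.k₁ (y.map M.outputAlphabet.invFun)))) (T : ℝ)
    (hT : (t + 1 : ℕ) ≤ T) : OutputsWithin (toMachine M P) x y T := by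
  refine ⟨t + 1, hT, ⟨⟨⟨t + 1, ?_⟩, le_rfl⟩⟩⟩
  have h₁ := h.stepsTo (m := (toMachine M P).tm.m) some none (fun l => rfl)
  have h₂ := h₁.trans (StepsTo.single rfl)
  unfold StepsTo at h₂
  have e₁ : initList (toMachine M P).tm (x.map M.inputAlphabet.invFun) =
      ⟨some (some (entry P)), (conf M.tm [] (only M.tm M.tm.k₀
        (x.map M.inputAlphabet.invFun))).1, (conf M.tm [] (only M.tm M.tm.k₀
        (x.map M.inputAlphabet.invFun))).2⟩ := by
    refine TM2.Cfg.mk.injEq .. |>.mpr ⟨rfl, rfl, ?_⟩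
    have := initList_stk (toMachine M P).tm (x.map M.inputAlphabet.invFun)
    refine this.trans ?_
    have hs : (fun _ => [] : ∀ k, List (ExtΓ M.tm k)) = stks [] [] [] [] (fun _ => []) := by
      funext k; rcases k with k | k
      · fin_cases k <;> rfl
      · rfl
    unfold only
    exact (congrArg (fun S => Function.update S (Sum.inr M.tm.k₀) _) hs).trans
      (update_stks_inr _ _ _ _ _ _ _)
  have e₂ : haltList (toMachine M P).tm (y.map M.outputAlphabet.invFun) =
      ⟨none, (conf M.tm [] (only M.tm M.tm.k₁
        (y.map M.outputAlphabet.invFun))).1, (conf M.tm [] (only M.tm M.tm.k₁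
        (y.map M.outputAlphabet.invFun))).2⟩ := by
    refine TM2.Cfg.mk.injEq .. |>.mpr ⟨rfl, rfl, ?_⟩
    have := haltList_stk (toMachine M P).tm (y.map M.outputAlphabet.invFun)
    refine this.trans ?_
    have hs : (fun _ => [] : ∀ k, List (ExtΓ M.tm k)) = stks [] [] [] [] (fun _ => []) := by
      funext k; rcases k with k | k
      · fin_cases k <;> rfl
      · rfl
    unfold only
    exact (congrArg (fun S => Function.update S (Sum.inr M.tm.k₁) _) hs).trans
      (update_stks_inr _ _ _ _ _ _ _)
  exact (congrArg (fun c => (flip Bind.bind (toMachine M P).tm.step)^[t + 1] (some c)) e₁).trans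
    (h₂.trans (congrArg some e₂).symm)

end StackProg

section

/-! ### Polynomial bounds -/

/-- The function `u` is bounded by a polynomial in `v`. -/
def PolyLe {γ : Type} (u v : γ → ℕ) : Prop := ∃ p, ∀ c, u c ≤ (v c + 2) ^ p

namespace PolyLe

variable {γ δ : Type} {u u' v w : γ → ℕ}

theorem of_le (h : ∀ c, u c ≤ v c) : PolyLe u v := ⟨1, fun c => by have := h c; simp; omega⟩

theorem refl (u : γ → ℕ) : PolyLe u u := of_le fun _ => le_rfl

/-- The base `v c + 2` is at least 2, so that constants are absorbed into the exponent. -/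
theorem const (n : ℕ) (v : γ → ℕ) : PolyLe (fun _ => n) v :=
  ⟨n, fun c => n.lt_two_pow_self.le.trans (Nat.pow_le_pow_left (by omega) n)⟩

theorem add (h : PolyLe u v) (h' : PolyLe u' v) : PolyLe (fun c => u c + u' c) v := by
  obtain ⟨p, hp⟩ := h
  obtain ⟨q, hq⟩ := h'
  refine ⟨p + q + 1, fun c => ?_⟩
  have h₁ : (v c + 2) ^ p ≤ (v c + 2) ^ (p + q) := Nat.pow_le_pow_right (by omega) (by omega)
  have h₂ : (v c + 2) ^ q ≤ (v c + 2) ^ (p + q) := Nat.pow_le_pow_right (by omega) (by omega)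
  have := hp c
  have := hq c
  rw [pow_succ]
  nlinarith

theorem mul (h : PolyLe u v) (h' : PolyLe u' v) : PolyLe (fun c => u c * u' c) v := by
  obtain ⟨p, hp⟩ := h
  obtain ⟨q, hq⟩ := h'
  exact ⟨p + q, fun c => by rw [pow_add]; exact Nat.mul_le_mul (hp c) (hq c)⟩

theorem trans (h : PolyLe u v) (h' : PolyLe v w) : PolyLe u w := by
  obtain ⟨p, hp⟩ := h
  obtain ⟨q, hq⟩ := h'
  -- The two extra factors absorb the summand 2 in the base: (w + 2)^q + 2 ≤ (w + 2)^(q + 2).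
  refine ⟨(q + 2) * p, fun c => ?_⟩
  rw [pow_mul]
  refine (hp c).trans (Nat.pow_le_pow_left ?_ p)
  have h1 := hq c
  have h2 : 1 ≤ (w c + 2) ^ q := Nat.one_le_pow _ _ (by omega)
  rw [pow_add]
  nlinarith [Nat.pow_le_pow_left (show 2 ≤ w c + 2 by omega) 2]

theorem pow (h : PolyLe u v) (n : ℕ) : PolyLe (fun c => u c ^ n) v := by
  obtain ⟨p, hp⟩ := h
  exact ⟨p * n, fun c => by rw [pow_mul]; exact Nat.pow_le_pow_left (hp c) n⟩

theorem comp (h : PolyLe u v) (f : δ → γ) : PolyLe (fun c => u (f c)) (fun c => v (f c)) := by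
  obtain ⟨p, hp⟩ := h
  exact ⟨p, fun c => hp _⟩

theorem of_le' (hu : ∀ c, u c ≤ u' c) (h : PolyLe u' v) : PolyLe u v :=
  (of_le hu).trans h

end PolyLe

/-! ### Data as binary trees -/

/-- Binary trees. -/
inductive BTree : Type
  | leaf : BTree
  | node (a b : BTree) : BTree

/-- The prefix code of a binary tree. -/
def BTree.code : BTree → List Bool
  | leaf => [false]
  | node a b => true :: (a.code ++ b.code)

/-- Types whose elements are represented by binary trees. -/
class TreeEnc (α : Type) where
  /-- The tree that represents an element. -/
  enc : α → BTree

open TreeEnc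

instance : TreeEnc Bool := ⟨fun b => if b then .node .leaf .leaf else .leaf⟩

instance : TreeEnc Unit := ⟨fun _ => .leaf⟩

instance {α β : Type} [TreeEnc α] [TreeEnc β] : TreeEnc (α × β) := ⟨fun p => .node (enc p.1) (enc p.2)⟩

/-- Lists are right combs. -/
def encList {α : Type} [TreeEnc α] : List α → BTree
  | [] => .leaf
  | a :: l => .node (enc a) (encList l)

instance {α : Type} [TreeEnc α] : TreeEnc (List α) := ⟨encList⟩

instance : TreeEnc ℕ := ⟨fun n => enc (List.replicate n ())⟩

instance {α : Type} [TreeEnc α] : TreeEnc (Option α) := ⟨fun o => enc o.toList⟩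

/-- The code of an element. -/
def tcode {α : Type} [TreeEnc α] (a : α) : List Bool := (enc a).code

/-- The size of an element. -/
def tsize {α : Type} [TreeEnc α] (a : α) : ℕ := (tcode a).length

section

variable {α β : Type} [TreeEnc α] [TreeEnc β]

theorem BTree.code_length_pos (t : BTree) : 0 < t.code.length := by cases t <;> simp [BTree.code]

theorem tsize_pos (a : α) : 0 < tsize a := BTree.code_length_pos _

@[simp] theorem tcode_pair (a : α) (b : β) : tcode (a, b) = true :: (tcode a ++ tcode b) := rfl

@[simp] theorem tcode_nil : tcode ([] : List α) = [false] := rfl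

@[simp] theorem tcode_cons (a : α) (l : List α) : tcode (a :: l) = true :: (tcode a ++ tcode l) := rfl

@[simp] theorem tcode_true : tcode true = [true, false, false] := rfl

@[simp] theorem tcode_false : tcode false = [false] := rfl

theorem tcode_nat (n : ℕ) : tcode n = tcode (List.replicate n ()) := rfl

theorem tcode_option (o : Option α) : tcode o = tcode o.toList := rfl

@[simp] theorem tsize_pair (a : α) (b : β) : tsize (a, b) = tsize a + tsize b + 1 := by
  simp [tsize]

@[simp] theorem tsize_nil : tsize ([] : List α) = 1 := rfl

@[simp] theorem tsize_cons (a : α) (l : List α) : tsize (a :: l) = tsize a + tsize l + 1 := by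
  simp [tsize]

theorem tsize_bool_le (b : Bool) : tsize b ≤ 3 := by cases b <;> simp [tsize]

@[simp] theorem tsize_unit (u : Unit) : tsize u = 1 := rfl

@[simp] theorem tsize_nat (n : ℕ) : tsize n = 2 * n + 1 := by
  have : tsize n = tsize (List.replicate n ()) := rfl
  rw [this]
  induction n with
  | zero => rfl
  | succ n ih => rw [List.replicate_succ, tsize_cons, ih rfl]; simp; ring

@[simp] theorem tsize_none : tsize (none : Option α) = 1 := rfl

@[simp] theorem tsize_some (a : α) : tsize (some a) = tsize a + 2 := by
  have : tsize (some a) = tsize [a] := rfl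
  rw [this]; simp

theorem tsize_list (l : List α) : tsize l = (l.map fun a => tsize a + 1).sum + 1 := by
  induction l with
  | nil => rfl
  | cons a l ih => simp [ih]; ring

@[simp] theorem tsize_append (l l' : List α) : tsize (l ++ l') + 1 = tsize l + tsize l' := by
  simp [tsize_list]; ring

theorem length_le_tsize (l : List α) : l.length ≤ tsize l := by
  induction l with
  | nil => simp
  | cons a l ih => simp; omega

theorem tsize_le_of_mem {a : α} {l : List α} (h : a ∈ l) : tsize a ≤ tsize l := by
  induction l with
  | nil => simp at h
  | cons b l ih =>
    rcases List.mem_cons.1 h with rfl | h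
    · simp; omega
    · have := ih h; simp; omega

theorem tsize_list_le {l : List α} {s : ℕ} (h : ∀ a ∈ l, tsize a ≤ s) :
    tsize l ≤ l.length * (s + 1) + 1 := by
  induction l with
  | nil => simp
  | cons b l ih =>
    have h₁ := ih fun a ha => h a (List.mem_cons_of_mem _ ha)
    have h₂ := h b List.mem_cons_self
    simp only [tsize_cons, List.length_cons]
    nlinarith

end

namespace StackProg

open Turing

variable {M : FinTM2}

/-! ### Programs that move trees between stacks -/

/-- The program runs in at most the given number of steps. -/
def RunsIn (P : ExtProg M) (s : ExtReg M × (∀ k, List (ExtΓ M k))) (T : ℕ)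
    (s' : ExtReg M × (∀ k, List (ExtΓ M k))) : Prop := ∃ t ≤ T, Runs P s t s'

theorem Runs.runsIn {P : ExtProg M} {s s' : ExtReg M × (∀ k, List (ExtΓ M k))} {T : ℕ}
    (h : Runs P s T s') : RunsIn P s T s' := ⟨T, le_rfl, h⟩

theorem RunsIn.mono {P : ExtProg M} {s s' : ExtReg M × (∀ k, List (ExtΓ M k))} {T T' : ℕ}
    (h : RunsIn P s T s') (hT : T ≤ T') : RunsIn P s T' s' :=
  let ⟨t, ht, h⟩ := h
  ⟨t, ht.trans hT, h⟩

theorem RunsIn.seq {P Q : ExtProg M} {s s' s'' : ExtReg M × (∀ k, List (ExtΓ M k))} {T T' : ℕ}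
    (h : RunsIn P s T s') (h' : RunsIn Q s' T' s'') : RunsIn (seq P Q) s (T + T') s'' :=
  let ⟨t, ht, h⟩ := h
  let ⟨t', ht', h'⟩ := h'
  ⟨t + t', by omega, Runs.seq h h'⟩

/-- The bit in the register. -/
def regBit (s : ExtReg M) : Bool := (s.1.getD none).getD false

/-- Push a fixed bit. -/
def pushBit (i : Fin 4) (b : Bool) : ExtProg M := push (Sum.inl i) fun _ => b

/-- Push the bit in the register. -/
def pushReg (i : Fin 4) : ExtProg M := push (Sum.inl i) regBit

/-- Pop into the register. -/
def popSym (k : Fin 4 ⊕ M.K) (e : ExtΓ M k → Option Bool) : ExtProg M :=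
  pop k fun s o => (o.map e, s.2)

/-- Pop a bit into the register. -/
def popBit (i : Fin 4) : ExtProg M := popSym (Sum.inl i) fun b => some b

/-- Pop a bit and forget it. -/
def discard (i : Fin 4) : ExtProg M := pop (Sum.inl i) fun s _ => s

/-- Copy the top of a stack to the register. -/
def peekBit (i : Fin 4) : ExtProg M := peek (Sum.inl i) fun s o => (o.map fun b => some b, s.2)

/-- Clear the register. -/
def clearReg : ExtProg M := load fun s => (none, s.2)

/-- Empty a stack, executing a program for each symbol. -/
def drain (k : Fin 4 ⊕ M.K) (e : ExtΓ M k → Option Bool) (Q : ExtProg M) : ExtProg M :=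
  seq (popSym k e) (loop (fun s => s.1.isSome) (seq Q (popSym k e)))

/-- The family `S` describes all stacks in terms of the unread part of stack `k` and an accumulator.
The body sees the popped symbol in the register and may only change the accumulator, so the loop is
a left fold. -/
theorem runsIn_drain {k : Fin 4 ⊕ M.K} (e : ExtΓ M k → Option Bool) (Q : ExtProg M) {α : Type}
    (S : List (ExtΓ M k) → α → ∀ k, List (ExtΓ M k)) (g : α → ExtΓ M k → α) (T : ℕ)
    (l : Option M.Λ × M.σ) (hS : ∀ x a, S x a k = x)
    (hu : ∀ x a y, Function.update (S x a) k y = S y a)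
    (hQ : ∀ b x a, RunsIn Q ((some (e b), l), S x a) T ((some (e b), l), S x (g a b)))
    (x : List (ExtΓ M k)) (a : α) (r : Option (Option Bool)) :
    RunsIn (drain k e Q) ((r, l), S x a) ((T + 2) * x.length + 2) ((none, l), S [] (x.foldl g a)) := by
  have key : ∀ (x : List (ExtΓ M k)) (a : α), RunsIn (loop (fun s => s.1.isSome) (seq Q (popSym k e)))
      ((x.head?.map e, l), S x.tail a) ((T + 2) * x.length + 1)
      ((none, l), S [] (x.foldl g a)) := by
    intro x
    induction x with
    | nil =>
      intro a
      simpa using (Runs.loop_false (p := fun s : ExtReg M => s.1.isSome) (P := seq Q (popSym k e))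
        (s := ((none, l), S [] a)) rfl).runsIn
    | cons b x ih =>
      intro a
      have h₁ := Runs.pop k (fun (s : ExtReg M) o => (Option.map e o, s.2)) (some (e b), l) (S x (g a b))
      rw [hS, hu] at h₁
      obtain ⟨t, ht, h⟩ := hQ b x a
      obtain ⟨t', ht', h'⟩ := ih (g a b)
      have h₂ := Runs.loop_true (p := fun s : ExtReg M => s.1.isSome) rfl (Runs.seq h h₁) h'
      refine ⟨_, ?_, h₂⟩
      simp only [List.length_cons, mul_add]
      omega
  have h₁ := Runs.pop k (fun (s : ExtReg M) o => (Option.map e o, s.2)) (r, l) (S x a)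
  rw [hS, hu] at h₁
  exact (h₁.runsIn.seq (key x a)).mono (by omega)

/-- The loop of `withTree`. -/
def withTreeLoop (Q : ExtProg M) : ExtProg M :=
  loop (fun s => s.1.isSome) <| seq (popBit 0) <| seq Q <|
    seq (ite regBit (pushBit 3 true) (discard 3)) (peekBit 3)

/-- Remove the tree on top of the first stack, executing a program for each symbol. -/
def withTree (Q : ExtProg M) : ExtProg M :=
  seq (pushBit 3 true) <| seq (peekBit 3) (withTreeLoop Q)

/-- The prefix code delimits itself: the last stack holds in unary the number of subtrees still to
be read, a node adds one and a leaf removes one. The statement is in continuation form, with the run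
after the tree as a hypothesis, so that the case of a node is the composition of the two induction
hypotheses. -/
theorem runs_withTreeLoop (Q : ExtProg M) {α : Type} (A B : α → List Bool) (g : α → Bool → α)
    (T : ℕ) (l : Option M.Λ × M.σ) (m : ∀ k, List (M.Γ k))
    (hQ : ∀ b x d a, Runs Q ((some (some b), l), stks x (A a) (B a) d m) T
      ((some (some b), l), stks x (A (g a b)) (B (g a b)) d m)) (t : BTree) :
    ∀ (x d : List Bool) (a : α) (y : Option Bool) (T' : ℕ) (s),
      Runs (withTreeLoop Q) ((d.head?.map some, l), stks x (A (t.code.foldl g a))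
        (B (t.code.foldl g a)) d m) T' s →
      Runs (withTreeLoop Q) ((some y, l), stks (t.code ++ x) (A a) (B a) (true :: d) m)
        ((T + 5) * t.code.length + T') s := by
  induction t with
  | leaf =>
    intro x d a y T' s h
    have h₁ := Runs.pop (Sum.inl 0) (fun (s : ExtReg M) (o : Option Bool) => (o.map some, s.2))
      (some y, l) (stks (false :: x) (A a) (B a) (true :: d) m)
    have h₂ := hQ false x (true :: d) a
    have h₃ := Runs.pop (Sum.inl 3) (fun (s : ExtReg M) (o : Option Bool) => s)
      (some (some false), l) (stks x (A (g a false)) (B (g a false)) (true :: d) m)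
    have h₄ := Runs.peek (Sum.inl 3) (fun (s : ExtReg M) (o : Option Bool) => (o.map some, s.2))
      (some (some false), l) (stks x (A (g a false)) (B (g a false)) d m)
    simp only [stks_zero, stks_three, update_stks_zero, update_stks_three, List.head?_cons,
      List.tail_cons, Option.map_some] at h₁ h₃ h₄
    have h₅ := Runs.loop_true (p := fun s : ExtReg M => s.1.isSome) (by rfl)
      (Runs.seq h₁ (Runs.seq h₂ (Runs.seq (Runs.ite_false (p := regBit)
        (Q := discard 3) (P := pushBit 3 true) (by rfl) h₃) h₄))) h
    convert! h₅ using 1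
    simp [BTree.code]; ring
  | node t₁ t₂ ih₁ ih₂ =>
    intro x d a y T' s h
    have h₁ := Runs.pop (Sum.inl 0) (fun (s : ExtReg M) (o : Option Bool) => (o.map some, s.2))
      (some y, l) (stks (true :: (t₁.code ++ (t₂.code ++ x))) (A a) (B a) (true :: d) m)
    have h₂ := hQ true (t₁.code ++ (t₂.code ++ x)) (true :: d) a
    have h₃ := Runs.push (Sum.inl 3) (fun (s : ExtReg M) => true)
      (some (some true), l)
      (stks (t₁.code ++ (t₂.code ++ x)) (A (g a true)) (B (g a true)) (true :: d) m)
    have h₄ := Runs.peek (Sum.inl 3) (fun (s : ExtReg M) (o : Option Bool) => (o.map some, s.2))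
      (some (some true), l)
      (stks (t₁.code ++ (t₂.code ++ x)) (A (g a true)) (B (g a true)) (true :: true :: d) m)
    simp only [stks_zero, stks_three, update_stks_zero, update_stks_three, List.head?_cons,
      List.tail_cons, Option.map_some] at h₁ h₃ h₄
    have h₆ := ih₁ (t₂.code ++ x) (true :: d) (g a true) (some true) _ s
      (ih₂ x d (t₁.code.foldl g (g a true)) (some true) T' s (by
        simpa [BTree.code, List.foldl_append] using h))
    have h₅ := Runs.loop_true (p := fun s : ExtReg M => s.1.isSome) (by rfl)
      (Runs.seq h₁ (Runs.seq h₂ (Runs.seq (Runs.ite_true (p := regBit)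
        (Q := discard 3) (P := pushBit 3 true) (by rfl) h₃) h₄))) h₆
    convert! h₅ using 1
    · simp [BTree.code]
    · simp [BTree.code]; ring

theorem runs_withTree (Q : ExtProg M) {α : Type} (A B : α → List Bool) (g : α → Bool → α)
    (T : ℕ) (l : Option M.Λ × M.σ) (m : ∀ k, List (M.Γ k))
    (hQ : ∀ b x d a, Runs Q ((some (some b), l), stks x (A a) (B a) d m) T
      ((some (some b), l), stks x (A (g a b)) (B (g a b)) d m)) (t : BTree)
    (x : List Bool) (a : α) (r : Option (Option Bool)) :
    Runs (withTree Q) ((r, l), stks (t.code ++ x) (A a) (B a) [] m)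
      ((T + 5) * t.code.length + 3)
      ((none, l), stks x (A (t.code.foldl g a)) (B (t.code.foldl g a)) [] m) := by
  have h₀ : Runs (withTreeLoop Q) ((none, l), stks x (A (t.code.foldl g a))
      (B (t.code.foldl g a)) [] m) 1 ((none, l), stks x (A (t.code.foldl g a))
      (B (t.code.foldl g a)) [] m) := Runs.loop_false rfl
  have h₁ := runs_withTreeLoop Q A B g T l m hQ t x [] a (some true) 1 _ h₀
  have h₂ := Runs.push (Sum.inl 3) (fun (s : ExtReg M) => true) (r, l)
    (stks (t.code ++ x) (A a) (B a) [] m)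
  have h₃ := Runs.peek (Sum.inl 3) (fun (s : ExtReg M) (o : Option Bool) => (o.map some, s.2))
    (r, l) (stks (t.code ++ x) (A a) (B a) [true] m)
  simp only [stks_three, update_stks_three, List.head?_cons, Option.map_some] at h₂ h₃
  convert! Runs.seq h₂ (Runs.seq h₃ h₁) using 1
  ring

theorem foldl_cons_eq {α : Type} (x y : List α) : x.foldl (fun l a => a :: l) y = x.reverse ++ y := by
  induction x generalizing y with
  | nil => rfl
  | cons a x ih => simp [ih]

theorem foldl_cons_prod_eq {α : Type} (x : List α) (y : List α × List α) :
    x.foldl (fun l a => (a :: l.1, a :: l.2)) y = (x.reverse ++ y.1, x.reverse ++ y.2) := by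
  induction x generalizing y with
  | nil => rfl
  | cons a x ih => simp [ih]

/-- The standard configuration, with the given contents of the main stack. -/
def mconf (M : FinTM2) (x : List Bool) : ExtReg M × (∀ k, List (ExtΓ M k)) :=
  conf M x fun _ => []

theorem runs_push (i : Fin 4) (b : Bool) (r l) (S : ∀ k, List (ExtΓ M k)) :
    Runs (pushBit i b) ((r, l), S) 1 ((r, l), Function.update S (Sum.inl i) (b :: S (Sum.inl i))) :=
  Runs.push _ _ _ _

theorem runs_pushReg (i : Fin 4) (b : Bool) (l) (S : ∀ k, List (ExtΓ M k)) :
    Runs (pushReg i) ((some (some b), l), S) 1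
      ((some (some b), l), Function.update S (Sum.inl i) (b :: S (Sum.inl i))) :=
  Runs.push _ _ _ _

/-- Remove the top tree. -/
def dropTree : ExtProg M := withTree (load id)

theorem runsIn_dropTree (t : BTree) (x : List Bool) :
    RunsIn dropTree (mconf M (t.code ++ x)) (20 * t.code.length) (mconf M x) := by
  have h := runs_withTree (M := M) (load id) (α := Unit) (fun _ => []) (fun _ => []) (fun _ _ => ())
    1 (none, M.initialState) (fun _ => []) (fun b x d _ => Runs.load _ _ _) t x () none
  have := t.code_length_pos
  exact h.runsIn.mono (by omega)

/-- Exchange the two top trees. -/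
def swapTrees : ExtProg M :=
  seq (withTree (pushReg 1)) <| seq (withTree (pushReg 2)) <|
    seq (drain (Sum.inl 1) some (pushReg 0)) (drain (Sum.inl 2) some (pushReg 0))

/-- Duplicate the top tree. -/
def dupTree : ExtProg M :=
  seq (withTree (pushReg 1)) <| seq (drain (Sum.inl 1) some (seq (pushReg 0) (pushReg 2))) <|
    seq (drain (Sum.inl 2) some (pushReg 1)) (drain (Sum.inl 1) some (pushReg 0))

/-- Moving a code to an auxiliary stack reverses it, and draining that stack restores the order. The
tree returned last ends on top. -/
theorem runsIn_swapTrees (t u : BTree) (x : List Bool) :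
    RunsIn swapTrees (mconf M (t.code ++ (u.code ++ x))) (20 * (t.code.length + u.code.length))
      (mconf M (u.code ++ (t.code ++ x))) := by
  have h₁ := runs_withTree (M := M) (pushReg 1) id (fun _ => []) (fun l a => a :: l) 1
    (none, M.initialState) (fun _ => [])
    (fun b x d a => by simpa using runs_pushReg 1 b _ (stks x a [] d _))
    t (u.code ++ x) [] none
  have h₂ := runs_withTree (M := M) (pushReg 2) (fun _ => t.code.reverse) id (fun l a => a :: l) 1
    (none, M.initialState) (fun _ => [])
    (fun b x d a => by simpa using runs_pushReg 2 b _ (stks x t.code.reverse a d _))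
    u x [] none
  have h₃ := runsIn_drain (M := M) (k := Sum.inl 1) some (pushReg 0)
    (fun y a => stks a y u.code.reverse [] fun _ => [])
    (fun l a => a :: l) 1 (none, M.initialState) (fun _ _ => rfl) (fun _ _ _ => by simp)
    (fun b y a => by simpa using (runs_pushReg 0 b _ (stks a y u.code.reverse [] _)).runsIn)
    t.code.reverse x none
  have h₄ := runsIn_drain (M := M) (k := Sum.inl 2) some (pushReg 0)
    (fun y a => stks a [] y [] fun _ => [])
    (fun l a => a :: l) 1 (none, M.initialState) (fun _ _ => rfl) (fun _ _ _ => by simp)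
    (fun b y a => by simpa using (runs_pushReg 0 b _ (stks a [] y [] _)).runsIn)
    u.code.reverse (t.code ++ x) none
  simp only [foldl_cons_eq, List.append_nil, List.reverse_reverse, id] at h₁ h₂ h₃ h₄
  have := t.code_length_pos
  have := u.code_length_pos
  refine (h₁.runsIn.seq (h₂.runsIn.seq (h₃.seq h₄))).mono ?_
  simp; omega

/-- Draining the reversed code onto two stacks at once yields the copy. The second copy then passes
through an auxiliary stack once more, to have the right orientation when it reaches the main stack.
-/
theorem runsIn_dupTree (t : BTree) (x : List Bool) :
    RunsIn dupTree (mconf M (t.code ++ x)) (40 * t.code.length)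
      (mconf M (t.code ++ (t.code ++ x))) := by
  have h₁ := runs_withTree (M := M) (pushReg 1) id (fun _ => []) (fun l a => a :: l) 1
    (none, M.initialState) (fun _ => [])
    (fun b x d a => by simpa using runs_pushReg 1 b _ (stks x a [] d _))
    t x [] none
  have h₂ := runsIn_drain (M := M) (k := Sum.inl 1) some (seq (pushReg 0) (pushReg 2))
    (fun y a => stks a.1 y a.2 [] fun _ => [])
    (fun l a => (a :: l.1, a :: l.2)) 2 (none, M.initialState) (fun _ _ => rfl)
    (fun _ _ _ => by simp)
    (fun b y a => by
      simpa using (Runs.seq (runs_pushReg 0 b _ (stks a.1 y a.2 [] fun _ => []))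
        (runs_pushReg 2 b _ (Function.update (stks a.1 y a.2 [] _) _ _))).runsIn)
    t.code.reverse (x, []) none
  have h₃ := runsIn_drain (M := M) (k := Sum.inl 2) some (pushReg 1)
    (fun y a => stks (t.code ++ x) a y [] fun _ => [])
    (fun l a => a :: l) 1 (none, M.initialState) (fun _ _ => rfl) (fun _ _ _ => by simp)
    (fun b y a => by simpa using (runs_pushReg 1 b _ (stks (t.code ++ x) a y [] _)).runsIn)
    t.code [] none
  have h₄ := runsIn_drain (M := M) (k := Sum.inl 1) some (pushReg 0)
    (fun y a => stks a y [] [] fun _ => [])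
    (fun l a => a :: l) 1 (none, M.initialState) (fun _ _ => rfl) (fun _ _ _ => by simp)
    (fun b y a => by simpa using (runs_pushReg 0 b _ (stks a y [] [] _)).runsIn)
    t.code.reverse (t.code ++ x) none
  simp only [foldl_cons_eq, foldl_cons_prod_eq, List.append_nil, List.reverse_reverse, id]
    at h₁ h₂ h₃ h₄
  have := t.code_length_pos
  refine (h₁.runsIn.seq (h₂.seq (h₃.seq h₄))).mono ?_
  simp; omega

end StackProg

end

section

open TreeEnc StackProg Turing

section

namespace StackProg

variable {M : FinTM2}

theorem runsIn_branch_true {P Q : ExtProg M} {y : List Bool} {T : ℕ} {s}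
    (h : RunsIn P (mconf M y) T s) :
    RunsIn (seq (popBit 0) (ite regBit (seq clearReg P) (seq clearReg Q)))
      (mconf M (true :: y)) (T + 3) s := by
  obtain ⟨t, ht, h⟩ := h
  have h₁ := Runs.pop (Sum.inl 0) (fun (s : ExtReg M) (o : Option Bool) => (o.map some, s.2))
    (none, none, M.initialState) (stks (M := M) (true :: y) [] [] [] fun _ => [])
  simp only [stks_zero, update_stks_zero, List.head?_cons, List.tail_cons, Option.map_some] at h₁
  have h₂ := Runs.seq h₁ (Runs.ite_true (p := regBit) (Q := seq clearReg Q) (by rfl)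
    (Runs.seq (Runs.load (fun s => (none, s.2)) _ _) h))
  exact ⟨_, by omega, h₂⟩

theorem runsIn_branch_false {P Q : ExtProg M} {y : List Bool} {T : ℕ} {s}
    (h : RunsIn Q (mconf M y) T s) :
    RunsIn (seq (popBit 0) (ite regBit (seq clearReg P) (seq clearReg Q)))
      (mconf M (false :: y)) (T + 3) s := by
  obtain ⟨t, ht, h⟩ := h
  have h₁ := Runs.pop (Sum.inl 0) (fun (s : ExtReg M) (o : Option Bool) => (o.map some, s.2))
    (none, none, M.initialState) (stks (M := M) (false :: y) [] [] [] fun _ => [])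
  simp only [stks_zero, update_stks_zero, List.head?_cons, List.tail_cons, Option.map_some] at h₁
  have h₂ := Runs.seq h₁ (Runs.ite_false (p := regBit) (P := seq clearReg P) (by rfl)
    (Runs.seq (Runs.load (fun s => (none, s.2)) _ _) h))
  exact ⟨_, by omega, h₂⟩

theorem runsIn_discard (b : Bool) (x : List Bool) :
    RunsIn (discard 0) (mconf M (b :: x)) 1 (mconf M x) := by
  have h₁ := Runs.pop (Sum.inl 0) (fun (s : ExtReg M) (o : Option Bool) => s)
    (none, none, M.initialState) (stks (M := M) (b :: x) [] [] [] fun _ => [])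
  simp only [stks_zero, update_stks_zero, List.tail_cons] at h₁
  exact h₁.runsIn

theorem runsIn_pushBit (b : Bool) (x : List Bool) :
    RunsIn (pushBit 0 b) (mconf M x) 1 (mconf M (b :: x)) := by
  have h₁ := runs_push (M := M) 0 b none (none, M.initialState) (stks x [] [] [] fun _ => [])
  simp only [stks_zero, update_stks_zero] at h₁
  exact h₁.runsIn

/-- Push a fixed word. -/
def pushWord : List Bool → ExtProg M
  | [] => load id
  | b :: w => seq (pushWord w) (pushBit 0 b)

theorem runsIn_pushWord (w x : List Bool) :
    RunsIn (pushWord w) (mconf M x) (w.length + 1) (mconf M (w ++ x)) := by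
  induction w with
  | nil => exact ⟨1, by simp, Runs.load _ _ _⟩
  | cons b w ih => exact (ih.seq (runsIn_pushBit b _)).mono (by simp)

end StackProg

/-! ### Functions that are computed by programs -/

/-- The program computes the function within the given time. -/
def Computes {M : FinTM2} {α β : Type} [TreeEnc α] [TreeEnc β] (P : ExtProg M) (f : α → β)
    (T : α → ℕ) : Prop :=
  ∀ a x, RunsIn P (mconf M (tcode a ++ x)) (T a) (mconf M (tcode (f a) ++ x))

/-- The function is computed by a program in time polynomial in `B`, which also bounds
the sizes of the arguments and of the values. -/
def Eff (M : FinTM2) {α β : Type} [TreeEnc α] [TreeEnc β] (B : α → ℕ) (f : α → β) : Prop :=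
  PolyLe tsize B ∧ PolyLe (fun a => tsize (f a)) B ∧
    ∃ (P : ExtProg M) (T : α → ℕ), PolyLe T B ∧ Computes P f T

/-- The function is computable in polynomial time. -/
@[fun_prop]
def PolyTime (M : FinTM2) {α β : Type} [TreeEnc α] [TreeEnc β] (f : α → β) : Prop :=
  Eff M tsize f

variable {M : FinTM2} {α β γ δ : Type} [TreeEnc α] [TreeEnc β] [TreeEnc γ] [TreeEnc δ]

namespace Eff

theorem mono {B B' : α → ℕ} {f : α → β} (h : Eff M B f) (hB : PolyLe B B') : Eff M B' f :=
  let ⟨h₁, h₂, P, T, h₃, h₄⟩ := h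
  ⟨h₁.trans hB, h₂.trans hB, P, T, h₃.trans hB, h₄⟩

theorem comp' {Bg : β → ℕ} {B : α → ℕ} {g : β → γ} {f : α → β} (hg : Eff M Bg g) (hf : Eff M B f)
    (hB : PolyLe (fun a => Bg (f a)) B) : Eff M B (fun a => g (f a)) := by
  obtain ⟨g₁, g₂, P, T, g₃, g₄⟩ := hg
  obtain ⟨f₁, f₂, P', T', f₃, f₄⟩ := hf
  exact ⟨f₁, (g₂.comp f).trans hB, seq P' P, fun a => T' a + T (f a),
    f₃.add ((g₃.comp f).trans hB), fun a x => (f₄ a x).seq (g₄ (f a) x)⟩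

theorem comp {B : α → ℕ} {g : β → γ} {f : α → β} (hg : PolyTime M g) (hf : Eff M B f) :
    Eff M B (fun a => g (f a)) :=
  comp' hg hf hf.2.1

theorem congr_code {B : α → ℕ} {f : α → β} {g : α → γ} (hf : Eff M B f)
    (h : ∀ a, tcode (g a) = tcode (f a)) : Eff M B g := by
  obtain ⟨f₁, f₂, P, T, f₃, f₄⟩ := hf
  refine ⟨f₁, ?_, P, T, f₃, fun a x => ?_⟩
  · simpa [tsize, h] using f₂
  · rw [h]; exact f₄ a x

theorem of_code {f : α → β} (h : ∀ a, tcode (f a) = tcode a) : PolyTime M f := by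
  refine ⟨PolyLe.refl _, PolyLe.of_le fun a => ?_, load id, fun _ => 1, PolyLe.const _ _,
    fun a x => ?_⟩
  · simp [tsize, h]
  · rw [h]; exact (Runs.load _ _ _).runsIn

theorem id' {B : α → ℕ} (hB : PolyLe tsize B) : Eff M B (fun a : α => a) :=
  (of_code fun _ => rfl : PolyTime M _).mono hB

theorem const {B : α → ℕ} (hB : PolyLe tsize B) (b : β) : Eff M B (fun _ => b) := by
  refine ⟨hB, PolyLe.const _ _, seq dropTree (pushWord (tcode b)),
    fun a => 20 * tsize a + (tsize b + 1), ?_, fun a x => ?_⟩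
  · exact ((PolyLe.const _ _).mul hB).add (PolyLe.const _ _)
  · exact (runsIn_dropTree _ _).seq (runsIn_pushWord _ _)

/-- The second component is computed first, from a copy of the argument, because the first component
must end on top. One more bit turns the two codes into the code of the pair. -/
theorem pair {B : α → ℕ} {f : α → β} {g : α → γ} (hf : Eff M B f) (hg : Eff M B g) :
    Eff M B (fun a => (f a, g a)) := by
  obtain ⟨g₁, g₂, P, T, g₃, g₄⟩ := hg
  obtain ⟨f₁, f₂, P', T', f₃, f₄⟩ := hf
  refine ⟨f₁, ?_, seq dupTree (seq P (seq swapTrees (seq P' (pushBit 0 true)))),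
    fun a => 40 * tsize a + (T a + (20 * (tsize (g a) + tsize a) + (T' a + 1))), ?_, fun a x => ?_⟩
  · simpa using (f₂.add g₂).add (PolyLe.const 1 _)
  · exact ((PolyLe.const _ _).mul f₁).add (g₃.add (((PolyLe.const _ _).mul (g₂.add f₁)).add
      (f₃.add (PolyLe.const _ _))))
  · refine (runsIn_dupTree (enc a) x).seq ((g₄ a _).seq ((runsIn_swapTrees (enc (g a)) (enc a)
      x).seq ((f₄ a _).seq ?_)))
    simp only [tcode_pair, List.cons_append, List.append_assoc]
    exact runsIn_pushBit true _

theorem fst' : PolyTime M (Prod.fst : α × β → α) := by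
  refine ⟨PolyLe.refl _, PolyLe.of_le fun p => ?_, seq (discard 0) (seq swapTrees dropTree),
    fun p => 1 + (20 * (tsize p.1 + tsize p.2) + 20 * tsize p.2), ?_, fun p x => ?_⟩
  · rcases p with ⟨a, b⟩; simp; omega
  · refine PolyLe.of_le' (u' := fun p => 40 * tsize p) (fun p => ?_)
      ((PolyLe.const _ _).mul (PolyLe.refl _))
    rcases p with ⟨a, b⟩
    simp; omega
  · rcases p with ⟨a, b⟩
    simp only [tcode_pair, List.cons_append, List.append_assoc]
    exact (runsIn_discard _ _).seq ((runsIn_swapTrees (enc a) (enc b) x).seq (runsIn_dropTree _ _))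

theorem snd' : PolyTime M (Prod.snd : α × β → β) := by
  refine ⟨PolyLe.refl _, PolyLe.of_le fun p => ?_, seq (discard 0) dropTree,
    fun p => 1 + 20 * tsize p.1, ?_, fun p x => ?_⟩
  · rcases p with ⟨a, b⟩; simp; omega
  · refine PolyLe.of_le' (u' := fun p => 40 * tsize p) (fun p => ?_)
      ((PolyLe.const _ _).mul (PolyLe.refl _))
    rcases p with ⟨a, b⟩
    simp; omega
  · rcases p with ⟨a, b⟩
    simp only [tcode_pair, List.cons_append, List.append_assoc]
    exact (runsIn_discard _ _).seq (runsIn_dropTree _ _)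

theorem fst {B : γ → ℕ} {f : γ → α × β} (hf : Eff M B f) : Eff M B (fun c => (f c).1) :=
  comp fst' hf

theorem snd {B : γ → ℕ} {f : γ → α × β} (hf : Eff M B f) : Eff M B (fun c => (f c).2) :=
  comp snd' hf

/-- The first bit of the code of a Boolean decides the branch. The code of `true` leaves two further
bits, which are discarded before `f` runs. -/
theorem ite {B : α → ℕ} {b : α → Bool} {f g : α → β} (hb : Eff M B b) (hf : Eff M B f)
    (hg : Eff M B g) : Eff M B (fun a => if b a then f a else g a) := by
  obtain ⟨g₁, g₂, P, T, g₃, g₄⟩ := hg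
  obtain ⟨f₁, f₂, P', T', f₃, f₄⟩ := hf
  obtain ⟨b₁, b₂, P'', T'', b₃, b₄⟩ := hb
  refine ⟨f₁, ?_, seq dupTree (seq P'' (seq (popBit 0) (StackProg.ite regBit
    (seq clearReg (seq (discard 0) (seq (discard 0) P'))) (seq clearReg P)))),
    fun a => 40 * tsize a + (T'' a + ((T a + (T' a + 2)) + 3)), ?_, fun a x => ?_⟩
  · refine PolyLe.of_le' (fun a => ?_) (f₂.add g₂)
    dsimp only
    split_ifs <;> simp
  · exact ((PolyLe.const _ _).mul f₁).add (b₃.add ((g₃.add (f₃.add (PolyLe.const _ _))).add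
      (PolyLe.const _ _)))
  · refine (runsIn_dupTree (enc a) x).seq ((b₄ a _).seq ?_)
    by_cases h : b a = true
    · simp only [h, if_true, tcode_true]
      exact (runsIn_branch_true ((runsIn_discard _ _).seq ((runsIn_discard _ _).seq
        (f₄ a _)))).mono (by omega)
    · simp only [h, tcode_false]
      exact (runsIn_branch_false (g₄ a _)).mono (by omega)

/-- Taking a list apart costs nothing in this code: without its leading bit, the code of `a :: l` is
the codes of `a` and `l` in sequence. Two bits pushed in front of them and of `c` give the code of
`((a, l), c)`. -/
theorem listCases {B : γ → ℕ} {Bg : (α × List α) × γ → ℕ} {L : γ → List α} {f : γ → β}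
    {g : (α × List α) × γ → β} {h : γ → β} (hL : Eff M B L) (hf : Eff M B f) (hg : Eff M Bg g)
    (q : ℕ) (hB : ∀ c a l, L c = a :: l → Bg ((a, l), c) ≤ (B c + 2) ^ q)
    (h₀ : ∀ c, L c = [] → h c = f c) (h₁ : ∀ c a l, L c = a :: l → h c = g ((a, l), c)) :
    Eff M B h := by
  obtain ⟨g₁, g₂, P, T, ⟨q₂, g₃⟩, g₄⟩ := hg
  obtain ⟨f₁, f₂, P', T', f₃, f₄⟩ := hf
  obtain ⟨l₁, l₂, P'', T'', l₃, l₄⟩ := hL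
  obtain ⟨q₃, g₂⟩ := g₂
  have key : ∀ c a l, L c = a :: l → Bg ((a, l), c) + 2 ≤ (B c + 2) ^ (q + 2) := by
    intro c a l h
    have := hB c a l h
    have h2 : 1 ≤ (B c + 2) ^ q := Nat.one_le_pow _ _ (by omega)
    rw [pow_add]
    nlinarith [Nat.pow_le_pow_left (show 2 ≤ B c + 2 by omega) 2]
  refine ⟨f₁, ?_, seq dupTree (seq P'' (seq (popBit 0) (StackProg.ite regBit
    (seq clearReg (seq (pushBit 0 true) (seq (pushBit 0 true) P))) (seq clearReg P')))),
    fun c => 40 * tsize c + (T'' c + ((T' c + ((B c + 2) ^ ((q + 2) * q₂) + 2)) + 3)), ?_,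
    fun c x => ?_⟩
  · refine PolyLe.of_le' (u' := fun c => tsize (f c) + (B c + 2) ^ ((q + 2) * q₃)) (fun c => ?_)
      (f₂.add ⟨_, fun c => le_rfl⟩)
    rcases hL : L c with _ | ⟨a, l⟩
    · rw [h₀ c hL]; simp
    · rw [h₁ c a l hL, pow_mul]
      exact ((g₂ _).trans (Nat.pow_le_pow_left (key c a l hL) _)).trans (by omega)
  · exact ((PolyLe.const _ _).mul f₁).add (l₃.add ((f₃.add (PolyLe.add ⟨_, fun c => le_rfl⟩
      (PolyLe.const _ _))).add (PolyLe.const _ _)))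
  · refine (runsIn_dupTree (enc c) x).seq ((l₄ c _).seq ?_)
    rcases hL : L c with _ | ⟨a, l⟩
    · rw [h₀ c hL]
      exact (runsIn_branch_false (f₄ c _)).mono (by omega)
    · rw [h₁ c a l hL]
      have h₅ := g₄ ((a, l), c) x
      simp only [tcode_pair, tcode_cons, List.cons_append, List.append_assoc] at h₅ ⊢
      refine (runsIn_branch_true ((runsIn_pushBit _ _).seq ((runsIn_pushBit _ _).seq
        h₅))).mono ?_
      have h₆ := (g₃ ((a, l), c)).trans (Nat.pow_le_pow_left (key c a l hL) _)
      rw [← pow_mul] at h₆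
      omega

end Eff

/-! ### Folding over a list: the loop and its polynomial bounds -/

namespace StackProg

/-- Look at the first component of a pair: the register tells whether it is a leaf. -/
def testFst : ExtProg M := seq (discard 0) (seq (peekBit 0) (pushBit 0 true))

/-- Iterate while the first component of a pair is not a leaf. -/
def whileFst (P : ExtProg M) : ExtProg M :=
  seq testFst (seq (loop regBit (seq clearReg (seq P testFst))) clearReg)

theorem runs_testFst (b : Bool) (x : List Bool) :
    Runs testFst (mconf M (true :: b :: x)) 3
      ((some (some b), none, M.initialState), stks (true :: b :: x) [] [] [] fun _ => []) := by
  have h₁ := Runs.pop (Sum.inl 0) (fun (s : ExtReg M) (o : Option Bool) => s)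
    (none, none, M.initialState) (stks (M := M) (true :: b :: x) [] [] [] fun _ => [])
  have h₂ := Runs.peek (Sum.inl 0) (fun (s : ExtReg M) (o : Option Bool) => (o.map some, s.2))
    (none, none, M.initialState) (stks (M := M) (b :: x) [] [] [] fun _ => [])
  have h₃ := runs_push (M := M) 0 true (some (some b)) (none, M.initialState)
    (stks (b :: x) [] [] [] fun _ => [])
  simp only [stks_zero, update_stks_zero, List.tail_cons, List.head?_cons, Option.map_some]
    at h₁ h₂ h₃
  exact Runs.seq h₁ (Runs.seq h₂ h₃)

/-- The second bit of the code of `(l, (b, c))` tells whether `l` is empty, and this bit controls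
the loop. The time of the body is only assumed bounded at the states that the fold really reaches.
-/
theorem runsIn_whileFst {P : ExtProg M} {step : γ → β → α → β} {T : (α × List α) × (β × γ) → ℕ}
    (hP : Computes P (fun p : (α × List α) × (β × γ) => (p.1.2, (step p.2.2 p.2.1 p.1.1, p.2.2))) T)
    (c : γ) (Tm : ℕ) (x : List Bool) (l : List α) (b : β)
    (hT : ∀ l₁ a l₂, l = l₁ ++ a :: l₂ → T ((a, l₂), (l₁.foldl (step c) b, c)) ≤ Tm) :
    RunsIn (whileFst P) (mconf M (tcode (l, (b, c)) ++ x)) ((Tm + 5) * l.length + 5)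
      (mconf M (tcode (([] : List α), (l.foldl (step c) b, c)) ++ x)) := by
  have hcode : ∀ (l : List α) (b : β), ∃ y, tcode (l, (b, c)) ++ x = true :: (!l.isEmpty) :: y := by
    intro l b
    cases l <;> simp
  have key : ∀ (l : List α) (b : β),
      (∀ l₁ a l₂, l = l₁ ++ a :: l₂ → T ((a, l₂), (l₁.foldl (step c) b, c)) ≤ Tm) →
      RunsIn (loop regBit (seq clearReg (seq P testFst)))
      ((some (some !l.isEmpty), none, M.initialState), stks (tcode (l, (b, c)) ++ x) [] [] []
        fun _ => []) ((Tm + 5) * l.length + 1)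
      ((some (some false), none, M.initialState), stks (tcode (([] : List α),
        (l.foldl (step c) b, c)) ++ x) [] [] [] fun _ => []) := by
    intro l
    induction l with
    | nil => intro b _; exact ⟨1, by simp, Runs.loop_false rfl⟩
    | cons a l ih =>
      intro b hT
      obtain ⟨t, ht, h⟩ := ih (step c b a) fun l₁ a' l₂ h => by
        have := hT (a :: l₁) a' l₂ (by simp [h])
        simpa using this
      obtain ⟨t', ht', h'⟩ := hP ((a, l), (b, c)) x
      have hT' := hT [] a l rfl
      simp only [List.foldl_nil] at hT'
      obtain ⟨y, hy⟩ := hcode l (step c b a)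
      have h₂ := runs_testFst (M := M) (!l.isEmpty) y
      rw [← hy] at h₂
      have h₃ := Runs.loop_true (p := regBit) (by rfl)
        (Runs.seq (Runs.load (fun s => (none, s.2)) (some (some true), none, M.initialState) _)
          (Runs.seq h' h₂)) h
      refine ⟨_, ?_, h₃⟩
      simp only [List.length_cons]
      nlinarith
  obtain ⟨y, hy⟩ := hcode l b
  have h₂ := runs_testFst (M := M) (!l.isEmpty) y
  rw [← hy] at h₂
  obtain ⟨t, ht, h⟩ := key l b hT
  exact ⟨_, by omega, Runs.seq h₂ (Runs.seq h (Runs.load (fun s => (none, s.2)) _ _))⟩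

end StackProg

namespace Eff

/-- Iterating a polynomial time step need not take polynomial time, since the accumulator may grow
exponentially. So its size is assumed bounded after every prefix of the list, and the cost measure
of the step likewise. Each iteration then has a common polynomial bound, and the length of the list
bounds their number. -/
theorem foldl' {B : γ → ℕ} {Bs : α × β × γ → ℕ} {L : γ → List α} {init : γ → β}
    {step : γ → β → α → β} (hL : Eff M B L) (hi : Eff M B init)
    (hs : Eff M Bs (fun p : α × β × γ => step p.2.2 p.2.1 p.1)) (q : ℕ)
    (hB : ∀ c l₁ a l₂, L c = l₁ ++ a :: l₂ →
      Bs (a, l₁.foldl (step c) (init c), c) ≤ (B c + 2) ^ q)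
    (hsize : ∀ c l₁ l₂, L c = l₁ ++ l₂ →
      tsize (l₁.foldl (step c) (init c)) ≤ (B c + 2) ^ q) :
    Eff M B (fun c => (L c).foldl (step c) (init c)) := by
  set Bφ : (α × List α) × (β × γ) → ℕ := fun p => Bs (p.1.1, p.2.1, p.2.2) + tsize p with hBφ
  have hid : PolyLe tsize Bφ := PolyLe.of_le fun p => Nat.le_add_left _ _
  have hφ : Eff M Bφ (fun p : (α × List α) × (β × γ) =>
      (p.1.2, (step p.2.2 p.2.1 p.1.1, p.2.2))) := by
    refine (id' hid).fst.snd.pair (pair ?_ (id' hid).snd.snd)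
    exact comp' hs (f := fun p : (α × List α) × (β × γ) => (p.1.1, p.2.1, p.2.2))
      ((id' hid).fst.fst.pair (id' hid).snd) (PolyLe.of_le fun p => Nat.le_add_right _ _)
  obtain ⟨-, -, P, T, ⟨qT, hT⟩, hP⟩ := hφ
  obtain ⟨l₁, l₂, P₁, T₁, l₃, l₄⟩ := (hL.pair (hi.pair (id' hL.1)))
  have hc := hL.1
  have hLs := hL.2.1
  have hBpoly : PolyLe (fun c => (B c + 2) ^ q + (tsize (L c) + 1 +
      ((B c + 2) ^ q + tsize c + 1) + 1)) B :=
    PolyLe.add ⟨q, fun c => le_rfl⟩ (((hLs.add (PolyLe.const _ _)).add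
      (((PolyLe.add ⟨q, fun c => le_rfl⟩ hc).add (PolyLe.const _ _)))).add (PolyLe.const _ _))
  set Tm : γ → ℕ := fun c => ((B c + 2) ^ q + (tsize (L c) + 1 +
      ((B c + 2) ^ q + tsize c + 1) + 1) + 2) ^ qT with hTm
  have hTmP : PolyLe Tm B := (hBpoly.add (PolyLe.const 2 _)).pow qT
  have hfold : Eff M B (fun c => ((L c).foldl (step c) (init c), c)) := by
    refine ⟨hc, ?_, seq P₁ (seq (whileFst P) (seq (discard 0) (discard 0))),
      fun c => T₁ c + (((Tm c + 5) * tsize (L c) + 5) + (1 + 1)), ?_, fun c x => ?_⟩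
    · simp only [tsize_pair]
      exact ((PolyLe.of_le' (fun c => hsize c (L c) [] (by simp)) ⟨q, fun c => le_rfl⟩).add hc).add
        (PolyLe.const _ _)
    · exact l₃.add ((((hTmP.add (PolyLe.const _ _)).mul hLs).add (PolyLe.const _ _)).add
        (PolyLe.const _ _))
    -- After the loop the code begins with the bit of the outer pair and the bit of the empty list;
    -- without them it is the code of the accumulator and `c`.
    · refine (l₄ c x).seq (RunsIn.seq ?_ ((runsIn_discard true _).seq (runsIn_discard false _)))
      refine (runsIn_whileFst hP c (Tm c) x (L c) (init c) ?_).mono ?_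
      · intro l₁ a l₂ h
        refine (hT _).trans (Nat.pow_le_pow_left ?_ _)
        have h1 := hB c l₁ a l₂ h
        have h2 := hsize c l₁ (a :: l₂) h
        have h3 : tsize a + tsize l₂ + 1 ≤ tsize (L c) := by
          rw [h]
          have h4 := tsize_append l₁ (a :: l₂)
          have := tsize_pos l₁
          rw [tsize_cons] at h4
          omega
        simp only [hBφ, tsize_pair]
        omega
      · have := length_le_tsize (L c)
        nlinarith [Nat.mul_le_mul_left (Tm c + 5) this]
  exact hfold.fst

theorem foldl {B : γ → ℕ} {L : γ → List α} {init : γ → β}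
    {step : γ → β → α → β} (hL : Eff M B L) (hi : Eff M B init)
    (hs : PolyTime M (fun p : α × β × γ => step p.2.2 p.2.1 p.1)) (q : ℕ)
    (hsize : ∀ c l₁ l₂, L c = l₁ ++ l₂ →
      tsize (l₁.foldl (step c) (init c)) ≤ (B c + 2) ^ q) :
    Eff M B (fun c => (L c).foldl (step c) (init c)) := by
  obtain ⟨q', hq'⟩ : PolyLe (fun c => tsize (L c) + ((B c + 2) ^ q + tsize c + 1) + 1 +
      (B c + 2) ^ q) B :=
    ((hL.2.1.add ((PolyLe.add ⟨q, fun c => le_rfl⟩ hL.1).add (PolyLe.const _ _))).add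
      (PolyLe.const _ _)).add ⟨q, fun c => le_rfl⟩
  refine foldl' hL hi hs q' ?_ ?_
  · intro c l₁ a l₂ h
    refine le_trans ?_ (hq' c)
    have := hsize c l₁ _ h
    have : tsize a ≤ tsize (L c) := tsize_le_of_mem (by rw [h]; simp)
    simp only [tsize_pair]
    omega
  · intro c l₁ l₂ h
    have := hsize c l₁ l₂ h
    have := hq' c
    simp only at this
    omega

/-- Folding a function that enlarges the accumulator by an amount independent of it. -/
theorem foldl_add {B : γ → ℕ} {L : γ → List α} {init : γ → β}
    {step : γ → β → α → β} (hL : Eff M B L) (hi : Eff M B init)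
    (hs : PolyTime M (fun p : α × β × γ => step p.2.2 p.2.1 p.1)) (u : α × γ → ℕ)
    (hu : PolyLe u tsize)
    (hsize : ∀ c b a, tsize (step c b a) ≤ tsize b + u (a, c)) :
    Eff M B (fun c => (L c).foldl (step c) (init c)) := by
  obtain ⟨p, hp⟩ := hu
  obtain ⟨q, hq⟩ : PolyLe (fun c => tsize (init c) +
      tsize (L c) * (tsize (L c) + tsize c + 1 + 2) ^ p) B :=
    hi.2.1.add (hL.2.1.mul ((((hL.2.1.add hL.1).add (PolyLe.const _ _)).add
      (PolyLe.const _ _)).pow p))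
  refine foldl hL hi hs q fun c l₁ l₂ h => le_trans ?_ (hq c)
  -- Each step adds at most an amount that does not depend on the accumulator, so the growth is
  -- linear in the number of steps.
  have key : ∀ l : List α, (∀ a ∈ l, tsize a ≤ tsize (L c)) → ∀ b, tsize (l.foldl (step c) b) ≤
      tsize b + l.length * (tsize (L c) + tsize c + 1 + 2) ^ p := by
    intro l
    induction l with
    | nil => simp
    | cons a l ih =>
      intro hl b
      have h₁ := ih (fun a ha => hl a (List.mem_cons_of_mem _ ha)) (step c b a)
      have h₂ := hsize c b a
      have h₃ := hp (a, c)
      have h₄ := hl a List.mem_cons_self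
      have h₅ : (tsize (a, c) + 2) ^ p ≤ (tsize (L c) + tsize c + 1 + 2) ^ p :=
        Nat.pow_le_pow_left (by simp; omega) _
      simp only [List.foldl_cons, List.length_cons]
      rw [add_one_mul]
      omega
  have h₁ := key l₁ (fun a ha => tsize_le_of_mem (by rw [h]; simp [ha])) (init c)
  have h₂ : l₁.length ≤ tsize (L c) := by
    refine le_trans ?_ (length_le_tsize (L c)); rw [h]; simp
  exact h₁.trans (Nat.add_le_add_left (Nat.mul_le_mul_right _ h₂) _)

end Eff

end

section

variable {M : FinTM2} {α β γ δ : Type} [TreeEnc α] [TreeEnc β] [TreeEnc γ] [TreeEnc δ]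

namespace PolyTime

@[fun_prop] theorem id : PolyTime M (fun a : α => a) := Eff.of_code fun _ => rfl

@[fun_prop] theorem const (b : β) : PolyTime M (fun _ : α => b) := Eff.const (PolyLe.refl _) b

@[fun_prop] theorem comp {g : β → γ} {f : α → β} (hg : PolyTime M g) (hf : PolyTime M f) :
    PolyTime M (fun a => g (f a)) := Eff.comp hg hf

@[fun_prop] theorem fst : PolyTime M (fun p : α × β => p.1) := Eff.fst'

@[fun_prop] theorem snd : PolyTime M (fun p : α × β => p.2) := Eff.snd'

@[fun_prop] theorem mk {f : α → β} {g : α → γ} (hf : PolyTime M f) (hg : PolyTime M g) :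
    PolyTime M (fun a => (f a, g a)) := Eff.pair hf hg

@[fun_prop] theorem cond {b : α → Bool} {f g : α → β} (hb : PolyTime M b) (hf : PolyTime M f)
    (hg : PolyTime M g) : PolyTime M (fun a => bif b a then f a else g a) := by
  have h : PolyTime M (fun a => if b a then f a else g a) := Eff.ite hb hf hg
  simpa only [Bool.cond_eq_ite] using h

@[fun_prop] theorem not {b : α → Bool} (hb : PolyTime M b) : PolyTime M (fun a => !(b a)) := by
  have : PolyTime M (fun a => bif b a then false else true) := by fun_prop
  exact this

@[fun_prop] theorem and {b c : α → Bool} (hb : PolyTime M b) (hc : PolyTime M c) :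
    PolyTime M (fun a => b a && c a) := by
  have : PolyTime M (fun a => bif b a then c a else false) := by fun_prop
  convert! this using 2 with a
  cases b a <;> rfl

@[fun_prop] theorem or {b c : α → Bool} (hb : PolyTime M b) (hc : PolyTime M c) :
    PolyTime M (fun a => b a || c a) := by
  have : PolyTime M (fun a => bif b a then true else c a) := by fun_prop
  exact this

/-! ### Lists -/

theorem listCases {L : γ → List α} {f : γ → β} {g : (α × List α) × γ → β} {h : γ → β}
    (hL : PolyTime M L) (hf : PolyTime M f) (hg : PolyTime M g)
    (h₀ : ∀ c, L c = [] → h c = f c) (h₁ : ∀ c a l, L c = a :: l → h c = g ((a, l), c)) :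
    PolyTime M h := by
  obtain ⟨q, hq⟩ : PolyLe (fun c => tsize (L c) + tsize c + 1) tsize :=
    (hL.2.1.add (PolyLe.refl _)).add (PolyLe.const _ _)
  refine Eff.listCases hL hf hg q (fun c a l h => ?_) h₀ h₁
  have := hq c
  simp only [h, tsize_cons] at this
  simp only [tsize_pair]
  omega

theorem cons' : PolyTime M (fun p : α × List α => p.1 :: p.2) := Eff.of_code fun _ => rfl

@[fun_prop] theorem cons {f : γ → α} {L : γ → List α} (hf : PolyTime M f) (hL : PolyTime M L) :
    PolyTime M (fun c => f c :: L c) := cons'.comp (hf.mk hL)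

@[fun_prop] theorem tail {L : γ → List α} (hL : PolyTime M L) : PolyTime M (fun c => (L c).tail) :=
  listCases (f := fun _ => []) (g := fun p => p.1.2) hL (by fun_prop) (by fun_prop)
    (fun c h => by simp [h]) (fun c a l h => by simp [h])

@[fun_prop] theorem headD {L : γ → List α} {d : γ → α} (hL : PolyTime M L) (hd : PolyTime M d) :
    PolyTime M (fun c => (L c).headD (d c)) :=
  listCases (f := d) (g := fun p => p.1.1) hL hd (by fun_prop)
    (fun c h => by simp [h]) (fun c a l h => by simp [h])

@[fun_prop] theorem isEmpty {L : γ → List α} (hL : PolyTime M L) :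
    PolyTime M (fun c => (L c).isEmpty) :=
  listCases (f := fun _ => true) (g := fun _ => false) hL (by fun_prop) (by fun_prop)
    (fun c h => by simp [h]) (fun c a l h => by simp [h])

theorem foldl {L : γ → List α} {init : γ → β} {step : γ → β → α → β} (hL : PolyTime M L)
    (hi : PolyTime M init) (hs : PolyTime M (fun p : (γ × β) × α => step p.1.1 p.1.2 p.2))
    (u : α × γ → ℕ) (hu : PolyLe u tsize) (hsize : ∀ c b a, tsize (step c b a) ≤ tsize b + u (a, c)) :
    PolyTime M (fun c => (L c).foldl (step c) (init c)) :=
  Eff.foldl_add hL hi (hs.comp (f := fun p : α × β × γ => ((p.2.2, p.2.1), p.1)) (by fun_prop))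
    u hu hsize

end PolyTime

omit [TreeEnc α] [TreeEnc β] in
theorem foldl_append_flatMap (l : List α) (f : α → List β) (l' : List β) :
    l.foldl (fun acc a => acc ++ f a) l' = l' ++ l.flatMap f := by
  induction l generalizing l' with
  | nil => simp
  | cons a l ih => simp [ih]

namespace PolyTime

@[fun_prop] theorem reverse {L : γ → List α} (hL : PolyTime M L) :
    PolyTime M (fun c => (L c).reverse) := by
  have := foldl (M := M) (init := fun _ => []) (step := fun (_ : γ) acc a => a :: acc) hL (by fun_prop)
    (by fun_prop) (fun p => tsize p.1 + 1)
    (PolyLe.of_le fun p => by have : tsize p = _ := tsize_pair p.1 p.2; omega)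
    (fun c b a => by simp; omega)
  simpa using this

theorem append' : PolyTime M (fun p : List α × List α => p.1 ++ p.2) := by
  have := foldl (M := M) (L := fun p : List α × List α => p.1.reverse) (init := fun p => p.2)
    (step := fun _ acc a => a :: acc) (by fun_prop) (by fun_prop)
    (by fun_prop) (fun p => tsize p.1 + 1)
    (PolyLe.of_le fun p => by have : tsize p = _ := tsize_pair p.1 p.2; omega)
    (fun c b a => by simp; omega)
  simpa using this

@[fun_prop] theorem append {L L' : γ → List α} (hL : PolyTime M L) (hL' : PolyTime M L') :
    PolyTime M (fun c => L c ++ L' c) := append'.comp (hL.mk hL')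

end PolyTime

omit [TreeEnc α] in
theorem tsize_flatMap_le (l : List α) (f : α → List β) (s : ℕ) (h : ∀ a ∈ l, tsize (f a) ≤ s) :
    tsize (l.flatMap f) ≤ l.length * s + 1 := by
  induction l with
  | nil => simp
  | cons a l ih =>
    have h₁ := ih fun a ha => h a (List.mem_cons_of_mem _ ha)
    have h₂ := h a List.mem_cons_self
    have h₃ := tsize_append (f a) (l.flatMap f)
    simp only [List.flatMap_cons, List.length_cons]
    rw [add_one_mul]
    omega

/-- The cost of `f` has its own measure, which must be bounded only at elements of the list. This is
needed for the enumeration of cliques, which is exponential in its argument and cheap only relative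
to `reductionCost`. -/
theorem Eff.flatMap {B : γ → ℕ} {Bf : γ × α → ℕ} {L : γ → List α} {f : γ → α → List β}
    (hL : Eff M B L) (hf : Eff M Bf (fun p : γ × α => f p.1 p.2)) (q : ℕ)
    (hB : ∀ c, ∀ a ∈ L c, Bf (c, a) ≤ (B c + 2) ^ q) :
    Eff M B (fun c => (L c).flatMap (f c)) := by
  obtain ⟨q₁, h₁⟩ := hf.2.1
  have h2 : PolyLe (fun c => tsize (L c) * (((B c + 2) ^ q + 2) ^ q₁) + 1) B :=
    (hL.2.1.mul ((PolyLe.add ⟨q, fun c => le_rfl⟩ (PolyLe.const 2 _)).pow q₁)).add (PolyLe.const _ _)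
  have key : ∀ c l₁ l₂, L c = l₁ ++ l₂ →
      tsize (l₁.flatMap (f c)) ≤ tsize (L c) * (((B c + 2) ^ q + 2) ^ q₁) + 1 := by
    intro c l₁ l₂ h
    refine (tsize_flatMap_le l₁ (f c) (((B c + 2) ^ q + 2) ^ q₁) fun a ha => ?_).trans ?_
    · exact (h₁ (c, a)).trans (Nat.pow_le_pow_left (by
        have := hB c a (by rw [h]; simp [ha]); omega) _)
    · have : l₁.length ≤ tsize (L c) := by
        refine le_trans ?_ (length_le_tsize (L c)); rw [h]; simp
      exact Nat.add_le_add_right (Nat.mul_le_mul_right _ this) _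
  obtain ⟨q₂, hq₂⟩ := h2.add (PolyLe.add (u := fun c => (B c + 2) ^ q) ⟨q, fun c => le_rfl⟩
    (((hL.2.1).add h2).add ((hL.1.add (PolyLe.const 2 _)))))
  have hBs : PolyLe tsize (fun p : α × List β × γ => Bf (p.2.2, p.1) + tsize p) :=
    PolyLe.of_le fun p => Nat.le_add_left _ _
  have := Eff.foldl' (Bs := fun p : α × List β × γ => Bf (p.2.2, p.1) + tsize p)
    (init := fun _ => ([] : List β)) (step := fun c acc a => acc ++ f c a) hL
    (Eff.const hL.1 _) (Eff.comp PolyTime.append' ((Eff.id' hBs).snd.fst.pair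
      (Eff.comp' hf (f := fun p : α × List β × γ => (p.2.2, p.1))
        ((Eff.id' hBs).snd.snd.pair (Eff.id' hBs).fst)
        (PolyLe.of_le fun p => Nat.le_add_right _ _)))) q₂ ?_ ?_
  · simpa only [foldl_append_flatMap, List.nil_append] using this
  · intro c l₁ a l₂ h
    refine le_trans ?_ (hq₂ c)
    have h3 := key c l₁ (a :: l₂) h
    have h4 := hB c a (by rw [h]; simp)
    have h5 : tsize a ≤ tsize (L c) := tsize_le_of_mem (by rw [h]; simp)
    simp only [foldl_append_flatMap, List.nil_append, tsize_pair]
    omega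
  · intro c l₁ l₂ h
    refine le_trans ?_ (hq₂ c)
    have h3 := key c l₁ l₂ h
    simp only [foldl_append_flatMap, List.nil_append]
    omega

namespace PolyTime

@[fun_prop] theorem flatMap {L : γ → List α} {f : γ → α → List β} (hL : PolyTime M L)
    (hf : PolyTime M (fun p : γ × α => f p.1 p.2)) :
    PolyTime M (fun c => (L c).flatMap (f c)) := by
  obtain ⟨q, hq⟩ := (hL.2.1.add (PolyLe.refl _)).add (PolyLe.const 1 _)
  refine Eff.flatMap hL hf q fun c a ha => le_trans ?_ (hq c)
  have := tsize_le_of_mem ha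
  simp only [tsize_pair]
  omega

@[fun_prop] theorem map {L : γ → List α} {f : γ → α → β} (hL : PolyTime M L)
    (hf : PolyTime M (fun p : γ × α => f p.1 p.2)) : PolyTime M (fun c => (L c).map (f c)) := by
  have : PolyTime M (fun c => (L c).flatMap fun a => [f c a]) := by fun_prop
  convert! this using 2 with c
  exact List.map_eq_flatMap

@[fun_prop] theorem filter {L : γ → List α} {f : γ → α → Bool} (hL : PolyTime M L)
    (hf : PolyTime M (fun p : γ × α => f p.1 p.2)) : PolyTime M (fun c => (L c).filter (f c)) := by
  have : PolyTime M (fun c => (L c).flatMap fun a => bif f c a then [a] else []) := by fun_prop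
  convert! this using 2 with c
  induction L c with
  | nil => rfl
  | cons a l ih => cases h : f c a <;> simp [h, ih]

@[fun_prop] theorem all {L : γ → List α} {f : γ → α → Bool} (hL : PolyTime M L)
    (hf : PolyTime M (fun p : γ × α => f p.1 p.2)) : PolyTime M (fun c => (L c).all (f c)) := by
  have : PolyTime M (fun c => ((L c).filter fun a => !(f c a)).isEmpty) := by fun_prop
  convert! this using 2 with c
  induction L c with
  | nil => rfl
  | cons a l ih => cases h : f c a <;> simp [h, ih]

@[fun_prop] theorem any {L : γ → List α} {f : γ → α → Bool} (hL : PolyTime M L)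
    (hf : PolyTime M (fun p : γ × α => f p.1 p.2)) : PolyTime M (fun c => (L c).any (f c)) := by
  have : PolyTime M (fun c => !((L c).all fun a => !(f c a))) := by fun_prop
  simpa [List.not_all_eq_any_not] using this

/-! ### Natural numbers in unary -/

@[fun_prop] theorem units {f : γ → ℕ} (hf : PolyTime M f) :
    PolyTime M (fun c => List.replicate (f c) ()) :=
  (Eff.of_code fun _ => rfl : PolyTime M fun n : ℕ => List.replicate n ()).comp hf

/-- A number has the code of a list of units, so this function is the identity on codes. Unary
arithmetic thereby reduces to list operations. -/
theorem ofUnits : PolyTime M (fun l : List Unit => l.length) :=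
  Eff.of_code fun l => by rw [tcode_nat]; congr 1; exact (List.eq_replicate_length.2 (by simp)).symm

@[fun_prop] theorem length {L : γ → List α} (hL : PolyTime M L) :
    PolyTime M (fun c => (L c).length) := by
  have : PolyTime M (fun c => ((L c).map fun _ => ()).length) := ofUnits.comp (by fun_prop)
  simpa using this

@[fun_prop] theorem add {f g : γ → ℕ} (hf : PolyTime M f) (hg : PolyTime M g) :
    PolyTime M (fun c => f c + g c) := by
  have : PolyTime M (fun c => (List.replicate (f c) () ++ List.replicate (g c) ()).length) := by
    fun_prop
  simpa using this

@[fun_prop] theorem mul {f g : γ → ℕ} (hf : PolyTime M f) (hg : PolyTime M g) :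
    PolyTime M (fun c => f c * g c) := by
  have : PolyTime M (fun c => ((List.replicate (f c) ()).flatMap
    fun _ => List.replicate (g c) ()).length) := by fun_prop
  simpa [List.length_flatMap] using this

@[fun_prop] theorem replicate {f : γ → ℕ} {g : γ → α} (hf : PolyTime M f) (hg : PolyTime M g) :
    PolyTime M (fun c => List.replicate (f c) (g c)) := by
  have : PolyTime M (fun c => (List.replicate (f c) ()).map fun _ => g c) := by fun_prop
  simpa using this

@[fun_prop] theorem drop {n : γ → ℕ} {L : γ → List α} (hn : PolyTime M n) (hL : PolyTime M L) :
    PolyTime M (fun c => (L c).drop (n c)) := by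
  have := foldl (M := M) (L := fun c => List.replicate (n c) ()) (init := L)
    (step := fun (_ : γ) acc _ => acc.tail) (by fun_prop) (by fun_prop)
    (by fun_prop) (fun p => 0) (PolyLe.const _ _)
    (fun c b a => by cases b <;> simp; omega)
  convert! this using 2 with c
  clear this
  induction n c with
  | zero => rfl
  | succ k ih =>
    rw [List.replicate_succ', List.foldl_append, ← ih]
    simp

@[fun_prop] theorem getD {n : γ → ℕ} {L : γ → List α} {d : γ → α} (hn : PolyTime M n)
    (hL : PolyTime M L) (hd : PolyTime M d) : PolyTime M (fun c => (L c).getD (n c) (d c)) := by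
  have : PolyTime M (fun c => ((L c).drop (n c)).headD (d c)) := by fun_prop
  simpa using this

@[fun_prop] theorem sub {f g : γ → ℕ} (hf : PolyTime M f) (hg : PolyTime M g) :
    PolyTime M (fun c => f c - g c) := by
  have : PolyTime M (fun c => ((List.replicate (f c) ()).drop (g c)).length) := by fun_prop
  simpa using this

@[fun_prop] theorem ble {f g : γ → ℕ} (hf : PolyTime M f) (hg : PolyTime M g) :
    PolyTime M (fun c => Nat.ble (f c) (g c)) := by
  have : PolyTime M (fun c => (List.replicate (f c - g c) ()).isEmpty) := by fun_prop
  convert! this using 2 with c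
  rw [Bool.eq_iff_iff]
  simp [Nat.sub_eq_zero_iff_le]

@[fun_prop] theorem beq {f g : γ → ℕ} (hf : PolyTime M f) (hg : PolyTime M g) :
    PolyTime M (fun c => Nat.beq (f c) (g c)) := by
  have : PolyTime M (fun c => Nat.ble (f c) (g c) && Nat.ble (g c) (f c)) := by fun_prop
  convert! this using 2 with c
  rw [Bool.eq_iff_iff, Bool.and_eq_true, Nat.beq_eq, Nat.ble_eq, Nat.ble_eq, le_antisymm_iff]

@[fun_prop] theorem range {f : γ → ℕ} (hf : PolyTime M f) :
    PolyTime M (fun c => List.range (f c)) := by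
  -- The guard never fires in the actual computation. It makes the growth bound hold for every
  -- accumulator, as `foldl` demands: without it the appended entry could be arbitrarily large.
  have h : PolyTime M (fun c => (List.replicate (f c) ()).foldl
      (fun acc _ => bif Nat.ble (f c) acc.length then acc else acc ++ [acc.length]) []) := by
    refine foldl (by fun_prop) (by fun_prop) (by fun_prop) (fun p => 2 * f p.2 + 3) ?_ ?_
    · refine PolyLe.add ((PolyLe.const _ _).mul ?_) (PolyLe.const _ _)
      have := hf.2.1
      have h₂ : PolyLe (fun p : Unit × γ => f p.2) (fun p : Unit × γ => tsize p.2) := by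
        refine PolyLe.of_le' (fun p => ?_) (this.comp fun p : Unit × γ => p.2)
        simp; omega
      exact h₂.trans (PolyLe.of_le fun p => by rcases p with ⟨a, b⟩; simp; omega)
    · intro c b a
      cases h : Nat.ble (f c) b.length
      · have : ¬ f c ≤ b.length := by rw [← Nat.ble_eq, h]; simp
        have := tsize_append b [b.length]
        simp only [tsize_cons, tsize_nil, tsize_nat] at this
        simp only [cond_false]
        omega
      · simp
  convert! h using 2 with c
  have : ∀ k ≤ f c, List.range k = (List.replicate k ()).foldl
      (fun acc _ => bif Nat.ble (f c) acc.length then acc else acc ++ [acc.length]) [] := by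
    intro k
    induction k with
    | zero => simp
    | succ k ih =>
      intro hk
      rw [List.replicate_succ', List.foldl_append, ← ih (by omega), List.range_succ]
      have : Nat.ble (f c) k = false := by
        rw [Bool.eq_false_iff, Ne, Nat.ble_eq]; omega
      simp [this]
  exact this _ le_rfl

theorem divMod {f g : γ → ℕ} (hf : PolyTime M f) (hg : PolyTime M g) :
    PolyTime M (fun c => (f c / g c, f c % g c)) := by
  have h : PolyTime M (fun c => (List.replicate (f c) ()).foldl
      (fun p _ => bif Nat.beq (p.2 + 1) (g c) then (p.1 + 1, 0) else (p.1, p.2 + 1)) (0, 0)) := by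
    refine foldl (by fun_prop) (by fun_prop) (by fun_prop) (fun _ => 2) (PolyLe.const _ _) ?_
    rintro c ⟨a, b⟩ -
    cases Nat.beq (b + 1) (g c) <;> simp <;> omega
  convert! h using 2 with c
  induction f c with
  | zero => simp
  | succ k ih =>
    rw [List.replicate_succ', List.foldl_append, ← ih]
    simp only [List.foldl_cons, List.foldl_nil]
    -- For divisor zero the remainder is never reset, in agreement with the conventions `x / 0 = 0`
    -- and `x % 0 = x`.
    rcases Nat.eq_zero_or_pos (g c) with h₀ | h₀
    · simp [h₀]
      rfl
    have hk := Nat.div_add_mod k (g c)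
    have hlt := Nat.mod_lt k h₀
    by_cases h₁ : k % g c + 1 = g c
    · have : Nat.beq (k % g c + 1) (g c) = true := by rw [Nat.beq_eq]; exact h₁
      rw [this]
      have := (Nat.div_mod_unique h₀ (a := k + 1) (c := 0) (d := k / g c + 1)).2
        ⟨by rw [mul_add]; omega, h₀⟩
      simp [this.1, this.2]
    · have : Nat.beq (k % g c + 1) (g c) = false := by
        rw [Bool.eq_false_iff, Ne, Nat.beq_eq]; exact h₁
      rw [this]
      have := (Nat.div_mod_unique h₀ (a := k + 1) (c := k % g c + 1) (d := k / g c)).2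
        ⟨by omega, by omega⟩
      simp [this.1, this.2]

@[fun_prop] theorem div {f g : γ → ℕ} (hf : PolyTime M f) (hg : PolyTime M g) :
    PolyTime M (fun c => f c / g c) := fst.comp (divMod hf hg)

@[fun_prop] theorem mod {f g : γ → ℕ} (hf : PolyTime M f) (hg : PolyTime M g) :
    PolyTime M (fun c => f c % g c) := snd.comp (divMod hf hg)

/-! ### Options -/

theorem toList' : PolyTime M (fun o : Option α => o.toList) := Eff.of_code fun _ => rfl

theorem some' : PolyTime M (fun a : α => some a) := by
  have : PolyTime M (fun a : α => [a]) := by fun_prop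
  exact this.congr_code fun _ => rfl

@[fun_prop] theorem some {f : γ → α} (hf : PolyTime M f) : PolyTime M (fun c => some (f c)) :=
  some'.comp hf

@[fun_prop] theorem optionElim {o : γ → Option α} {f : γ → β} {g : γ → α → β}
    (ho : PolyTime M o) (hf : PolyTime M f) (hg : PolyTime M (fun p : γ × α => g p.1 p.2)) :
    PolyTime M (fun c => (o c).elim (f c) (g c)) := by
  refine listCases (L := fun c => (o c).toList) (f := f) (g := fun p => g p.2 p.1.1)
    (toList'.comp ho) hf (hg.comp (f := fun p : (α × List α) × γ => (p.2, p.1.1)) (by fun_prop))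
    ?_ ?_
  · intro c h
    cases h' : o c <;> simp [h'] at h ⊢
  · intro c a l h
    cases h' : o c <;> simp [h'] at h ⊢
    simp [h.1]

@[fun_prop] theorem optionBind {o : γ → Option α} {g : γ → α → Option β}
    (ho : PolyTime M o) (hg : PolyTime M (fun p : γ × α => g p.1 p.2)) :
    PolyTime M (fun c => (o c).bind (g c)) := by
  have : PolyTime M (fun c => (o c).elim none (g c)) := by fun_prop
  convert! this using 2 with c
  cases o c <;> rfl

end PolyTime

end

/-! ### Clocked evaluation of computable functions -/

/-- The sum of the successors of the entries, computed in unary. -/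
def listWeight (v : List ℕ) : ℕ := (v.flatMap fun x => List.replicate (x + 1) ()).length

theorem tsize_eq_listWeight (v : List ℕ) : tsize v = 2 * listWeight v + 1 := by
  induction v with
  | nil => rfl
  | cons x v ih =>
    simp only [listWeight, tsize_cons, ih, List.flatMap_cons, List.length_append,
      List.length_replicate, tsize_nat]
    ring

/-- One iteration of a clocked loop. -/
def clockedStep (φ : List ℕ → Option (List ℕ)) (n : ℕ) (s : Option (Bool × List ℕ)) :
    Option (Bool × List ℕ) :=
  s.bind fun p => bif p.1 then some p else
    bif Nat.ble (listWeight p.2) n then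
      (φ p.2).bind fun w => some (Nat.beq (w.headD 0) 0, w.tail)
    else none

/-- Evaluation of a code where loops make a limited number of iterations. -/
def clockedRun : ToPartrec.Code → ℕ → List ℕ → Option (List ℕ)
  | .zero', _, v => some (0 :: v)
  | .succ, _, v => some [v.headD 0 + 1]
  | .tail, _, v => some v.tail
  | .cons f fs, n, v => (clockedRun f n v).bind fun a => (clockedRun fs n v).bind fun b =>
      some (a.headD 0 :: b)
  | .comp f g, n, v => (clockedRun g n v).bind fun w => clockedRun f n w
  | .case f g, n, v => bif Nat.beq (v.headD 0) 0 then clockedRun f n v.tail else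
      clockedRun g n ((v.headD 0 - 1) :: v.tail)
  | .fix f, n, v => ((List.replicate n ()).foldl (fun s _ => clockedStep (clockedRun f n) n s)
      (some (false, v))).bind fun p => bif p.1 then some p.2 else none

theorem foldl_clockedStep_none (φ : List ℕ → Option (List ℕ)) (n : ℕ) (l : List Unit) :
    l.foldl (fun s _ => clockedStep φ n s) none = none := by
  induction l with
  | nil => rfl
  | cons a l ih => exact ih

theorem foldl_clockedStep_true (φ : List ℕ → Option (List ℕ)) (n : ℕ) (l : List Unit)
    (v : List ℕ) : l.foldl (fun s _ => clockedStep φ n s) (some (true, v)) = some (true, v) := by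
  induction l with
  | nil => rfl
  | cons a l ih => exact ih

theorem headD_zero (v : List ℕ) : v.headD 0 = v.headI := by cases v <;> rfl

theorem head?_getD_zero (v : List ℕ) : v.head?.getD 0 = v.headI := by cases v <;> rfl

theorem mem_comp_eval {f g : ToPartrec.Code} {v w : List ℕ} :
    w ∈ (ToPartrec.Code.comp f g).eval v ↔ ∃ u ∈ g.eval v, w ∈ f.eval u := by
  rw [ToPartrec.Code.comp_eval]
  exact Part.mem_bind_iff

/-- The body of the partial fixed point in the semantics of loops. -/
def fixBody (f : ToPartrec.Code) : List ℕ →. List ℕ ⊕ List ℕ := fun v =>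
  (f.eval v).map fun v => if v.headI = 0 then Sum.inl v.tail else Sum.inr v.tail

theorem fix_eval_eq (f : ToPartrec.Code) : (ToPartrec.Code.fix f).eval = (fixBody f).fix :=
  ToPartrec.Code.fix_eval f

theorem inl_mem_fixBody {f : ToPartrec.Code} {v w : List ℕ} :
    Sum.inl w ∈ fixBody f v ↔ ∃ u ∈ f.eval v, u.headI = 0 ∧ u.tail = w := by
  refine (Part.mem_map_iff _).trans (exists_congr fun u => and_congr_right fun _ => ?_)
  split_ifs with h <;> simp [h]

theorem inr_mem_fixBody {f : ToPartrec.Code} {v w : List ℕ} :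
    Sum.inr w ∈ fixBody f v ↔ ∃ u ∈ f.eval v, u.headI ≠ 0 ∧ u.tail = w := by
  refine (Part.mem_map_iff _).trans (exists_congr fun u => and_congr_right fun _ => ?_)
  split_ifs with h <;> simp [h]

/-- The clock can only turn a result into `none`, never into a wrong value, so an answer obtained
with any clock can be trusted. -/
theorem clockedRun_sound (c : ToPartrec.Code) (n : ℕ) :
    ∀ v w, clockedRun c n v = some w → w ∈ c.eval v := by
  induction c with
  | zero' | succ | tail =>
    intro v w h
    simp [clockedRun] at h
    subst h
    simp [head?_getD_zero]
  | cons f fs ihf ihfs =>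
    intro v w h
    simp only [clockedRun, Option.bind_eq_some_iff] at h
    obtain ⟨a, ha, b, hb, h⟩ := h
    simp only [Option.some.injEq] at h
    subst h
    simp only [ToPartrec.Code.cons_eval, Part.bind_eq_bind, Part.mem_bind_iff]
    exact ⟨a, ihf v a ha, b, ihfs v b hb, by simp [head?_getD_zero]⟩
  | comp f g ihf ihg =>
    intro v w h
    simp only [clockedRun, Option.bind_eq_some_iff] at h
    obtain ⟨a, ha, h⟩ := h
    exact mem_comp_eval.2 ⟨a, ihg v a ha, ihf a w h⟩
  | case f g ihf ihg =>
    intro v w h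
    simp only [clockedRun, headD_zero] at h
    simp only [ToPartrec.Code.case_eval]
    cases h₀ : v.headI with
    | zero => rw [h₀] at h; exact ihf _ _ h
    | succ k => rw [h₀] at h; exact ihg _ _ h
  | fix f ih =>
    have key : ∀ k v w, (List.replicate k ()).foldl
        (fun s _ => clockedStep (clockedRun f n) n s) (some (false, v)) = some (true, w) →
        w ∈ (ToPartrec.Code.fix f).eval v := by
      intro k
      induction k with
      | zero => intro v w h; simp at h
      | succ k ihk =>
        intro v w h
        rw [List.replicate_succ, List.foldl_cons] at h
        have h₁ : clockedStep (clockedRun f n) n (some (false, v)) =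
          bif Nat.ble (listWeight v) n then
          (clockedRun f n v).bind fun w => some (Nat.beq (w.headD 0) 0, w.tail) else none := rfl
        rw [h₁] at h
        cases h₂ : Nat.ble (listWeight v) n with
        | false => rw [h₂, cond_false, foldl_clockedStep_none] at h; simp at h
        | true =>
          rw [h₂, cond_true] at h
          cases h₃ : clockedRun f n v with
          | none => rw [h₃, Option.bind_none, foldl_clockedStep_none] at h; simp at h
          | some u =>
            rw [h₃, Option.bind_some] at h
            have hu := ih v u h₃
            rw [headD_zero] at h
            rw [fix_eval_eq]
            refine PFun.mem_fix_iff.2 ?_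
            by_cases h₀ : u.headI = 0
            · left
              rw [h₀] at h
              have h₄ : Nat.beq 0 0 = true := rfl
              rw [h₄, foldl_clockedStep_true] at h
              simp only [Option.some.injEq, Prod.mk.injEq, true_and] at h
              exact inl_mem_fixBody.2 ⟨u, hu, h₀, h⟩
            · right
              have h₄ : Nat.beq u.headI 0 = false := by
                rw [Bool.eq_false_iff, Ne, Nat.beq_eq]; exact h₀
              rw [h₄] at h
              refine ⟨u.tail, ?_, ?_⟩
              · exact inr_mem_fixBody.2 ⟨u, hu, h₀, rfl⟩
              · have := ihk _ _ h
                rwa [fix_eval_eq] at this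
    intro v w h
    simp only [clockedRun, Option.bind_eq_some_iff] at h
    obtain ⟨⟨b, a⟩, ha, h⟩ := h
    cases b with
    | false => simp at h
    | true =>
      simp only [cond_true, Option.some.injEq] at h
      subst h
      exact key n v _ ha

/-- A terminating evaluation makes finitely many iterations through finitely many lists, so every
clock above their number and their weights suffices. -/
theorem clockedRun_complete (c : ToPartrec.Code) :
    ∀ v w, w ∈ c.eval v → ∃ F, ∀ n, F ≤ n → clockedRun c n v = some w := by
  induction c with
  | zero' | succ | tail =>
    intro v w h
    simp at h
    subst h
    exact ⟨0, fun n _ => by simp [clockedRun, head?_getD_zero]⟩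
  | cons f fs ihf ihfs =>
    intro v w h
    simp only [ToPartrec.Code.cons_eval, Part.bind_eq_bind, Part.mem_bind_iff] at h
    obtain ⟨a, ha, b, hb, h⟩ := h
    obtain ⟨F₁, h₁⟩ := ihf v a ha
    obtain ⟨F₂, h₂⟩ := ihfs v b hb
    refine ⟨max F₁ F₂, fun n hn => ?_⟩
    simp at h
    simp [clockedRun, h₁ n (le_of_max_le_left hn), h₂ n (le_of_max_le_right hn), h, head?_getD_zero]
  | comp f g ihf ihg =>
    intro v w h
    obtain ⟨a, ha, h⟩ := mem_comp_eval.1 h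
    obtain ⟨F₁, h₁⟩ := ihg v a ha
    obtain ⟨F₂, h₂⟩ := ihf a w h
    refine ⟨max F₁ F₂, fun n hn => ?_⟩
    simp [clockedRun, h₁ n (le_of_max_le_left hn), h₂ n (le_of_max_le_right hn)]
  | case f g ihf ihg =>
    intro v w h
    simp only [ToPartrec.Code.case_eval] at h
    cases h₀ : v.headI with
    | zero =>
      rw [h₀] at h
      obtain ⟨F, hF⟩ := ihf _ _ h
      exact ⟨F, fun n hn => by simp only [clockedRun, headD_zero, h₀]; exact hF n hn⟩
    | succ k =>
      rw [h₀] at h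
      obtain ⟨F, hF⟩ := ihg _ _ h
      exact ⟨F, fun n hn => by simp only [clockedRun, headD_zero, h₀]; exact hF n hn⟩
  | fix f ih =>
    intro v w h
    rw [fix_eval_eq] at h
    -- The clock and the number of iterations are decoupled, because passing to the tail of the loop
    -- lowers only the latter.
    have key : ∃ F, ∀ n, F ≤ n → ∀ k, F ≤ k → (List.replicate k ()).foldl
        (fun s _ => clockedStep (clockedRun f n) n s) (some (false, v)) = some (true, w) := by
      refine PFun.fixInduction (C := fun v => ∃ F, ∀ n, F ≤ n → ∀ k, F ≤ k →
        (List.replicate k ()).foldl (fun s _ => clockedStep (clockedRun f n) n s)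
          (some (false, v)) = some (true, w)) h fun v hv IH => ?_
      replace hv := PFun.mem_fix_iff.1 hv
      have step : ∀ n u, listWeight v ≤ n → clockedRun f n v = some u →
          clockedStep (clockedRun f n) n (some (false, v)) =
            some (Nat.beq u.headI 0, u.tail) := by
        intro n u hn hu
        have h₂ : Nat.ble (listWeight v) n = true := by rw [Nat.ble_eq]; exact hn
        simp [clockedStep, h₂, hu, head?_getD_zero]
      rcases hv with hv | ⟨v', hv', -⟩
      · obtain ⟨u, hu, h₀, hu'⟩ := inl_mem_fixBody.1 hv
        obtain ⟨F, hF⟩ := ih v u hu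
        refine ⟨max (F + 1) (listWeight v), fun n hn k hk => ?_⟩
        obtain ⟨k, rfl⟩ : ∃ k', k = k' + 1 := ⟨k - 1, by omega⟩
        rw [List.replicate_succ, List.foldl_cons, step n u (le_of_max_le_right hn)
          (hF n (by omega))]
        rw [h₀, hu', ← foldl_clockedStep_true (clockedRun f n) n (List.replicate k ()) w]
        rfl
      · obtain ⟨F', hF'⟩ := IH v' hv'
        obtain ⟨u, hu, h₀, hu'⟩ := inr_mem_fixBody.1 hv'
        obtain ⟨F, hF⟩ := ih v u hu
        refine ⟨max (max (F + 1) (F' + 1)) (listWeight v), fun n hn k hk => ?_⟩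
        obtain ⟨k, rfl⟩ : ∃ k', k = k' + 1 := ⟨k - 1, by omega⟩
        rw [List.replicate_succ, List.foldl_cons, step n u (le_of_max_le_right hn)
          (hF n (by omega))]
        have h₄ : Nat.beq u.headI 0 = false := by
          rw [Bool.eq_false_iff, Ne, Nat.beq_eq]; exact h₀
        rw [h₄, hu']
        exact hF' n (by omega) k (by omega)
    obtain ⟨F, hF⟩ := key
    exact ⟨F, fun n hn => by simp [clockedRun, hF n hn n hn]⟩

theorem exists_code_of_computable {h : ℕ → ℕ} (hh : Computable h) :
    ∃ c : ToPartrec.Code, (∀ n k w, clockedRun c n [k] = some w → w = [h k]) ∧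
      ∀ k, ∃ F, ∀ n, F ≤ n → clockedRun c n [k] = some [h k] := by
  obtain ⟨c, hc⟩ := ToPartrec.Code.exists_code (Nat.Partrec'.part_iff₁.2 hh)
  have hc' : ∀ k, c.eval [k] = Part.some [h k] := by
    intro k
    have := hc (k ::ᵥ List.Vector.nil)
    simpa using show c.eval [k] = _ from this
  refine ⟨c, fun n k w hw => ?_, fun k => ?_⟩
  · have := clockedRun_sound c n _ _ hw
    rw [hc'] at this
    simpa using this
  · exact clockedRun_complete c _ _ (by rw [hc']; simp)

namespace PolyTime

variable {M : FinTM2} {γ : Type} [TreeEnc γ]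

@[fun_prop] theorem listWeight {L : γ → List ℕ} (hL : PolyTime M L) :
    PolyTime M (fun c => listWeight (L c)) := by
  unfold _root_.listWeight
  fun_prop

/-- The delicate case is a loop, where a polynomial time body is iterated. The guard in
`clockedStep` applies the body only to lists of weight at most the clock, so each new value is
polynomial in the clock, whatever the number of iterations before it. -/
theorem clockedRun' (c : ToPartrec.Code) :
    PolyTime M (fun p : ℕ × List ℕ => clockedRun c p.1 p.2) := by
  induction c with
  | zero' | succ | tail => simp only [clockedRun]; fun_prop
  | cons f fs ihf ihfs =>
    simp only [clockedRun]
    have h₁ : PolyTime M (fun p : (ℕ × List ℕ) × List ℕ => clockedRun fs p.1.1 p.1.2) :=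
      ihfs.comp fst
    fun_prop
  | comp f g ihf ihg =>
    simp only [clockedRun]
    have h₁ : PolyTime M (fun p : (ℕ × List ℕ) × List ℕ => clockedRun f p.1.1 p.2) :=
      ihf.comp (f := fun p : (ℕ × List ℕ) × List ℕ => (p.1.1, p.2)) (by fun_prop)
    fun_prop
  | case f g ihf ihg =>
    simp only [clockedRun]
    have h₁ : PolyTime M (fun p : ℕ × List ℕ => clockedRun f p.1 p.2.tail) :=
      ihf.comp (f := fun p : ℕ × List ℕ => (p.1, p.2.tail)) (by fun_prop)
    have h₂ : PolyTime M (fun p : ℕ × List ℕ =>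
        clockedRun g p.1 ((p.2.headD 0 - 1) :: p.2.tail)) :=
      ihg.comp (f := fun p : ℕ × List ℕ => (p.1, (p.2.headD 0 - 1) :: p.2.tail)) (by fun_prop)
    fun_prop
  | fix f ih =>
    simp only [clockedRun]
    have hstep : PolyTime M (fun p : Unit × Option (Bool × List ℕ) × (ℕ × List ℕ) =>
        clockedStep (clockedRun f p.2.2.1) p.2.2.1 p.2.1) := by
      unfold clockedStep
      have h₁ : PolyTime M (fun p : (Unit × Option (Bool × List ℕ) × (ℕ × List ℕ)) ×
          (Bool × List ℕ) => clockedRun f p.1.2.2.1 p.2.2) :=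
        ih.comp (f := fun p : (Unit × Option (Bool × List ℕ) × (ℕ × List ℕ)) ×
          (Bool × List ℕ) => (p.1.2.2.1, p.2.2)) (by fun_prop)
      fun_prop
    obtain ⟨p, hp⟩ := ih.2.1
    -- This is the base `tsize (n, v) + 2` of the bound for the body when the weight of `v` is at
    -- most the clock `n`.
    have hn : PolyLe (fun c : ℕ × List ℕ => (2 * c.1 + 1) + (2 * c.1 + 1) + 1 + 2) tsize := by
      refine PolyLe.of_le' (u' := fun c => 2 * tsize c + 10) (fun c => ?_)
        (((PolyLe.const _ _).mul (PolyLe.refl _)).add (PolyLe.const _ _))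
      rcases c with ⟨a, b⟩
      simp; omega
    obtain ⟨q, hq⟩ := ((hn.pow p).add (PolyLe.const 10 _)).add (PolyLe.refl _)
    have hfold : PolyTime M (fun c : ℕ × List ℕ => (List.replicate c.1 ()).foldl
        (fun s _ => clockedStep (clockedRun f c.1) c.1 s) (Option.some (false, c.2))) := by
      refine Eff.foldl (show PolyTime M _ by fun_prop) (show PolyTime M _ by fun_prop) hstep q
        fun c l₁ l₂ _ => le_trans ?_ (hq c)
      obtain ⟨K, hK⟩ : ∃ K, K = ((2 * c.1 + 1) + (2 * c.1 + 1) + 1 + 2) ^ p + 10 + tsize c :=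
        ⟨_, rfl⟩
      have key : ∀ (l : List Unit) s, tsize s ≤ K →
          tsize (l.foldl (fun s _ => clockedStep (clockedRun f c.1) c.1 s) s) ≤ K := by
        intro l
        induction l with
        | nil => intro s hs; exact hs
        | cons a l ihl =>
          intro s hs
          refine ihl _ ?_
          rcases s with _ | ⟨b, v⟩
          · exact hs
          · cases b with
            | true => exact hs
            | false =>
              have h₁ : clockedStep (clockedRun f c.1) c.1 (Option.some (false, v)) =
                bif Nat.ble (_root_.listWeight v) c.1 then (clockedRun f c.1 v).bind
                  fun w => Option.some (Nat.beq (w.headD 0) 0, w.tail) else none := rfl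
              dsimp only
              rw [h₁]
              cases h₂ : Nat.ble (_root_.listWeight v) c.1 with
              | false => simp; omega
              | true =>
                rw [Nat.ble_eq] at h₂
                have h₃ := hp (c.1, v)
                have h₄ : (tsize (c.1, v) + 2) ^ p ≤
                    ((2 * c.1 + 1) + (2 * c.1 + 1) + 1 + 2) ^ p := by
                  refine Nat.pow_le_pow_left ?_ _
                  simp [tsize_eq_listWeight]
                  omega
                cases h₅ : clockedRun f c.1 v with
                | none => simp; omega
                | some w =>
                  simp only [h₅, tsize_some] at h₃
                  have h₆ : tsize w.tail ≤ tsize w := by cases w <;> simp; omega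
                  have h₇ := tsize_bool_le (Nat.beq (w.headD 0) 0)
                  simp only [cond_true, Option.bind_some, tsize_some, tsize_pair]
                  omega
      refine (key l₁ _ ?_).trans hK.le
      rcases c with ⟨n, v⟩
      have := tsize_bool_le false
      simp only [tsize_some, tsize_pair] at hK ⊢
      omega
    fun_prop

@[fun_prop] theorem clockedRun (c : ToPartrec.Code) {n : γ → ℕ} {v : γ → List ℕ}
    (hn : PolyTime M n) (hv : PolyTime M v) : PolyTime M (fun a => clockedRun c (n a) (v a)) :=
  (clockedRun' c).comp (hn.mk hv)

end PolyTime

/-! ### Transfer between machine stacks and tree codes; calling a machine -/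

namespace StackProg

variable {M : FinTM2}

@[simp] theorem update_only (k : M.K) (x y : List (M.Γ k)) :
    Function.update (only M k x) k y = only M k y := Function.update_idem ..

@[simp] theorem only_self (k : M.K) (x : List (M.Γ k)) : only M k x k = x :=
  Function.update_self ..

@[simp] theorem only_nil (k : M.K) : only M k [] = fun _ => [] := by
  funext j
  by_cases h : j = k
  · subst h; simp
  · simp [only, h]

theorem runsIn_pushWord' (w x : List Bool) (s : ExtReg M) (m : ∀ k, List (M.Γ k)) :
    RunsIn (pushWord w) (s, stks x [] [] [] m) (w.length + 1) (s, stks (w ++ x) [] [] [] m) := by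
  induction w with
  | nil => exact ⟨1, by simp, Runs.load _ _ _⟩
  | cons b w ih =>
    refine (ih.seq (Runs.runsIn ?_)).mono (T := w.length + 1 + 1) (by simp)
    obtain ⟨r, l⟩ := s
    simpa using runs_push (M := M) 0 b r l (stks (w ++ x) [] [] [] m)

/-- Push the code of the list node for the symbol in the register. -/
def pushSymbol : ExtProg M :=
  ite (fun s => s.1 == some none) (pushWord [true, false]) <|
    ite regBit (pushWord (true :: tcode (some true))) (pushWord (true :: tcode (some false)))

theorem runsIn_pushSymbol (c : Option Bool) (x : List Bool) (l : Option M.Λ × M.σ)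
    (m : ∀ k, List (M.Γ k)) :
    RunsIn pushSymbol ((some c, l), stks x [] [] [] m) 10
      ((some c, l), stks (true :: (tcode c ++ x)) [] [] [] m) := by
  rcases c with _ | _ | _
  · obtain ⟨t, ht, h⟩ := runsIn_pushWord' [true, false] x (some none, l) m
    exact ⟨_, by simp at ht; omega, Runs.ite_true rfl h⟩
  · obtain ⟨t, ht, h⟩ := runsIn_pushWord' (true :: tcode (some false)) x (some (some false), l) m
    exact ⟨_, by simp [tcode_option] at ht; omega, Runs.ite_false rfl (Runs.ite_false rfl h)⟩
  · obtain ⟨t, ht, h⟩ := runsIn_pushWord' (true :: tcode (some true)) x (some (some true), l) m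
    exact ⟨_, by simp [tcode_option] at ht; omega, Runs.ite_false rfl (Runs.ite_true rfl h)⟩

/-- Move a stack of the machine to the main stack, as the code of the reversed list. -/
def readStack (k : M.K) (e : M.Γ k → Option Bool) : ExtProg M :=
  seq (pushBit 0 false) (drain (Sum.inr k) e pushSymbol)

theorem foldl_tcode_cons {α β : Type} [TreeEnc α] (e : β → α) (l : List β) (l' : List α)
    (x : List Bool) :
    l.foldl (fun y a => true :: (tcode (e a) ++ y)) (tcode l' ++ x) =
      tcode ((l.map e).reverse ++ l') ++ x := by
  induction l generalizing l' with
  | nil => simp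
  | cons a l ih =>
    have := ih (e a :: l')
    simp only [tcode_cons, List.cons_append, List.append_assoc] at this
    simp [this]

/-- The bit pushed first codes the empty list, and each symbol is prepended as it is popped, so the
list comes out reversed. `runsIn_writeStack` reverses as well; the caller compensates. -/
theorem runsIn_readStack (k : M.K) (e : M.Γ k → Option Bool) (y : List (M.Γ k)) (x : List Bool) :
    RunsIn (readStack k e) (conf M x (only M k y)) (12 * y.length + 3)
      (mconf M (tcode (y.map e).reverse ++ x)) := by
  have h₁ := runs_push (M := M) 0 false none (none, M.initialState)
    (stks x [] [] [] (only M k y))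
  have h₂ := runsIn_drain (M := M) (k := Sum.inr k) e pushSymbol
    (fun y a => stks a [] [] [] (only M k y)) (fun x a => true :: (tcode (e a) ++ x)) 10
    (none, M.initialState) (fun y a => by simp) (fun y a z => by simp)
    (fun b y a => runsIn_pushSymbol _ _ _ _) y (false :: x) none
  simp only [stks_zero, update_stks_zero] at h₁
  have h₃ := foldl_tcode_cons e y [] x
  simp only [tcode_nil, List.append_nil, List.cons_append, List.nil_append] at h₃
  rw [h₃, only_nil] at h₂
  exact (h₁.runsIn.seq h₂).mono (by omega)

/-- Move the symbol on top of the main stack to a stack of the machine. -/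
def writeSymbol (k : M.K) (e : Option Bool → M.Γ k) : ExtProg M :=
  seq (popBit 0) <| seq (ite regBit (seq (popBit 0) <| ite regBit
      (seq (discard 0) <| seq (discard 0) <| seq (discard 0) <|
        push (Sum.inr k) fun _ => e (some true))
      (seq (discard 0) <| push (Sum.inr k) fun _ => e (some false)))
    (push (Sum.inr k) fun _ => e none)) clearReg

/-- Move the list on top of the main stack to a stack of the machine. -/
def writeStack (k : M.K) (e : Option Bool → M.Γ k) : ExtProg M :=
  seq (seq (popBit 0) (loop regBit (seq clearReg (seq (writeSymbol k e) (popBit 0))))) clearReg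

theorem runs_popBit (b : Bool) (x : List Bool) (r l) (m : ∀ k, List (M.Γ k)) :
    Runs (popBit 0) ((r, l), stks (b :: x) [] [] [] m) 1
      ((some (some b), l), stks x [] [] [] m) := by
  have := Runs.pop (Sum.inl 0) (fun (s : ExtReg M) (o : Option Bool) => (o.map some, s.2))
    (r, l) (stks (b :: x) [] [] [] m)
  simp only [stks_zero, update_stks_zero, List.tail_cons, List.head?_cons, Option.map_some] at this
  exact this

theorem runs_discard (b : Bool) (x : List Bool) (s : ExtReg M) (m : ∀ k, List (M.Γ k)) :
    Runs (discard 0) (s, stks (b :: x) [] [] [] m) 1 (s, stks x [] [] [] m) := by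
  have := Runs.pop (Sum.inl 0) (fun (s : ExtReg M) (o : Option Bool) => s)
    s (stks (b :: x) [] [] [] m)
  simp only [stks_zero, update_stks_zero, List.tail_cons] at this
  exact this

theorem runs_pushOnly (k : M.K) (a : M.Γ k) (x : List Bool) (s : ExtReg M) (y : List (M.Γ k)) :
    Runs (push (Sum.inr k) fun _ => a) (s, stks x [] [] [] (only M k y)) 1
      (s, stks x [] [] [] (only M k (a :: y))) := by
  simpa using Runs.push (Sum.inr k) (fun (s : ExtReg M) => a) s (stks x [] [] [] (only M k y))

theorem runs_clearReg (r) (l : Option M.Λ × M.σ) (S : ∀ k, List (ExtΓ M k)) :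
    Runs clearReg ((r, l), S) 1 ((none, l), S) := Runs.load (fun s => (none, s.2)) _ _

theorem runsIn_writeSymbol (k : M.K) (e : Option Bool → M.Γ k) (c : Option Bool) (x : List Bool)
    (y : List (M.Γ k)) : RunsIn (writeSymbol k e) (conf M (tcode c ++ x) (only M k y)) 10
      (conf M x (only M k (e c :: y))) := by
  rcases c with _ | _ | _
  · exact ⟨_, by norm_num, Runs.seq (runs_popBit _ _ _ _ _) (Runs.seq (Runs.ite_false rfl
      (runs_pushOnly _ _ _ _ _)) (runs_clearReg _ _ _))⟩
  · exact ⟨_, by norm_num, Runs.seq (runs_popBit _ _ _ _ _) (Runs.seq (Runs.ite_true rfl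
      (Runs.seq (runs_popBit _ _ _ _ _) (Runs.ite_false rfl (Runs.seq (runs_discard _ _ _ _)
      (runs_pushOnly _ _ _ _ _))))) (runs_clearReg _ _ _))⟩
  · exact ⟨_, by norm_num, Runs.seq (runs_popBit _ _ _ _ _) (Runs.seq (Runs.ite_true rfl
      (Runs.seq (runs_popBit _ _ _ _ _) (Runs.ite_true rfl (Runs.seq (runs_discard _ _ _ _)
      (Runs.seq (runs_discard _ _ _ _) (Runs.seq (runs_discard _ _ _ _)
      (runs_pushOnly _ _ _ _ _))))))) (runs_clearReg _ _ _))⟩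

theorem runsIn_writeStack (k : M.K) (e : Option Bool → M.Γ k) (w : List (Option Bool))
    (x : List Bool) :
    RunsIn (writeStack k e) (mconf M (tcode w ++ x)) (20 * w.length + 3)
      (conf M x (only M k (w.map e).reverse)) := by
  have key : ∀ (w : List (Option Bool)) (y : List (M.Γ k)),
      RunsIn (seq (popBit 0) (loop regBit (seq clearReg (seq (writeSymbol k e) (popBit 0)))))
      (conf M (tcode w ++ x) (only M k y)) (20 * w.length + 2)
      ((some (some false), none, M.initialState),
        stks x [] [] [] (only M k ((w.map e).reverse ++ y))) := by
    intro w
    induction w with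
    | nil =>
      intro y
      exact ⟨2, by simp, Runs.seq (runs_popBit _ _ _ _ _) (Runs.loop_false rfl)⟩
    | cons c w ih =>
      intro y
      obtain ⟨t, ht, h⟩ := ih (e c :: y)
      -- The run for the tail is a pop followed by the loop. Here that pop becomes the end of the
      -- first iteration's body.
      cases h with | @seq _ _ _ s' _ t₁ t₂ h₁ h₂ =>
      have hc : (List.map e (c :: w)).reverse ++ y = (List.map e w).reverse ++ e c :: y := by simp
      rw [hc]
      obtain ⟨t₃, ht₃, h₃⟩ := runsIn_writeSymbol k e c (tcode w ++ x) y
      have h₄ := runs_popBit true (tcode c ++ (tcode w ++ x)) none (none, M.initialState)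
        (only M k y)
      rw [tcode_cons, List.cons_append, List.append_assoc]
      refine ⟨_, ?_, Runs.seq h₄ (Runs.loop_true rfl
        (Runs.seq (runs_clearReg _ _ _) (Runs.seq h₃ h₁)) h₂)⟩
      simp only [List.length_cons]
      omega
  have h := key w []
  simp only [only_nil, List.append_nil] at h
  exact (h.seq (runs_clearReg _ _ _).runsIn).mono (by omega)

/-- The main stack `x` survives the call, so data for interpreting the answer can wait there. -/
theorem runsIn_callMachine (M : FinTM2) : ∃ (P : ExtProg M) (T : ℕ), ∀ (n : ℕ)
    (w : List (M.Γ M.k₀)) (y : List (M.Γ M.k₁)),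
    (flip Bind.bind M.step)^[n] (some (initList M w)) = some (haltList M y) → ∀ x,
      RunsIn P (conf M x (only M M.k₀ w)) (T * n + 2) (conf M x (only M M.k₁ y)) := by
  obtain ⟨T, hT⟩ := runs_machineLoop M
  refine ⟨seq (load fun s => (s.1, some M.main, s.2.2)) machineLoop, T, fun n w y h x => ?_⟩
  obtain ⟨t, ht, h'⟩ := hT n _ _ rfl h none x [] [] []
  rw [initList_stk, haltList_stk] at h'
  exact ⟨_, by omega, Runs.seq (Runs.load _ _ _) h'⟩

/-- Move the bit on the main stack to a stack of the machine. -/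
def writeBit (k : M.K) (e : Bool → M.Γ k) : ExtProg M :=
  seq (popBit 0) <| seq (ite regBit (seq (discard 0) <| seq (discard 0) <|
        push (Sum.inr k) fun _ => e true) (push (Sum.inr k) fun _ => e false)) clearReg

theorem runsIn_writeBit (k : M.K) (e : Bool → M.Γ k) (b : Bool) :
    RunsIn (writeBit k e) (mconf M (tcode b)) 10 (conf M [] (only M k [e b])) := by
  have hm : mconf M (tcode b) = conf M (tcode b) (only M k []) := by rw [only_nil]; rfl
  rw [hm]
  cases b
  · exact ⟨_, by norm_num, Runs.seq (runs_popBit _ _ _ _ _) (Runs.seq (Runs.ite_false rfl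
      (runs_pushOnly _ _ _ _ _)) (runs_clearReg _ _ _))⟩
  · exact ⟨_, by norm_num, Runs.seq (runs_popBit _ _ _ _ _) (Runs.seq (Runs.ite_true rfl
      (Runs.seq (runs_discard _ _ _ _) (Runs.seq (runs_discard _ _ _ _)
      (runs_pushOnly _ _ _ _ _)))) (runs_clearReg _ _ _))⟩

end StackProg

/-- A machine that transforms its input, calls a given machine once, and transforms the answer
to a bit. -/
theorem exists_machine_of_query (M : Machine) {δ : Type} [TreeEnc δ]
    {B : List (Option Bool) → ℕ} {pre : List (Option Bool) → List (Option Bool) × δ}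
    {post : List Bool × δ → Bool} (hpre : Eff M.tm B pre) (hpost : PolyTime M.tm post) :
    ∃ (M' : Machine) (p : ℕ), ∀ x y (T : ℕ), OutputsWithin M (pre x).1 y T →
      OutputsWithin M' x [post (y, (pre x).2)] (((B x + T + y.length + 2) ^ p : ℕ) : ℝ) := by
  -- The preprocessing is conjugated by reversal, because reading the input and writing the query
  -- both reverse.
  have hrev : Eff M.tm (fun x => B x.reverse)
      (fun x : List (Option Bool) => ((pre x.reverse).1.reverse, (pre x.reverse).2)) := by
    have h₁ : Eff M.tm (fun x => B x.reverse) (fun x : List (Option Bool) => pre x.reverse) := by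
      refine Eff.comp' hpre ((show PolyTime M.tm (fun x : List (Option Bool) => x.reverse) by
        fun_prop).mono ?_) (PolyLe.refl _)
      refine PolyLe.of_le' (fun x => ?_) (hpre.1.comp List.reverse)
      simp [tsize_list]
    exact (Eff.comp (show PolyTime M.tm (fun p : List (Option Bool) × δ => (p.1.reverse, p.2)) by
      fun_prop) h₁)
  -- The answer is read in reverse and with its bits embedded in the three-letter alphabet; both are
  -- undone before `post`.
  have hpost' : PolyTime M.tm (fun p : List (Option Bool) × δ =>
      post (p.1.reverse.map fun o => o.elim false fun b => b, p.2)) := by fun_prop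
  obtain ⟨hr₁, hr₂, P₁, T₁, hT₁, hP₁⟩ := hrev
  obtain ⟨hs₁, hs₂, P₂, T₂, hT₂, hP₂⟩ := hpost'
  obtain ⟨P₃, T₃, hP₃⟩ := runsIn_callMachine M.tm
  obtain ⟨q₁, hq₁⟩ := hT₁
  obtain ⟨q₂, hq₂⟩ := hr₂
  obtain ⟨q₃, hq₃⟩ := hT₂
  obtain ⟨q₄, hq₄⟩ := hpre.1
  set X : List (Option Bool) × List Bool × ℕ → ℕ := fun z => B z.1 + z.2.2 + z.2.1.length with hX
  have hB : PolyLe (fun z => B z.1) X := PolyLe.of_le fun z => by simp only [X]; omega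
  have hn : PolyLe (fun z : List (Option Bool) × List Bool × ℕ => z.2.2) X :=
    PolyLe.of_le fun z => by simp only [X]; omega
  have hl : PolyLe (fun z : List (Option Bool) × List Bool × ℕ => z.2.1.length) X :=
    PolyLe.of_le fun z => by simp only [X]; omega
  obtain ⟨p, hp⟩ : PolyLe (fun z : List (Option Bool) × List Bool × ℕ =>
      (12 * (B z.1 + 2) ^ q₄ + 3) + ((B z.1 + 2) ^ q₁ + (1 + ((20 * (B z.1 + 2) ^ q₂ + 3) +
        ((T₃ * z.2.2 + 2) + ((12 * z.2.1.length + 3) + (1 +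
          ((6 * z.2.1.length + 1 + (B z.1 + 2) ^ q₂ + 1 + 2) ^ q₃ + 10))))))) + 1) X := by
    have hB2 : ∀ q, PolyLe (fun z => (B z.1 + 2) ^ q) X := fun q =>
      (hB.add (PolyLe.const 2 _)).pow q
    have hc : ∀ n, PolyLe (fun _ => n) X := fun n => PolyLe.const n _
    exact ((((hc _).mul (hB2 _)).add (hc _)).add ((hB2 _).add ((hc _).add
      ((((hc _).mul (hB2 _)).add (hc _)).add ((((hc _).mul hn).add (hc _)).add
      ((((hc _).mul hl).add (hc _)).add ((hc _).add (((((((hc _).mul hl).add (hc _)).add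
      (hB2 _)).add (hc _)).add (hc _)).pow _ |>.add (hc _))))))))).add (hc _)
  refine ⟨toMachine M (seq (readStack M.tm.k₀ M.inputAlphabet) (seq P₁ (seq (discard 0)
    (seq (writeStack M.tm.k₀ M.inputAlphabet.symm) (seq P₃ (seq (readStack M.tm.k₁
      fun a => some (M.outputAlphabet a)) (seq (pushBit 0 true) (seq P₂ (writeBit M.tm.k₁
        M.outputAlphabet.symm))))))))), p, fun x y T hT => ?_⟩
  obtain ⟨n, hn, ⟨⟨⟨n', hn'⟩, hnn⟩⟩⟩ := hT
  have hnT : n' ≤ T := hnn.trans (by exact_mod_cast hn)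
  have r₁ := runsIn_readStack M.tm.k₀ M.inputAlphabet (x.map M.inputAlphabet.invFun) []
  have e₁ : ((x.map M.inputAlphabet.invFun).map M.inputAlphabet).reverse = x.reverse := by
    simp [Function.comp_def]
  rw [e₁, List.append_nil] at r₁
  have r₂ := hP₁ x.reverse []
  simp only [List.reverse_reverse, List.append_nil, tcode_pair] at r₂
  have r₃ := runsIn_discard (M := M.tm) true
    (tcode (pre x).1.reverse ++ tcode (pre x).2)
  have r₄ := runsIn_writeStack M.tm.k₀ M.inputAlphabet.symm (pre x).1.reverse (tcode (pre x).2)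
  rw [List.map_reverse, List.reverse_reverse] at r₄
  have r₅ := hP₃ n' _ _ hn' (tcode (pre x).2)
  have r₆ := runsIn_readStack M.tm.k₁ (fun a => some (M.outputAlphabet a))
    (y.map M.outputAlphabet.invFun) (tcode (pre x).2)
  have e₂ : ((y.map M.outputAlphabet.invFun).map
      fun a => some (M.outputAlphabet a)).reverse = (y.map some).reverse := by
    simp [Function.comp_def]
  rw [e₂] at r₆
  have r₇ := runsIn_pushBit (M := M.tm) true (tcode (y.map some).reverse ++ tcode (pre x).2)
  have r₈ := hP₂ ((y.map some).reverse, (pre x).2) []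
  simp only [tcode_pair, List.append_nil, List.reverse_reverse, List.map_map] at r₈
  have e₃ : y.map ((fun o : Option Bool => o.elim false fun b => b) ∘ some) = y := by
    simp [Function.comp_def]
  rw [e₃] at r₈
  have r₉ := runsIn_writeBit M.tm.k₁ M.outputAlphabet.symm (post (y, (pre x).2))
  obtain ⟨t, ht, h⟩ := r₁.seq (r₂.seq (r₃.seq (r₄.seq (r₅.seq (r₆.seq (r₇.seq (r₈.seq r₉)))))))
  refine outputsWithin_toMachine M _ x _ t h _ ?_
  refine Nat.cast_le.2 (le_trans ?_ (hp (x, y, T)))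
  have b₁ : x.length ≤ (B x + 2) ^ q₄ := (length_le_tsize x).trans (hq₄ x)
  have b₂ : T₁ x.reverse ≤ (B x + 2) ^ q₁ := by simpa using hq₁ x.reverse
  have b₃ : tsize (pre x).1.reverse + tsize (pre x).2 + 1 ≤ (B x + 2) ^ q₂ := by
    simpa using hq₂ x.reverse
  have b₄ : (pre x).1.reverse.length ≤ tsize (pre x).1.reverse := length_le_tsize _
  have b₅ : tsize (y.map some).reverse ≤ 6 * y.length + 1 := by
    have : ∀ a ∈ (y.map some).reverse, tsize a ≤ 5 := by
      intro a ha
      simp only [List.mem_reverse, List.mem_map] at ha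
      obtain ⟨b, -, rfl⟩ := ha
      have := tsize_bool_le b
      simp; omega
    have := tsize_list_le this
    simp at this ⊢
    omega
  have b₆ : T₂ ((y.map some).reverse, (pre x).2) ≤
      (6 * y.length + 1 + (B x + 2) ^ q₂ + 1 + 2) ^ q₃ := by
    refine (hq₃ _).trans (Nat.pow_le_pow_left ?_ _)
    rw [tsize_pair]
    omega
  have b₇ : T₃ * n' ≤ T₃ * T := Nat.mul_le_mul_left _ hnT
  simp only [List.length_map] at ht
  dsimp only
  omega

section

/-! ### The reduction as a function on words -/

/-- One step of splitting a word at its separators. -/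
def tokenStep (p : List (List Bool) × List Bool) (c : Option Bool) :
    List (List Bool) × List Bool :=
  c.elim (p.2.reverse :: p.1, []) fun b => (p.1, b :: p.2)

/-- The blocks of a word that are terminated by separators. -/
def tokenize (x : List (Option Bool)) : List (List Bool) :=
  (x.foldl tokenStep ([], [])).1.reverse

/-- The number of groups, the number of vertices, the rows of the adjacency matrix and the
groups of the vertices. -/
abbrev Inst : Type := ℕ × ℕ × List (List Bool) × List ℕ

/-- Read an instance. -/
def parseInst (x : List (Option Bool)) : Inst :=
  (((tokenize x).getD 0 []).length, ((tokenize x).getD 1 []).length, (tokenize x).drop 2,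
    ((tokenize x).drop (2 + ((tokenize x).getD 1 []).length)).map fun w => w.length)

/-- Membership in the union of sets of vertices. -/
def unionMem (ms : List (List Bool)) (u : ℕ) : Bool := ms.any fun w => w.getD u false

/-- Test whether the union of the sets is a clique. -/
def isCliqueUnion (I : Inst) (ms : List (List Bool)) : Bool :=
  (List.range I.2.1).all fun u => (List.range I.2.1).all fun v =>
    !(unionMem ms u && unionMem ms v) || (Nat.beq u v || (I.2.2.1.getD u []).getD v false)

/-- The size of the union of the sets. -/
def unionCard (I : Inst) (ms : List (List Bool)) : ℕ :=
  ((List.range I.2.1).filter fun u => unionMem ms u).length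

/-- Test whether digit `i` of `x` in base `q` is zero. -/
def zeroDigit (q i x : ℕ) : Bool :=
  Nat.beq ((List.replicate i ()).foldl (fun y _ => y / q) x % q) 0

/-- The vertices whose group has digit `i` equal to zero. -/
def blockVertices (I : Inst) (q i : ℕ) : List Bool :=
  (List.range I.2.1).map fun v => zeroDigit q i (I.2.2.2.getD v 0)

/-- The number of groups with digit `i` equal to zero. -/
def blockCard (I : Inst) (q i : ℕ) : ℕ := ((List.range I.1).filter fun x => zeroDigit q i x).length

/-- Extend subsets by one position. -/
def extendMasks (acc : List (List Bool)) (b : Bool) : List (List Bool) :=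
  (acc.map fun w => false :: w) ++ bif b then acc.map fun w => true :: w else []

/-- All subsets of a set. -/
def subsets (s : List Bool) : List (List Bool) := s.reverse.foldl extendMasks [[]]

/-- The vertices of the new graph with first component `i`: the cliques that meet each group
of the block. -/
def blockCliques (I : Inst) (q i : ℕ) : List (ℕ × List Bool) :=
  ((subsets (blockVertices I q i)).filter fun w =>
    isCliqueUnion I [w] && Nat.beq (unionCard I [w]) (blockCard I q i)).map fun w => (i, w)

/-- The vertices of the new graph. -/
def newVertices (I : Inst) (k q : ℕ) : List (ℕ × List Bool) :=
  (List.range k).flatMap fun i => blockCliques I q i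

/-- Adjacency in the new graph. -/
def newAdj (I : Inst) (e e' : ℕ × List Bool) : Bool :=
  !(Nat.beq e.1 e'.1) && isCliqueUnion I [e.2, e'.2]

/-- The encoding of the new graph and the parameter. -/
def newInput (I : Inst) (k : ℕ) (vs : List (ℕ × List Bool)) : List (Option Bool) :=
  (List.replicate k (some true) ++ [none]) ++ ((List.replicate vs.length (some true) ++ [none]) ++
    vs.flatMap fun e => (vs.map fun e' => some (newAdj I e e')) ++ [none])

section
variable (c₁ c₂ : ToPartrec.Code)

/-- The value of `c₂` if the evaluation of both codes succeeds and the value of `c₁` is small. -/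
def goodParam (n k : ℕ) : Option ℕ :=
  (clockedRun c₁ n [k]).bind fun a => (clockedRun c₂ n [k]).bind fun b =>
    bif Nat.ble (a.headD 0) n && (Nat.ble 1 (b.headD 0) && Nat.ble 1 k) then some (b.headD 0)
    else none

/-- The parameters that are used for `n` groups. -/
def params (n : ℕ) : ℕ × ℕ :=
  ((List.range (n + 1)).flatMap fun k =>
    (goodParam c₁ c₂ n k).elim [] fun q => [(k, q)]).reverse.headD (1, 1)

/-- The instance with its parameters. -/
def parseParams (x : List (Option Bool)) : Inst × ℕ × ℕ :=
  (parseInst x, params c₁ c₂ (parseInst x).1)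

/-- The instance and the vertices of the new graph. -/
def parseVertices (x : List (Option Bool)) : Inst × List (ℕ × List Bool) :=
  ((parseInst x), newVertices (parseInst x) (params c₁ c₂ (parseInst x).1).1
    (params c₁ c₂ (parseInst x).1).2)

/-- The query and the data that are needed to interpret the answer. -/
def reduction (x : List (Option Bool)) :
    List (Option Bool) × Inst × List (ℕ × List Bool) :=
  (newInput (parseInst x) (params c₁ c₂ (parseInst x).1).1
    (bif (parseVertices c₁ c₂ x).2.isEmpty then [(0, [])] else (parseVertices c₁ c₂ x).2),
    parseVertices c₁ c₂ x)

/-- The time bound of the reduction. -/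
def reductionCost (x : List (Option Bool)) : ℕ :=
  tsize x + ((List.range (params c₁ c₂ (parseInst x).1).1).map fun i =>
    2 ^ (blockVertices (parseInst x) (params c₁ c₂ (parseInst x).1).2 i).count true).sum

end

/-- Interpretation of a bit. -/
def decodeBit (p : List Bool × Inst × List (ℕ × List Bool)) : Bool :=
  p.1.headD false && !(p.2.2.isEmpty)

/-- The sets that belong to the selected vertices. -/
def selected (y : List Bool) (vs : List (ℕ × List Bool)) : List (List Bool) :=
  ((List.range vs.length).filter fun a => y.getD a false).map fun a => (vs.getD a (0, [])).2

/-- Interpretation of a set of vertices. -/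
def decodeSet (D : ℕ) (p : List Bool × Inst × List (ℕ × List Bool)) : Bool :=
  isCliqueUnion p.2.1 (selected p.1 p.2.2) &&
    Nat.ble ((D - 1) * p.2.1.1) (D * unionCard p.2.1 (selected p.1 p.2.2))

theorem subsets_nil : subsets [] = [[]] := rfl

theorem subsets_cons (b : Bool) (s : List Bool) :
    subsets (b :: s) = extendMasks (subsets s) b := by simp [subsets]

theorem length_subsets (s : List Bool) : (subsets s).length = 2 ^ s.count true := by
  induction s with
  | nil => rfl
  | cons b s ih => cases b <;> simp [subsets_cons, extendMasks, ih, pow_succ, mul_two]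

theorem length_of_mem_subsets {s w : List Bool} (h : w ∈ subsets s) : w.length = s.length := by
  induction s generalizing w with
  | nil => simp [subsets_nil] at h; simp [h]
  | cons b s ih =>
    rw [subsets_cons, extendMasks, List.mem_append] at h
    rcases h with h | h
    · obtain ⟨w', hw', rfl⟩ := List.mem_map.1 h
      simp [ih hw']
    · cases b
      · simp at h
      · obtain ⟨w', hw', rfl⟩ := List.mem_map.1 h
        simp [ih hw']

/-! ### Running time of the reduction -/

variable {M : FinTM2} {α β γ δ : Type} [TreeEnc α] [TreeEnc β] [TreeEnc γ] [TreeEnc δ]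

theorem tsize_bools_le (w : List Bool) : tsize w ≤ w.length * 4 + 1 :=
  tsize_list_le fun b _ => tsize_bool_le b

theorem tsize_subsets_le (s : List Bool) :
    tsize (subsets s) ≤ 2 ^ s.count true * (s.length * 4 + 2) + 1 := by
  have := tsize_list_le (l := subsets s) (s := s.length * 4 + 1) fun w hw => by
    rw [← length_of_mem_subsets hw]; exact tsize_bools_le w
  rwa [length_subsets] at this

/-- After each prefix of the fold the accumulator lists the subsets of a final segment of `s`, so it
is never larger than the bound for `s` itself. -/
theorem eff_subsets : Eff M (fun s : List Bool => tsize s + 2 ^ s.count true) subsets := by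
  have hB : PolyLe tsize (fun s : List Bool => tsize s + 2 ^ s.count true) :=
    PolyLe.of_le fun s => Nat.le_add_right _ _
  have h2 : PolyLe (fun s : List Bool => 2 ^ s.count true)
    (fun s : List Bool => tsize s + 2 ^ s.count true) := PolyLe.of_le fun s => Nat.le_add_left _ _
  obtain ⟨q, hq⟩ := (h2.mul ((hB.mul (PolyLe.const 4 _)).add (PolyLe.const 2 _))).add
    (PolyLe.const 1 _)
  refine Eff.foldl (L := fun s : List Bool => s.reverse) (init := fun _ => [[]])
    (step := fun _ => extendMasks) ((show PolyTime M _ by fun_prop).mono hB) (Eff.const hB _) ?_ q ?_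
  · unfold extendMasks
    fun_prop
  · intro s l₁ l₂ h
    have h₁ : l₁.foldl extendMasks [[]] = subsets l₁.reverse := by simp [subsets]
    rw [h₁]
    refine (tsize_subsets_le _).trans (le_trans ?_ (hq s))
    have h₃ : s = l₂.reverse ++ l₁.reverse := by
      rw [← List.reverse_append, ← h, List.reverse_reverse]
    have h₄ : l₁.reverse.count true ≤ s.count true := by rw [h₃]; simp
    have h₅ : l₁.reverse.length ≤ tsize s := by
      refine le_trans ?_ (length_le_tsize s); rw [h₃]; simp
    dsimp only
    gcongr
    norm_num

namespace PolyTime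

@[fun_prop] theorem tokenize {x : γ → List (Option Bool)} (hx : PolyTime M x) :
    PolyTime M (fun c => tokenize (x c)) := by
  have h : PolyTime M (fun c => (x c).foldl tokenStep ([], [])) := by
    refine foldl (step := fun _ => tokenStep) hx (by fun_prop) ?_ (fun p => tsize p.1 + 1) ?_ ?_
    · unfold tokenStep; fun_prop
    · exact PolyLe.of_le fun p => by have : tsize p = _ := tsize_pair p.1 p.2; omega
    · intro c p a
      rcases p with ⟨l, w⟩
      have hw : tsize w.reverse = tsize w := by simp [tsize_list]
      cases a
      · simp [tokenStep, hw]; omega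
      · simp [tokenStep]; omega
  unfold _root_.tokenize
  fun_prop

@[fun_prop] theorem parseInst {x : γ → List (Option Bool)} (hx : PolyTime M x) :
    PolyTime M (fun c => parseInst (x c)) := by
  unfold _root_.parseInst
  fun_prop

@[fun_prop] theorem unionMem {ms : γ → List (List Bool)} {u : γ → ℕ} (hm : PolyTime M ms)
    (hu : PolyTime M u) : PolyTime M (fun c => unionMem (ms c) (u c)) := by
  unfold _root_.unionMem
  fun_prop

@[fun_prop] theorem isCliqueUnion {I : γ → Inst} {ms : γ → List (List Bool)} (hI : PolyTime M I)
    (hm : PolyTime M ms) : PolyTime M (fun c => isCliqueUnion (I c) (ms c)) := by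
  unfold _root_.isCliqueUnion
  fun_prop

@[fun_prop] theorem unionCard {I : γ → Inst} {ms : γ → List (List Bool)} (hI : PolyTime M I)
    (hm : PolyTime M ms) : PolyTime M (fun c => unionCard (I c) (ms c)) := by
  unfold _root_.unionCard
  fun_prop

@[fun_prop] theorem zeroDigit {q i x : γ → ℕ} (hq : PolyTime M q) (hi : PolyTime M i)
    (hx : PolyTime M x) : PolyTime M (fun c => zeroDigit (q c) (i c) (x c)) := by
  have h : PolyTime M (fun c => (List.replicate (i c) ()).foldl (fun y _ => y / q c) (x c)) := by
    refine foldl (by fun_prop) hx (by fun_prop) (fun _ => 0) (PolyLe.const _ _) ?_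
    intro c b a
    simpa using Nat.div_le_self b (q c)
  unfold _root_.zeroDigit
  fun_prop

@[fun_prop] theorem blockVertices {I : γ → Inst} {q i : γ → ℕ} (hI : PolyTime M I)
    (hq : PolyTime M q) (hi : PolyTime M i) :
    PolyTime M (fun c => blockVertices (I c) (q c) (i c)) := by
  unfold _root_.blockVertices
  fun_prop

@[fun_prop] theorem blockCard {I : γ → Inst} {q i : γ → ℕ} (hI : PolyTime M I)
    (hq : PolyTime M q) (hi : PolyTime M i) :
    PolyTime M (fun c => blockCard (I c) (q c) (i c)) := by
  unfold _root_.blockCard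
  fun_prop

@[fun_prop] theorem newAdj {I : γ → Inst} {e e' : γ → ℕ × List Bool} (hI : PolyTime M I)
    (he : PolyTime M e) (he' : PolyTime M e') :
    PolyTime M (fun c => newAdj (I c) (e c) (e' c)) := by
  unfold _root_.newAdj
  fun_prop

@[fun_prop] theorem newInput {I : γ → Inst} {k : γ → ℕ} {vs : γ → List (ℕ × List Bool)}
    (hI : PolyTime M I) (hk : PolyTime M k) (hv : PolyTime M vs) :
    PolyTime M (fun c => newInput (I c) (k c) (vs c)) := by
  unfold _root_.newInput
  fun_prop

@[fun_prop] theorem params (c₁ c₂ : ToPartrec.Code) {n : γ → ℕ} (hn : PolyTime M n) :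
    PolyTime M (fun c => params c₁ c₂ (n c)) := by
  unfold _root_.params _root_.goodParam
  fun_prop

end PolyTime

theorem polyTime_decodeBit : PolyTime M decodeBit := by
  unfold decodeBit
  fun_prop

theorem polyTime_decodeSet (D : ℕ) : PolyTime M (decodeSet D) := by
  unfold decodeSet selected
  fun_prop

theorem eff_blockCliques : Eff M (fun p : (Inst × ℕ × ℕ) × ℕ =>
    tsize p + 2 ^ (blockVertices p.1.1 p.1.2.2 p.2).count true)
    (fun p : (Inst × ℕ × ℕ) × ℕ => blockCliques p.1.1 p.1.2.2 p.2) := by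
  have hB : PolyLe tsize (fun p : (Inst × ℕ × ℕ) × ℕ =>
      tsize p + 2 ^ (blockVertices p.1.1 p.1.2.2 p.2).count true) :=
    PolyLe.of_le fun s => Nat.le_add_right _ _
  have h₁ : PolyTime M (fun p : (Inst × ℕ × ℕ) × ℕ => blockVertices p.1.1 p.1.2.2 p.2) := by
    fun_prop
  have h₂ : PolyTime M (fun z : ((Inst × ℕ × ℕ) × ℕ) × List (List Bool) => (z.2.filter fun w =>
    isCliqueUnion z.1.1.1 [w] && Nat.beq (unionCard z.1.1.1 [w])
      (blockCard z.1.1.1 z.1.1.2.2 z.1.2)).map fun w => (z.1.2, w)) := by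
    fun_prop
  refine Eff.comp (f := fun p : (Inst × ℕ × ℕ) × ℕ =>
    (p, subsets (blockVertices p.1.1 p.1.2.2 p.2))) h₂ ((Eff.id' hB).pair ?_)
  exact Eff.comp' eff_subsets (h₁.mono hB)
    ((h₁.2.1.trans hB).add (PolyLe.of_le fun p => Nat.le_add_left _ _))

/-- Only the enumeration of the subsets of the blocks is exponential, and `reductionCost` contains
exactly these powers of two. Everything else is polynomial in the input or in the enumerated list.
-/
theorem eff_reduction (c₁ c₂ : ToPartrec.Code) :
    Eff M (reductionCost c₁ c₂) (reduction c₁ c₂) := by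
  have hB : PolyLe tsize (reductionCost c₁ c₂) := PolyLe.of_le fun s => Nat.le_add_right _ _
  have h₁ : PolyTime M (parseParams c₁ c₂) := by
    unfold parseParams
    fun_prop
  have h₂ : PolyTime M (fun x => List.range (parseParams c₁ c₂ x).2.1) := by fun_prop
  have h₃ : Eff M (fun p : List (Option Bool) × ℕ => tsize p + (tsize (parseParams c₁ c₂ p.1, p.2) +
      2 ^ (blockVertices (parseParams c₁ c₂ p.1).1 (parseParams c₁ c₂ p.1).2.2 p.2).count true))
      (fun p : List (Option Bool) × ℕ =>
      blockCliques (parseParams c₁ c₂ p.1).1 (parseParams c₁ c₂ p.1).2.2 p.2) := by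
    have h : PolyTime M (fun p : List (Option Bool) × ℕ => (parseParams c₁ c₂ p.1, p.2)) := by
      fun_prop
    exact Eff.comp' (f := fun p : List (Option Bool) × ℕ => (parseParams c₁ c₂ p.1, p.2))
      eff_blockCliques (h.mono (PolyLe.of_le fun s => Nat.le_add_right _ _))
      (PolyLe.of_le fun s => Nat.le_add_left _ _)
  obtain ⟨q, hq⟩ := ((((hB.add (h₂.2.1.trans hB)).add (PolyLe.const 1 _)).add
    ((h₁.2.1.trans hB).add (h₂.2.1.trans hB))).add (PolyLe.const 1 _)).add
    (PolyLe.refl (reductionCost c₁ c₂))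
  have h₄ : Eff M (reductionCost c₁ c₂) (fun x => (List.range (parseParams c₁ c₂ x).2.1).flatMap
      fun i => blockCliques (parseParams c₁ c₂ x).1 (parseParams c₁ c₂ x).2.2 i) := by
    refine Eff.flatMap (h₂.mono hB) h₃ q fun x i hi => le_trans ?_ (hq x)
    have h₅ := tsize_le_of_mem hi
    have h₆ : 2 ^ (blockVertices (parseParams c₁ c₂ x).1 (parseParams c₁ c₂ x).2.2 i).count true ≤
        reductionCost c₁ c₂ x := by
      refine le_trans ?_ (Nat.le_add_left _ _)
      exact List.le_sum_of_mem (List.mem_map.2 ⟨i, hi, rfl⟩)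
    simp only [tsize_pair (parseParams c₁ c₂ x) i, tsize_pair x i]
    omega
  have h₅ : Eff M (reductionCost c₁ c₂) (fun x => (x, parseVertices c₁ c₂ x)) :=
    (Eff.id' hB).pair (((show PolyTime M _ by fun_prop).mono hB).pair h₄)
  have h₆ : PolyTime M (fun p : List (Option Bool) × Inst × List (ℕ × List Bool) =>
      (newInput (parseInst p.1) (params c₁ c₂ (parseInst p.1).1).1
        (bif p.2.2.isEmpty then [(0, [])] else p.2.2), p.2)) := by
    fun_prop
  exact Eff.comp (f := fun x => (x, parseVertices c₁ c₂ x)) h₆ h₅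

end

/-! ### Correctness of the parser -/

theorem foldl_tokenStep_map (w : List Bool) (l : List (List Bool)) (r : List Bool) :
    (w.map some).foldl tokenStep (l, r) = (l, w.reverse ++ r) := by
  induction w generalizing r with
  | nil => rfl
  | cons b w ih => simp [tokenStep, ih]

theorem tokenize_flatMap (ws : List (List Bool)) :
    tokenize (ws.flatMap fun w => w.map some ++ [none]) = ws := by
  have h : ∀ l, (ws.flatMap fun w => w.map some ++ [none]).foldl tokenStep (l, []) =
      (ws.reverse ++ l, []) := by
    induction ws with
    | nil => simp
    | cons w ws ih =>
      intro l
      simp [foldl_tokenStep_map, tokenStep, ih]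
  simp [tokenize, h]

/-- The data `I` describe the graph `G` with the groups `group`. -/
def Represents (I : Inst) {n N : ℕ} (G : SimpleGraph (Fin N)) (group : Fin N → Fin n) : Prop :=
  I.1 = n ∧ I.2.1 = N ∧
    (∀ u v : Fin N, (I.2.2.1.getD u []).getD v false = true ↔ G.Adj u v) ∧
    ∀ v : Fin N, I.2.2.2.getD v 0 = group v

open Classical in
theorem tokenize_encodeGroupedInput {n N : ℕ} (G : SimpleGraph (Fin N)) (group : Fin N → Fin n) :
    tokenize (encodeGroupedInput G group) = List.replicate n true :: List.replicate N true ::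
      (((List.finRange N).map fun u => (List.finRange N).map fun v => decide (G.Adj u v)) ++
        (List.finRange N).map fun v => List.replicate (group v).val true) := by
  rw [← tokenize_flatMap (_ :: _)]
  congr 1
  simp [encodeGroupedInput, encodeGraph, encodeUnary, List.flatMap_map, List.map_map,
    Function.comp_def]

theorem represents_parseInst {n N : ℕ} (G : SimpleGraph (Fin N)) (group : Fin N → Fin n) :
    Represents (parseInst (encodeGroupedInput G group)) G group := by
  classical
  simp only [parseInst, tokenize_encodeGroupedInput]
  refine ⟨by simp, by simp, fun u v => ?_, fun v => ?_⟩
  · simp [List.getD_eq_getElem?_getD, List.getElem?_append]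
  · simp [List.getD_eq_getElem?_getD, add_comm 2]

/-! ### Unions of sets of vertices -/

theorem isCliqueUnion_iff {I : Inst} {n N : ℕ} {G : SimpleGraph (Fin N)} {group : Fin N → Fin n}
    (hI : Represents I G group) (ms : List (List Bool)) :
    isCliqueUnion I ms = true ↔ G.IsClique {u : Fin N | unionMem ms u = true} := by
  obtain ⟨-, h, hG, -⟩ := hI
  simp only [isCliqueUnion, h, List.all_eq_true, List.mem_range, SimpleGraph.isClique_iff,
    Set.Pairwise, Set.mem_ofPred_eq, Bool.or_eq_true, Nat.beq_eq, Bool.not_eq_true', ← hG]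
  refine ⟨fun H u hu v hv huv => ?_, fun H u hu v hv => ?_⟩
  · have := H u u.2 v v.2
    rw [hu, hv] at this
    simpa [Fin.val_inj, huv] using this
  · by_cases h1 : unionMem ms u = true ∧ unionMem ms v = true
    · by_cases h2 : u = v
      · exact Or.inr (Or.inl h2)
      · exact Or.inr (Or.inr (H (x := ⟨u, hu⟩) h1.1 (y := ⟨v, hv⟩) h1.2 (by simpa using h2)))
    · left
      simpa using h1

/-- The set of vertices that a list of sets covers. -/
def unionSet (N : ℕ) (ms : List (List Bool)) : Finset (Fin N) :=
  Finset.univ.filter fun u => unionMem ms u = true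

@[simp] theorem mem_unionSet {N : ℕ} {ms : List (List Bool)} {u : Fin N} :
    u ∈ unionSet N ms ↔ unionMem ms u = true := by simp [unionSet]

theorem length_filter_range (N : ℕ) (p : ℕ → Bool) :
    ((List.range N).filter p).length = (Finset.univ.filter fun u : Fin N => p u = true).card := by
  have h : (Finset.univ.filter fun u : Fin N => p u = true).card =
      ((Finset.range N).filter fun u => p u = true).card := by
    rw [← Finset.card_map Fin.valEmbedding]
    congr 1
    ext u
    simp only [Finset.mem_map, Finset.mem_filter, Finset.mem_univ, true_and, Finset.mem_range,
      Fin.valEmbedding_apply]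
    exact ⟨fun ⟨a, ha, e⟩ => e ▸ ⟨a.2, ha⟩, fun ⟨a, ha⟩ => ⟨⟨u, a⟩, ha, rfl⟩⟩
  rw [h, ← List.toFinset_card_of_nodup (List.nodup_range.filter _)]
  congr 1
  ext u
  simp

theorem unionCard_eq {I : Inst} {N : ℕ} (h : I.2.1 = N) (ms : List (List Bool)) :
    unionCard I ms = (unionSet N ms).card := by
  rw [unionCard, h, length_filter_range, unionSet]

theorem unionMem_singleton (w : List Bool) (u : ℕ) : unionMem [w] u = w.getD u false := by
  simp [unionMem]

/-! ### Subsets -/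

theorem getD_of_mem_subsets {s w : List Bool} (h : w ∈ subsets s) (u : ℕ)
    (hu : w.getD u false = true) : s.getD u false = true := by
  induction s generalizing w u with
  | nil => simp [subsets_nil] at h; simp [h] at hu
  | cons b s ih =>
    rw [subsets_cons, extendMasks, List.mem_append] at h
    rcases h with h | h
    · obtain ⟨w', hw', rfl⟩ := List.mem_map.1 h
      cases u
      · simp at hu
      · exact ih hw' _ hu
    · cases b
      · simp at h
      · obtain ⟨w', hw', rfl⟩ := List.mem_map.1 h
        cases u
        · simp
        · exact ih hw' _ hu

theorem map_mem_subsets {γ : Type} (l : List γ) (f g : γ → Bool)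
    (h : ∀ a ∈ l, f a = true → g a = true) : l.map f ∈ subsets (l.map g) := by
  induction l with
  | nil => simp [subsets_nil]
  | cons a l ih =>
    have ih' := ih fun b hb => h b (List.mem_cons_of_mem _ hb)
    have ha := h a List.mem_cons_self
    rw [List.map_cons, List.map_cons, subsets_cons, extendMasks, List.mem_append]
    cases hf : f a
    · exact Or.inl (List.mem_map_of_mem ih')
    · right
      simp only [ha hf, cond_true]
      exact List.mem_map_of_mem ih'

/-! ### Digits -/

theorem zeroDigit_iff (q i x : ℕ) : zeroDigit q i x = true ↔ x / q ^ i % q = 0 := by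
  have : (List.replicate i ()).foldl (fun y _ => y / q) x = x / q ^ i := by
    induction i generalizing x with
    | zero => simp
    | succ i ih => rw [List.replicate_succ, List.foldl_cons, ih, Nat.div_div_eq_div_mul, pow_succ']
  simp [zeroDigit, this]

/-! ### Counting numbers with restricted digits -/

theorem eq_of_digits_eq {q k x y : ℕ} (h : x / q ^ k = y / q ^ k)
    (hd : ∀ i < k, x / q ^ i % q = y / q ^ i % q) : x = y := by
  induction k with
  | zero => simpa using h
  | succ k ih =>
    refine ih ?_ fun i hi => hd i (by omega)
    rw [pow_succ, ← Nat.div_div_eq_div_mul, ← Nat.div_div_eq_div_mul] at h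
    rw [← Nat.div_add_mod (x / q ^ k) q, h, hd k (by omega), Nat.div_add_mod]

/-- A number is determined by its lowest k digits and its quotient by `q ^ k`, which takes at most
`n / q ^ k + 1` values. -/
theorem card_digits_le (q k n : ℕ) (A : Fin k → Finset ℕ) :
    ((Finset.range n).filter fun x => ∀ i : Fin k, x / q ^ (i : ℕ) % q ∈ A i).card ≤
      (n / q ^ k + 1) * ∏ i, (A i).card := by
  rw [← Fintype.card_piFinset, ← Finset.card_range (n / q ^ k + 1), ← Finset.card_product]
  refine Finset.card_le_card_of_injOn (fun x => (x / q ^ k, fun i : Fin k => x / q ^ (i : ℕ) % q))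
    ?_ ?_
  · intro x hx
    simp only [Finset.coe_filter, Finset.mem_range, Set.mem_ofPred_eq] at hx
    simp only [Finset.coe_product, Set.mem_prod, Finset.mem_coe, Finset.mem_range,
      Fintype.mem_piFinset]
    exact ⟨Nat.lt_succ_of_le (Nat.div_le_div_right hx.1.le), hx.2⟩
  · intro x _ y _ h
    simp only [Prod.mk.injEq] at h
    exact eq_of_digits_eq h.1 fun i hi => congrFun h.2 ⟨i, hi⟩

/-- Positions in `R` allow `q - 1` digits and the others `q`. Multiplying by `q ^ R.card` avoids the
exponent `k - R.card`. -/
theorem card_nonzero_digits_le {q k : ℕ} (hq : 0 < q) (n : ℕ) (R : Finset (Fin k)) :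
    ((Finset.range n).filter fun x => ∀ i ∈ R, x / q ^ (i : ℕ) % q ≠ 0).card * q ^ R.card ≤
      (n / q ^ k + 1) * ((q - 1) ^ R.card * q ^ k) := by
  classical
  have h := card_digits_le q k n fun i => if i ∈ R then (Finset.range q).erase 0 else Finset.range q
  have hp : ∏ i : Fin k, (if i ∈ R then (Finset.range q).erase 0 else Finset.range q).card =
      (q - 1) ^ R.card * q ^ (k - R.card) := by
    have : ∀ i : Fin k, (if i ∈ R then (Finset.range q).erase 0 else Finset.range q).card =
        if i ∈ R then q - 1 else q := by
      intro i
      split_ifs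
      · rw [Finset.card_erase_of_mem (by simpa using hq), Finset.card_range]
      · simp
    simp only [this]
    rw [Finset.prod_ite, Finset.prod_const, Finset.prod_const]
    congr 2
    · congr 1
      ext; simp
    · have : (Finset.univ.filter fun i : Fin k => i ∉ R) = Rᶜ := by ext; simp
      rw [this, Finset.card_compl, Fintype.card_fin]
  rw [hp] at h
  have hR : R.card ≤ k := by simpa using R.card_le_univ
  calc _ ≤ (n / q ^ k + 1) * ((q - 1) ^ R.card * q ^ (k - R.card)) * q ^ R.card := by
        gcongr
        refine le_trans (Finset.card_le_card ?_) h
        intro x hx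
        simp only [Finset.mem_filter] at hx ⊢
        refine ⟨hx.1, fun i => ?_⟩
        split_ifs with hi
        · simpa using ⟨hx.2 i hi, Nat.mod_lt _ hq⟩
        · simpa using Nat.mod_lt _ hq
    _ = _ := by
        rw [mul_assoc, mul_assoc, ← pow_add, Nat.sub_add_cancel hR]

/-- Bernoulli's inequality gives (1 + 1/(q - 1))^r ≥ 1 + r/(q - 1) ≥ 2D. -/
theorem two_mul_mul_pred_pow_le {q D r : ℕ} (hq : 0 < q) (hr : 0 < r)
    (h : 2 * D * (q - 1) ≤ r) : 2 * D * (q - 1) ^ r ≤ q ^ r := by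
  obtain ⟨p, rfl⟩ : ∃ p, q = p + 1 := ⟨q - 1, by omega⟩
  rw [Nat.add_sub_cancel] at h ⊢
  -- For q = 1 the left side vanishes, but only because r is positive.
  rcases Nat.eq_zero_or_pos p with rfl | hp
  · simp [hr.ne']
  have hp' : (0 : ℝ) < p := by exact_mod_cast hp
  have h₁ := one_add_mul_le_pow (a := (1 : ℝ) / p) (by have : (0 : ℝ) ≤ 1 / p := by positivity
                                                       linarith) r
  have h₂ : (2 * D : ℝ) ≤ r * (1 / p) := by
    rw [mul_one_div, le_div_iff₀ hp']; exact_mod_cast h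
  have h₃ : ((p : ℝ) + 1) = p * (1 + 1 / p) := by field_simp
  have : (2 * D : ℝ) * (p : ℝ) ^ r ≤ (p + 1) ^ r := by
    rw [h₃, mul_pow, mul_comm]
    gcongr
    linarith
  exact_mod_cast this

/-- The incomplete last period costs a factor 2, since n/q^k + 1 ≤ 2n/q^k. The 2 in `2 * D` pays for
it. -/
theorem mul_card_nonzero_digits_le {q k n D : ℕ} (hq : 0 < q) (hn : q ^ k ≤ n)
    (R : Finset (Fin k)) (hR : 0 < R.card) (h : 2 * D * (q - 1) ≤ R.card) :
    D * ((Finset.range n).filter fun x => ∀ i ∈ R, x / q ^ (i : ℕ) % q ≠ 0).card ≤ n := by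
  set m := ((Finset.range n).filter fun x => ∀ i ∈ R, x / q ^ (i : ℕ) % q ≠ 0).card
  have h₁ : m * q ^ R.card ≤ _ := card_nonzero_digits_le hq n R
  have h₂ := two_mul_mul_pred_pow_le hq hR h
  have h₃ : (n / q ^ k + 1) * q ^ k ≤ 2 * n := by
    have := Nat.div_mul_le_self n (q ^ k)
    rw [add_mul]; omega
  refine Nat.le_of_mul_le_mul_right (c := q ^ R.card) ?_ (by positivity)
  calc D * m * q ^ R.card = D * (m * q ^ R.card) := by ring
    _ ≤ D * ((n / q ^ k + 1) * ((q - 1) ^ R.card * q ^ k)) := by gcongr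
    _ = D * (q - 1) ^ R.card * ((n / q ^ k + 1) * q ^ k) := by ring
    _ ≤ D * (q - 1) ^ R.card * (2 * n) := by gcongr
    _ = n * (2 * D * (q - 1) ^ R.card) := by ring
    _ ≤ n * q ^ R.card := by gcongr

theorem mul_card_zero_digit_le {q k n i : ℕ} (hn : q ^ k ≤ n) (hi : i < k) (hq : 0 < q) :
    q * ((Finset.range n).filter fun x => x / q ^ i % q = 0).card ≤ 2 * n := by
  have h := card_digits_le q k n fun j => if j = ⟨i, hi⟩ then {0} else Finset.range q
  have hp : ∏ j : Fin k, (if j = ⟨i, hi⟩ then {0} else Finset.range q).card = q ^ (k - 1) := by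
    have : ∀ j : Fin k, (if j = ⟨i, hi⟩ then {0} else Finset.range q).card =
        if j = ⟨i, hi⟩ then 1 else q := by
      intro j
      split_ifs <;> simp
    simp only [this]
    rw [Finset.prod_ite, Finset.prod_const, Finset.prod_const, one_pow, one_mul]
    congr 1
    have : (Finset.univ.filter fun j : Fin k => ¬ j = ⟨i, hi⟩) = {⟨i, hi⟩}ᶜ := by ext; simp
    rw [this, Finset.card_compl, Fintype.card_fin, Finset.card_singleton]
  rw [hp] at h
  have h₃ : (n / q ^ k + 1) * q ^ k ≤ 2 * n := by
    have := Nat.div_mul_le_self n (q ^ k)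
    rw [add_mul]; omega
  refine le_trans ?_ h₃
  obtain ⟨k, rfl⟩ : ∃ k', k = k' + 1 := ⟨k - 1, by omega⟩
  calc _ ≤ q * ((n / q ^ (k + 1) + 1) * q ^ (k + 1 - 1)) := by
        gcongr
        refine le_trans (Finset.card_le_card ?_) h
        intro x hx
        simp only [Finset.mem_filter] at hx ⊢
        refine ⟨hx.1, fun j => ?_⟩
        split_ifs with hj
        · subst hj; simpa using hx.2
        · simpa using Nat.mod_lt _ hq
    _ = _ := by rw [Nat.add_sub_cancel]; ring

/-! ### The new graph -/

theorem mem_newVertices {I : Inst} {k q : ℕ} {e : ℕ × List Bool} :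
    e ∈ newVertices I k q ↔ e.1 < k ∧ e.2 ∈ subsets (blockVertices I q e.1) ∧
      isCliqueUnion I [e.2] = true ∧ unionCard I [e.2] = blockCard I q e.1 := by
  rcases e with ⟨i, w⟩
  simp only [newVertices, blockCliques, List.mem_flatMap, List.mem_range, List.mem_map,
    List.mem_filter, Bool.and_eq_true, Nat.beq_eq, Prod.mk.injEq]
  constructor
  · rintro ⟨i', hi, w', hw, rfl, rfl⟩
    exact ⟨hi, hw⟩
  · rintro ⟨hi, hw⟩
    exact ⟨i, hi, w, hw, rfl, rfl⟩

theorem newAdj_iff {I : Inst} {e e' : ℕ × List Bool} :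
    newAdj I e e' = true ↔ e.1 ≠ e'.1 ∧ isCliqueUnion I [e.2, e'.2] = true := by
  rw [newAdj, Bool.and_eq_true, Bool.not_eq_true', ← Bool.not_eq_true, Nat.beq_eq]

theorem newAdj_symm (I : Inst) (e e' : ℕ × List Bool) : newAdj I e e' = newAdj I e' e := by
  have h : unionMem [e.2, e'.2] = unionMem [e'.2, e.2] := by
    funext u
    simp [unionMem, Bool.or_comm]
  rw [Bool.eq_iff_iff, newAdj_iff, newAdj_iff]
  simp only [isCliqueUnion, h, ne_comm]

/-- The new graph on a list of vertices. -/
def newGraph (I : Inst) (vs : List (ℕ × List Bool)) : SimpleGraph (Fin vs.length) where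
  Adj a b := newAdj I (vs.get a) (vs.get b) = true
  symm := ⟨fun a b h => by rw [newAdj_symm]; exact h⟩
  loopless := ⟨fun a h => (newAdj_iff.1 h).1 rfl⟩

theorem newInput_eq (I : Inst) (k : ℕ) (vs : List (ℕ × List Bool)) :
    newInput I k vs = encodeCliqueInput k (newGraph I vs) := by
  have h : vs = (List.finRange vs.length).map vs.get := by simp
  have h₂ : ∀ f : ℕ × List Bool → List (Option Bool),
      vs.flatMap f = (List.finRange vs.length).flatMap fun a => f (vs.get a) := by
    intro f
    conv_lhs => rw [h]
    rw [List.flatMap_map]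
  have h₃ : ∀ f : ℕ × List Bool → Option Bool,
      vs.map f = (List.finRange vs.length).map fun a => f (vs.get a) := by
    intro f
    conv_lhs => rw [h]
    rw [List.map_map]; rfl
  simp only [newInput, encodeCliqueInput, encodeGraph, encodeUnary, h₂, h₃, newGraph]
  congr! 8 with a b
  exact Bool.decide_eq_true.symm

section
variable {I : Inst} {C n N : ℕ} {G : SimpleGraph (Fin N)} {group : Fin N → Fin n}

theorem blockCard_eq (hI : Represents I G group) (q i : ℕ) :
    blockCard I q i = (Finset.univ.filter fun x : Fin n => (x : ℕ) / q ^ i % q = 0).card := by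
  rw [blockCard, hI.1, length_filter_range]
  simp only [zeroDigit_iff]

theorem getD_blockVertices (hI : Represents I G group) (q i : ℕ) (u : Fin N) :
    (blockVertices I q i).getD u false = true ↔ (group u : ℕ) / q ^ i % q = 0 := by
  have : (blockVertices I q i).getD u false = zeroDigit q i (I.2.2.2.getD u 0) := by
    simp [blockVertices, List.getD_eq_getElem?_getD, hI.2.1]
  rw [this, hI.2.2.2, zeroDigit_iff]

theorem IsGrouping.injOn (hG : IsGrouping C G group) {K : Set (Fin N)} (hK : G.IsClique K) :
    Set.InjOn group K := by
  intro u hu v hv h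
  by_contra huv
  exact hG.2 u v h (hK hu hv huv)

/-- The set of vertices of a clique that belong to a block, as a list. -/
def blockMask (group : Fin N → Fin n) (K : Finset (Fin N)) (q i : ℕ) : List Bool :=
  (List.finRange N).map fun v => decide (v ∈ K ∧ (group v : ℕ) / q ^ i % q = 0)

theorem unionMem_blockMask (K : Finset (Fin N)) (q i : ℕ) (u : Fin N) :
    unionMem [blockMask group K q i] u = true ↔ u ∈ K ∧ (group u : ℕ) / q ^ i % q = 0 := by
  simp [unionMem, blockMask, List.getD_eq_getElem?_getD]

/-- Groups are independent, so a clique with n vertices has exactly one vertex in each of the n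
groups. Its part in a block therefore has as many vertices as the block has groups. -/
theorem blockMask_mem_newVertices (hI : Represents I G group) (hG : IsGrouping C G group)
    {K : Finset (Fin N)} (hK : G.IsNClique n K) {k q i : ℕ} (hi : i < k) :
    (i, blockMask group K q i) ∈ newVertices I k q := by
  classical
  rw [mem_newVertices]
  have hinj := hG.injOn hK.1
  have hsurj : ∀ x : Fin n, ∃ u ∈ K, group u = x := by
    have : K.image group = Finset.univ := by
      rw [← Finset.card_eq_iff_eq_univ, Finset.card_image_of_injOn hinj, hK.2, Fintype.card_fin]
    intro x
    have hx := Finset.mem_univ x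
    rw [← this] at hx
    simpa using hx
  refine ⟨hi, ?_, ?_, ?_⟩
  · have : blockVertices I q i =
        (List.finRange N).map fun v : Fin N => decide ((group v : ℕ) / q ^ i % q = 0) := by
      rw [blockVertices, hI.2.1, ← List.map_coe_finRange_eq_range, List.map_map]
      refine List.map_congr_left fun v _ => ?_
      rw [Function.comp_apply, hI.2.2.2, Bool.eq_iff_iff, zeroDigit_iff, decide_eq_true_iff]
    rw [this]
    exact map_mem_subsets _ _ _ fun v _ h => by simp at h ⊢; exact h.2
  · rw [isCliqueUnion_iff hI]
    refine hK.1.subset fun u hu => ?_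
    exact ((unionMem_blockMask K q i u).1 hu).1
  · rw [unionCard_eq hI.2.1, blockCard_eq hI]
    refine Finset.card_bij (fun u _ => group u) ?_ ?_ ?_
    · intro u hu
      simp only [unionSet, Finset.mem_filter, Finset.mem_univ, true_and, unionMem_blockMask] at hu ⊢
      exact hu.2
    · intro u hu v hv
      simp only [unionSet, Finset.mem_filter, Finset.mem_univ, true_and,
        unionMem_blockMask] at hu hv
      exact hinj hu.1 hv.1
    · intro x hx
      obtain ⟨u, hu, rfl⟩ := hsurj x
      refine ⟨u, ?_, rfl⟩
      simp only [unionSet, Finset.mem_filter, Finset.mem_univ, true_and,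
        unionMem_blockMask] at hx ⊢
      exact ⟨hu, hx⟩

theorem exists_clique_newGraph (hI : Represents I G group) (hG : IsGrouping C G group)
    (h : HasCliqueOfSize G n) (k q : ℕ) :
    HasCliqueOfSize (newGraph I (newVertices I k q)) k := by
  obtain ⟨K, hK⟩ := h
  have hv : ∀ i : Fin k, ∃ a : Fin (newVertices I k q).length,
      (newVertices I k q).get a = ((i : ℕ), blockMask group K q i) := fun i =>
    List.mem_iff_get.1 (blockMask_mem_newVertices hI hG hK i.2)
  choose a ha using hv
  have hinj : Function.Injective a := by
    intro i j hij
    have := ha i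
    rw [hij, ha j, Prod.mk.injEq] at this
    exact Fin.ext this.1.symm
  refine ⟨Finset.univ.map ⟨a, hinj⟩, ?_, by simp⟩
  intro x hx y hy hxy
  simp only [Finset.coe_map, Finset.coe_univ, Set.image_univ, Set.mem_range,
    Function.Embedding.coeFn_mk] at hx hy
  obtain ⟨i, rfl⟩ := hx
  obtain ⟨j, rfl⟩ := hy
  have hij : (i : ℕ) ≠ j := fun h => hxy (congrArg a (Fin.ext h))
  change newAdj I _ _ = true
  rw [ha, ha, newAdj_iff]
  refine ⟨hij, ?_⟩
  rw [isCliqueUnion_iff hI]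
  refine hK.1.subset fun u hu => ?_
  have hu' : unionMem [blockMask group K q i] u = true ∨ unionMem [blockMask group K q j] u = true := by
    simpa [unionMem] using hu
  rcases hu' with h | h
  · exact ((unionMem_blockMask K q i u).1 h).1
  · exact ((unionMem_blockMask K q j u).1 h).1

theorem isClique_unionSet (hI : Represents I G group) {k q : ℕ}
    {S : Finset (Fin (newVertices I k q).length)}
    (hS : (newGraph I (newVertices I k q)).IsClique (S : Set _)) {ms : List (List Bool)}
    (hm : ∀ w, w ∈ ms ↔ ∃ a ∈ S, ((newVertices I k q).get a).2 = w) :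
    G.IsClique (unionSet N ms : Set (Fin N)) := by
  intro u hu v hv huv
  rw [Finset.mem_coe, mem_unionSet, unionMem, List.any_eq_true] at hu hv
  simp only [hm] at hu hv
  obtain ⟨_, ⟨a, ha, rfl⟩, hua⟩ := hu
  obtain ⟨_, ⟨b, hb, rfl⟩, hvb⟩ := hv
  by_cases hab : a = b
  · subst hab
    have := (mem_newVertices.1 (List.get_mem (newVertices I k q) a)).2.2.1
    rw [isCliqueUnion_iff hI] at this
    exact this (by simpa [unionMem] using hua) (by simpa [unionMem] using hvb) huv
  · have := newAdj_iff.1 (hS ha hb hab)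
    rw [isCliqueUnion_iff hI] at this
    exact this.2 (by simp only [Set.mem_ofPred_eq, unionMem, List.any_cons, hua, Bool.true_or])
      (by simp only [Set.mem_ofPred_eq, unionMem, List.any_cons, hvb, Bool.true_or, Bool.or_true])
      huv

/-- The clique injects into the groups of its block and has as many vertices as there are such
groups, so it meets all of them. This justifies the cardinality test in `blockCliques`. -/
theorem exists_mem_unionSet (hI : Represents I G group) (hG : IsGrouping C G group) {k q : ℕ}
    (a : Fin (newVertices I k q).length) (x : Fin n)
    (hx : (x : ℕ) / q ^ ((newVertices I k q).get a).1 % q = 0) :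
    ∃ u ∈ unionSet N [((newVertices I k q).get a).2], group u = x := by
  classical
  obtain ⟨-, h₁, h₂, h₃⟩ := mem_newVertices.1 (List.get_mem (newVertices I k q) a)
  set w := ((newVertices I k q).get a).2
  set i := ((newVertices I k q).get a).1
  rw [unionCard_eq hI.2.1, blockCard_eq hI] at h₃
  rw [isCliqueUnion_iff hI] at h₂
  have hinj : Set.InjOn group (unionSet N [w] : Set (Fin N)) := by
    refine hG.injOn (h₂.subset fun u hu => ?_)
    simpa [unionSet] using hu
  have : (unionSet N [w]).image group =
      Finset.univ.filter fun x : Fin n => (x : ℕ) / q ^ i % q = 0 := by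
    refine Finset.eq_of_subset_of_card_le ?_ ?_
    · intro y hy
      obtain ⟨u, hu, rfl⟩ := Finset.mem_image.1 hy
      simp only [unionSet, Finset.mem_filter, Finset.mem_univ, true_and,
        unionMem_singleton] at hu ⊢
      exact (getD_blockVertices hI q i u).1 (getD_of_mem_subsets h₁ _ hu)
    · rw [← h₃, Finset.card_image_of_injOn hinj]
  have hx' : x ∈ (unionSet N [w]).image group := by
    rw [this]
    simpa using hx
  simpa using hx'

/-- The soundness of the reduction: a group missed by the union has a nonzero digit at every index
that occurs in `S`, and such groups make up at most a fraction 1/D. -/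
theorem le_card_unionSet (hI : Represents I G group) (hG : IsGrouping C G group) {k q D : ℕ}
    (hD : 0 < D) (hq : 0 < q) (hn : q ^ k ≤ n) {S : Finset (Fin (newVertices I k q).length)}
    (hS : (newGraph I (newVertices I k q)).IsClique (S : Set _)) (hS₀ : 0 < S.card)
    (hS₁ : 2 * D * (q - 1) ≤ S.card) {ms : List (List Bool)}
    (hm : ∀ w, w ∈ ms ↔ ∃ a ∈ S, ((newVertices I k q).get a).2 = w) :
    (D - 1) * n ≤ D * (unionSet N ms).card := by
  classical
  let tag : Fin (newVertices I k q).length → Fin k := fun a =>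
    ⟨((newVertices I k q).get a).1, (mem_newVertices.1 (List.get_mem (newVertices I k q) a)).1⟩
  -- Adjacent vertices have different indices, so `S` provides `S.card` distinct digit positions.
  have htag : Set.InjOn tag S := by
    intro a ha b hb hab
    by_contra h
    exact (newAdj_iff.1 (hS ha hb h)).1 (congrArg Fin.val hab)
  have hc : (S.image tag).card = S.card := Finset.card_image_of_injOn htag
  have h := mul_card_nonzero_digits_le (D := D) hq hn (S.image tag) (by omega) (by omega)
  set m := ((Finset.range n).filter fun x =>
    ∀ i ∈ S.image tag, x / q ^ (i : ℕ) % q ≠ 0).card with hm'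
  have hcover : n ≤ m + (unionSet N ms).card := by
    have h₁ : Finset.range n ⊆ ((Finset.range n).filter fun x =>
        ∀ i ∈ S.image tag, x / q ^ (i : ℕ) % q ≠ 0) ∪
        (unionSet N ms).image (fun u => (group u : ℕ)) := by
      intro x hx
      rw [Finset.mem_union]
      by_cases hx' : ∀ i ∈ S.image tag, x / q ^ (i : ℕ) % q ≠ 0
      · exact Or.inl (Finset.mem_filter.2 ⟨hx, hx'⟩)
      · right
        push Not at hx'
        obtain ⟨i, hi, hxi⟩ := hx'
        obtain ⟨a, ha, rfl⟩ := Finset.mem_image.1 hi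
        obtain ⟨u, hu, hux⟩ := exists_mem_unionSet hI hG a ⟨x, Finset.mem_range.1 hx⟩ hxi
        refine Finset.mem_image.2 ⟨u, ?_, by rw [hux]⟩
        simp only [unionSet, Finset.mem_filter, Finset.mem_univ, true_and,
          unionMem_singleton] at hu ⊢
        rw [unionMem, List.any_eq_true]
        exact ⟨_, (hm _).2 ⟨a, ha, rfl⟩, hu⟩
    have h₂ := (Finset.card_le_card h₁).trans (Finset.card_union_le _ _)
    rw [Finset.card_range] at h₂
    exact h₂.trans (Nat.add_le_add_left Finset.card_image_le _)
  obtain ⟨d, rfl⟩ : ∃ d, D = d + 1 := ⟨D - 1, by omega⟩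
  rw [Nat.add_sub_cancel]
  have := Nat.mul_le_mul_left (d + 1) hcover
  rw [mul_add] at this
  have e : (d + 1) * n = d * n + n := by ring
  omega

end

/-! ### The parameters -/

/-- The code `c` computes the function `h`, with time measured by a clock. -/
def CodeFor (c : ToPartrec.Code) (h : ℕ → ℕ) : Prop :=
  (∀ n k w, clockedRun c n [k] = some w → w = [h k]) ∧
    ∀ k, ∃ F, ∀ n, F ≤ n → clockedRun c n [k] = some [h k]

section
variable {c₁ c₂ : ToPartrec.Code} {Φ Q : ℕ → ℕ}

theorem goodParam_spec (h₁ : CodeFor c₁ Φ) (h₂ : CodeFor c₂ Q) {n k q : ℕ}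
    (h : goodParam c₁ c₂ n k = some q) : Φ k ≤ n ∧ q = Q k ∧ 1 ≤ Q k ∧ 1 ≤ k := by
  rw [goodParam, Option.bind_eq_some_iff] at h
  obtain ⟨a, ha, h⟩ := h
  rw [Option.bind_eq_some_iff] at h
  obtain ⟨b, hb, h⟩ := h
  rw [h₁.1 _ _ _ ha, h₂.1 _ _ _ hb, cond_eq_ite] at h
  split_ifs at h with hc
  simp only [Bool.and_eq_true, Nat.ble_eq, List.headD_cons] at hc
  simp only [List.headD_cons, Option.some.injEq] at h
  exact ⟨hc.1, h.symm, hc.2⟩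

theorem eventually_goodParam (h₁ : CodeFor c₁ Φ) (h₂ : CodeFor c₂ Q) {k : ℕ} (hk : 1 ≤ k)
    (hq : 1 ≤ Q k) : ∀ᶠ n in atTop, goodParam c₁ c₂ n k = some (Q k) := by
  obtain ⟨F₁, hF₁⟩ := h₁.2 k
  obtain ⟨F₂, hF₂⟩ := h₂.2 k
  filter_upwards [eventually_ge_atTop F₁, eventually_ge_atTop F₂, eventually_ge_atTop (Φ k)]
    with n hn₁ hn₂ hn
  have : (Nat.ble (Φ k) n && (Nat.ble 1 (Q k) && Nat.ble 1 k)) = true := by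
    simp only [Bool.and_eq_true, Nat.ble_eq]
    exact ⟨hn, hq, hk⟩
  rw [goodParam, hF₁ n hn₁, hF₂ n hn₂]
  simp [this]

/-- The last entry of the list belongs to the largest argument where `g` succeeds, so `params` makes
a maximal choice. -/
theorem reverse_headD_flatMap_range (g : ℕ → Option ℕ) (d : ℕ × ℕ) (m : ℕ) :
    (((List.range m).flatMap fun k => (g k).elim [] fun q => [(k, q)]).reverse.headD d = d ∧
        ∀ k < m, g k = none) ∨
      ∃ k q, ((List.range m).flatMap fun k => (g k).elim [] fun q => [(k, q)]).reverse.headD d =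
        (k, q) ∧ g k = some q ∧ k < m ∧ ∀ k' < m, g k' ≠ none → k' ≤ k := by
  induction m with
  | zero => simp
  | succ m ih =>
    rw [List.range_succ, List.flatMap_append]
    rcases hm : g m with _ | q
    · have e : ([m].flatMap fun k => (g k).elim [] fun q => [(k, q)]) = [] := by simp [hm]
      rw [e, List.append_nil]
      rcases ih with ⟨h, h'⟩ | ⟨k, q, h, hk, hkm, h'⟩
      · refine Or.inl ⟨h, fun k hk => ?_⟩
        rcases Nat.lt_succ_iff_lt_or_eq.1 hk with hk | rfl
        exacts [h' k hk, hm]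
      · refine Or.inr ⟨k, q, h, hk, by omega, fun k' hk' hg => ?_⟩
        rcases Nat.lt_succ_iff_lt_or_eq.1 hk' with hk' | rfl
        exacts [h' k' hk' hg, absurd hm hg]
    · exact Or.inr ⟨m, q, by simp [hm], hm, by omega, fun k' hk' _ => by omega⟩

theorem params_spec (h₁ : CodeFor c₁ Φ) (h₂ : CodeFor c₂ Q) (n : ℕ) :
    params c₁ c₂ n = (1, 1) ∨ ∃ k, params c₁ c₂ n = (k, Q k) ∧ Φ k ≤ n ∧ 1 ≤ Q k ∧ 1 ≤ k := by
  rcases reverse_headD_flatMap_range (goodParam c₁ c₂ n) (1, 1) (n + 1) with h | ⟨k, q, h, hk, -⟩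
  · exact Or.inl h.1
  · obtain ⟨h₃, rfl, h₄⟩ := goodParam_spec h₁ h₂ hk
    exact Or.inr ⟨k, h, h₃, h₄⟩

/-- A fixed parameter with positive `Q` passes the test for all large n, and the chosen parameter is
at least as large. Hence it tends to infinity, with no control over its speed. -/
theorem eventually_params (h₁ : CodeFor c₁ Φ) (h₂ : CodeFor c₂ Q) (hQ : Tendsto Q atTop atTop)
    (K : ℕ) : ∀ᶠ n in atTop, ∃ k, K ≤ k ∧ params c₁ c₂ n = (k, Q k) ∧ Φ k ≤ n ∧ 1 ≤ Q k ∧ 1 ≤ k := by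
  obtain ⟨k₀, hk₀, hkK⟩ := ((hQ.eventually_ge_atTop 1).and (eventually_ge_atTop (K + 1))).exists
  filter_upwards [eventually_goodParam h₁ h₂ (by omega) hk₀, eventually_ge_atTop k₀] with n hn hnk
  rcases reverse_headD_flatMap_range (goodParam c₁ c₂ n) (1, 1) (n + 1) with h | ⟨k, q, h, hk, -, h'⟩
  · have := h.2 k₀ (by omega)
    simp [hn] at this
  · obtain ⟨h₃, rfl, h₄⟩ := goodParam_spec h₁ h₂ hk
    have := h' k₀ (by omega) (by simp [hn])
    exact ⟨k, by omega, h, h₃, h₄⟩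

end

/-! ### Sizes -/

section
variable {C n N : ℕ} {G : SimpleGraph (Fin N)} {group : Fin N → Fin n}

theorem card_filter_group_le (hG : IsGrouping C G group) (p : Fin n → Prop) [DecidablePred p] :
    (Finset.univ.filter fun v => p (group v)).card ≤
      C * (Finset.univ.filter fun x => p x).card := by
  classical
  refine Finset.card_le_mul_card_image_of_maps_to (f := group) (fun v hv => ?_) C fun x _ => ?_
  · simpa using hv
  · refine le_trans (Finset.card_le_card fun v hv => ?_) (hG.1 x)
    simp only [Finset.mem_filter] at hv ⊢
    exact ⟨Finset.mem_univ _, hv.2⟩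

theorem card_le_of_isGrouping (hG : IsGrouping C G group) : N ≤ C * n := by
  simpa using card_filter_group_le hG fun _ => True

/-- Each group contributes at most C vertices, and at most 2n/q groups have a zero digit at position
i. The case n = 0 is separate because the default parameters (1, 1) violate `q ^ k ≤ n` there. -/
theorem count_blockVertices_le {I : Inst} (hI : Represents I G group) (hG : IsGrouping C G group)
    {k q i : ℕ} (hq : 0 < q) (hi : i < k) (hn : n = 0 ∨ q ^ k ≤ n) :
    (blockVertices I q i).count true ≤ 2 * C * n / q := by
  have h₁ : (blockVertices I q i).count true =
      (Finset.univ.filter fun v : Fin N => (group v : ℕ) / q ^ i % q = 0).card := by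
    rw [blockVertices, hI.2.1, List.count, List.countP_map, List.countP_eq_length_filter]
    simp only [Function.comp_def, beq_true]
    rw [length_filter_range]
    simp only [hI.2.2.2, zeroDigit_iff]
  have h₂ := card_filter_group_le hG fun x => (x : ℕ) / q ^ i % q = 0
  rw [h₁, Nat.le_div_iff_mul_le hq]
  refine (Nat.mul_le_mul_right q h₂).trans ?_
  rcases hn with rfl | hn
  · simp
  have h₃ := mul_card_zero_digit_le hn hi hq
  have h₄ : (Finset.univ.filter fun x : Fin n => (x : ℕ) / q ^ i % q = 0).card =
      ((Finset.range n).filter fun x => x / q ^ i % q = 0).card := by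
    have := length_filter_range n fun x => decide (x / q ^ i % q = 0)
    simp only [decide_eq_true_eq] at this
    rw [← this, ← List.toFinset_card_of_nodup (List.nodup_range.filter _)]
    congr 1
    ext; simp
  rw [h₄]
  calc _ = C * (q * ((Finset.range n).filter fun x => x / q ^ i % q = 0).card) := by ring
    _ ≤ C * (2 * n) := by gcongr
    _ = _ := by ring

theorem length_newVertices_le (I : Inst) (k q : ℕ) : (newVertices I k q).length ≤
    ((List.range k).map fun i => 2 ^ (blockVertices I q i).count true).sum := by
  rw [newVertices, List.length_flatMap]
  refine List.sum_le_sum fun i _ => ?_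
  rw [blockCliques, List.length_map, ← length_subsets]
  exact List.length_filter_le _ _

theorem sum_two_pow_count_le {I : Inst} (hI : Represents I G group) (hG : IsGrouping C G group)
    {k q : ℕ} (hq : 0 < q) (hn : n = 0 ∨ q ^ k ≤ n) :
    ((List.range k).map fun i => 2 ^ (blockVertices I q i).count true).sum ≤
      k * 2 ^ (2 * C * n / q) := by
  refine (List.sum_le_card_nsmul _ (2 ^ (2 * C * n / q)) fun x hx => ?_).trans (by simp)
  obtain ⟨i, hi, rfl⟩ := List.mem_map.1 hx
  exact Nat.pow_le_pow_right (by norm_num)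
    (count_blockVertices_le hI hG hq (List.mem_range.1 hi) hn)

theorem length_encodeGroupedInput_le (G : SimpleGraph (Fin N)) (group : Fin N → Fin n) :
    (encodeGroupedInput G group).length ≤ (n + N + 2) ^ 2 := by
  have h : ((List.finRange N).map fun v => (group v : ℕ) + 1).sum ≤ N * n := by
    refine (List.sum_le_card_nsmul _ n fun x hx => ?_).trans (by simp)
    obtain ⟨v, -, rfl⟩ := List.mem_map.1 hx
    exact (group v).2
  simp only [encodeGroupedInput, encodeGraph, encodeUnary, List.length_append, List.length_flatMap,
    List.length_replicate, List.length_cons, List.length_nil, List.length_map, List.length_finRange,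
    zero_add, List.map_const', List.sum_replicate, smul_eq_mul]
  nlinarith

theorem tsize_encodeGroupedInput_le (hG : IsGrouping C G group) :
    tsize (encodeGroupedInput G group) ≤ 6 * ((C + 1) * n + 2) ^ 2 + 1 := by
  have h₁ : tsize (encodeGroupedInput G group) ≤ (encodeGroupedInput G group).length * (5 + 1) + 1 :=
    tsize_list_le fun a _ => by
      rcases a with _ | b
      · simp
      · have := tsize_bool_le b
        simp; omega
  have h₂ := length_encodeGroupedInput_le G group
  have h₃ : (n + N + 2) ^ 2 ≤ ((C + 1) * n + 2) ^ 2 := by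
    have := card_le_of_isGrouping hG
    have e : (C + 1) * n = C * n + n := by ring
    gcongr
    omega
  omega

end

/-! ### Correctness of the reduction -/

/-- The vertices of the graph of the query. -/
def queryVertices (vs : List (ℕ × List Bool)) : List (ℕ × List Bool) :=
  bif vs.isEmpty then [(0, [])] else vs

theorem queryVertices_of_ne_nil {vs : List (ℕ × List Bool)} (h : vs ≠ []) :
    queryVertices vs = vs := by
  rw [queryVertices, cond_eq_ite, if_neg (by simpa using h)]

theorem queryVertices_ne_nil (vs : List (ℕ × List Bool)) : queryVertices vs ≠ [] := by
  cases vs <;> simp [queryVertices]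

theorem length_queryVertices_le (vs : List (ℕ × List Bool)) :
    (queryVertices vs).length ≤ max 1 vs.length := by
  cases vs <;> simp [queryVertices]

section
variable {I : Inst} {C n N : ℕ} {G : SimpleGraph (Fin N)} {group : Fin N → Fin n} {k q D : ℕ}
  {r ε : ℝ}

/-- An empty new graph certifies a negative instance. The query is then made on a one-vertex graph,
as the given machine need not handle the empty graph. -/
theorem newVertices_ne_nil (hI : Represents I G group) (hG : IsGrouping C G group)
    (h : HasCliqueOfSize G n) (hk : 1 ≤ k) : newVertices I k q ≠ [] := by
  obtain ⟨S, hS⟩ := exists_clique_newGraph hI hG h k q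
  intro h₀
  have h₁ := S.card_le_univ
  rw [hS.2, Fintype.card_fin, h₀] at h₁
  simp at h₁
  omega

theorem decode_le_card (hI : Represents I G group) (hG : IsGrouping C G group) (hD : 0 < D)
    (hq : 0 < q) (hn : n = 0 ∨ q ^ k ≤ n)
    (hr : ∀ m : ℕ, r ≤ m → 0 < m ∧ 2 * D * (q - 1) ≤ m)
    {S : Finset (Fin (newVertices I k q).length)}
    (hS : (newGraph I (newVertices I k q)).IsClique (S : Set _)) (hS₁ : r ≤ S.card)
    {ms : List (List Bool)} (hm : ∀ w, w ∈ ms ↔ ∃ a ∈ S, ((newVertices I k q).get a).2 = w) :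
    (D - 1) * n ≤ D * (unionSet N ms).card := by
  rcases hn with rfl | hn
  · simp
  · exact le_card_unionSet hI hG hD hq hn hS (hr _ hS₁).1 (hr _ hS₁).2 hm

theorem hasCliqueOfSizeAtLeast_of_le (hD : 0 < D) (hε : ε ≤ 1 - 1 / D) {U : Finset (Fin N)}
    (hU : G.IsClique (U : Set (Fin N))) (h : (D - 1) * n ≤ D * U.card) :
    HasCliqueOfSizeAtLeast G (ε * n) := by
  refine ⟨U, hU, ?_⟩
  have hD' : (0 : ℝ) < D := by exact_mod_cast hD
  have h₁ : (((D - 1 : ℕ) : ℝ)) * n ≤ D * U.card := by exact_mod_cast h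
  rw [Nat.cast_sub (by omega), Nat.cast_one] at h₁
  have h₂ : ε * n ≤ (1 - 1 / D) * n := by gcongr
  refine h₂.trans ?_
  rw [show (1 - 1 / (D : ℝ)) = (D - 1) / D by field_simp, div_mul_eq_mul_div, div_le_iff₀ hD']
  linarith

theorem decodeBit_correct (hI : Represents I G group) (hG : IsGrouping C G group) (hD : 0 < D)
    (hε : ε ≤ 1 - 1 / D) (hk : 1 ≤ k) (hq : 0 < q) (hn : n = 0 ∨ q ^ k ≤ n)
    (hr : ∀ m : ℕ, r ≤ m → 0 < m ∧ 2 * D * (q - 1) ≤ m) {b : Bool}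
    (hb₁ : HasCliqueOfSize (newGraph I (queryVertices (newVertices I k q))) k → b = true)
    (hb₂ : ¬ HasCliqueOfSizeAtLeast (newGraph I (queryVertices (newVertices I k q))) r →
      b = false) :
    (HasCliqueOfSize G n → decodeBit ([b], I, newVertices I k q) = true) ∧
      (¬ HasCliqueOfSizeAtLeast G (ε * n) → decodeBit ([b], I, newVertices I k q) = false) := by
  constructor
  · intro h
    have hne := newVertices_ne_nil (q := q) hI hG h hk
    rw [queryVertices_of_ne_nil hne] at hb₁
    rw [decodeBit, hb₁ (exists_clique_newGraph hI hG h k q)]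
    simpa using hne
  · contrapose!
    intro h
    rw [Bool.ne_false_iff, decodeBit, Bool.and_eq_true] at h
    have hne : newVertices I k q ≠ [] := by simpa using h.2
    have hb : b = true := by simpa using h.1
    rw [queryVertices_of_ne_nil hne, hb] at hb₂
    have hb₃ : HasCliqueOfSizeAtLeast (newGraph I (newVertices I k q)) r := by
      by_contra h₃
      exact absurd (hb₂ h₃) (by simp)
    obtain ⟨S, hS, hS₁⟩ := hb₃
    have hm : ∀ w, w ∈ (S.toList.map fun a => ((newVertices I k q).get a).2) ↔
        ∃ a ∈ S, ((newVertices I k q).get a).2 = w := by simp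
    exact hasCliqueOfSizeAtLeast_of_le hD hε (isClique_unionSet hI hS hm)
      (decode_le_card hI hG hD hq hn hr hS hS₁ hm)

theorem mem_selected_encodeVertexSet {vs : List (ℕ × List Bool)} (S : Finset (Fin vs.length))
    (w : List Bool) : w ∈ selected (encodeVertexSet S) vs ↔ ∃ a ∈ S, (vs.get a).2 = w := by
  simp only [selected, List.mem_map, List.mem_filter, List.mem_range]
  constructor
  · rintro ⟨a, ⟨ha, hS⟩, rfl⟩
    refine ⟨⟨a, ha⟩, ?_, by simp [List.getD_eq_getElem?_getD, ha]⟩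
    simpa [encodeVertexSet, List.getD_eq_getElem?_getD, ha] using hS
  · rintro ⟨a, ha, rfl⟩
    refine ⟨a, ⟨a.2, ?_⟩, by simp [List.getD_eq_getElem?_getD]⟩
    simpa [encodeVertexSet, List.getD_eq_getElem?_getD] using ha

/-- The decoder does not trust the answer: it checks that the selected union is a clique of `G` of
sufficient size. A positive verdict is thus right for every answer, and the guarantee on `S` serves
only for completeness. -/
theorem decodeSet_correct (hI : Represents I G group) (hG : IsGrouping C G group) (hD : 0 < D)
    (hε : ε ≤ 1 - 1 / D) (hk : 1 ≤ k) (hq : 0 < q) (hn : n = 0 ∨ q ^ k ≤ n)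
    (hr : ∀ m : ℕ, r ≤ m → 0 < m ∧ 2 * D * (q - 1) ≤ m)
    {S : Finset (Fin (queryVertices (newVertices I k q)).length)}
    (hS : HasCliqueOfSize (newGraph I (queryVertices (newVertices I k q))) k →
      (newGraph I (queryVertices (newVertices I k q))).IsClique (S : Set _) ∧ r ≤ S.card) :
    (HasCliqueOfSize G n → decodeSet D (encodeVertexSet S, I, newVertices I k q) = true) ∧
      (¬ HasCliqueOfSizeAtLeast G (ε * n) →
        decodeSet D (encodeVertexSet S, I, newVertices I k q) = false) := by
  constructor
  · intro h
    have hne := newVertices_ne_nil (q := q) hI hG h hk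
    have hus := queryVertices_of_ne_nil hne
    -- The type of `S` depends on the vertex list, so the list is generalized before the equality is
    -- substituted.
    generalize queryVertices (newVertices I k q) = us at S hS hus
    subst hus
    obtain ⟨hS₁, hS₂⟩ := hS (exists_clique_newGraph hI hG h k q)
    have hm := mem_selected_encodeVertexSet S
    rw [decodeSet, Bool.and_eq_true, Nat.ble_eq, isCliqueUnion_iff hI, unionCard_eq hI.2.1, hI.1]
    refine ⟨?_, decode_le_card hI hG hD hq hn hr hS₁ hS₂ hm⟩
    simpa [unionSet] using isClique_unionSet hI hS₁ hm
  · contrapose!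
    intro h
    rw [Bool.ne_false_iff, decodeSet, Bool.and_eq_true, Nat.ble_eq, isCliqueUnion_iff hI,
      unionCard_eq hI.2.1, hI.1] at h
    exact hasCliqueOfSizeAtLeast_of_le hD hε (by simpa [unionSet] using h.1) h.2

end

/-! ### Subexponential growth -/

/-- The sequence `u` grows subexponentially. -/
def Subexp (u : ℕ → ℝ) : Prop := ∀ δ : ℝ, 0 < δ → ∀ᶠ n : ℕ in atTop, u n ≤ Real.exp (δ * n)

namespace Subexp
variable {u v : ℕ → ℝ}

theorem mono (hv : Subexp v) (h : ∀ᶠ n in atTop, u n ≤ v n) : Subexp u := fun δ hδ => by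
  filter_upwards [h, hv δ hδ] with n h₁ h₂ using h₁.trans h₂

theorem mul (hu : Subexp u) (hv : Subexp v) (hv₀ : ∀ n, 0 ≤ v n) :
    Subexp (fun n => u n * v n) := fun δ hδ => by
  filter_upwards [hu (δ / 2) (by positivity), hv (δ / 2) (by positivity)] with n h₁ h₂
  calc u n * v n ≤ Real.exp (δ / 2 * n) * Real.exp (δ / 2 * n) :=
        mul_le_mul h₁ h₂ (hv₀ n) (Real.exp_pos _).le
    _ = Real.exp (δ * n) := by rw [← Real.exp_add]; ring_nf

theorem natCast : Subexp (fun n => (n : ℝ)) := fun δ hδ => by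
  filter_upwards [eventually_ge_atTop ⌈2 / δ ^ 2⌉₊] with n hn
  have h₁ : 2 / δ ^ 2 ≤ n := (Nat.le_ceil _).trans (by exact_mod_cast hn)
  have h₂ := Real.quadratic_le_exp_of_nonneg (x := δ * n) (by positivity)
  rw [div_le_iff₀ (by positivity)] at h₁
  have h₃ : (n : ℝ) * 2 ≤ n * (n * δ ^ 2) := by gcongr
  have h₄ : 0 ≤ δ * n := by positivity
  nlinarith

theorem const (c : ℝ) : Subexp (fun _ => c) := natCast.mono <| by
  filter_upwards [eventually_ge_atTop ⌈c⌉₊] with n hn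
  exact (Nat.le_ceil _).trans (by exact_mod_cast hn)

theorem add (hu : Subexp u) (hv : Subexp v) : Subexp (fun n => u n + v n) := fun δ hδ => by
  filter_upwards [hu (δ / 2) (by positivity), hv (δ / 2) (by positivity),
    const 2 (δ / 2) (by positivity)] with n h₁ h₂ h₃
  calc u n + v n ≤ 2 * Real.exp (δ / 2 * n) := by linarith
    _ ≤ Real.exp (δ / 2 * n) * Real.exp (δ / 2 * n) := by gcongr
    _ = Real.exp (δ * n) := by rw [← Real.exp_add]; ring_nf

theorem pow (hu : Subexp u) (hu₀ : ∀ n, 0 ≤ u n) (p : ℕ) : Subexp (fun n => u n ^ p) := by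
  induction p with
  | zero => simpa using const 1
  | succ p ih => simpa only [pow_succ] using ih.mul hu hu₀

/-- This turns a subexponential time bound into the form `2 ^ t n` with t = o(n); the bound u ≥ 1
makes the logarithm nonnegative. -/
theorem isLittleO_logb (hu : Subexp u) (hu₁ : ∀ n, 1 ≤ u n) :
    (fun n => Real.logb 2 (u n)) =o[atTop] (fun n : ℕ => (n : ℝ)) := by
  rw [isLittleO_iff]
  intro δ hδ
  have h2 : 0 < Real.log 2 := Real.log_pos (by norm_num)
  filter_upwards [hu (δ * Real.log 2) (by positivity)] with n hn
  rw [Real.norm_of_nonneg (Real.logb_nonneg (by norm_num) (hu₁ n)), Real.norm_of_nonneg (by positivity),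
    Real.logb, div_le_iff₀ h2]
  refine (Real.log_le_log (by linarith [hu₁ n]) hn).trans ?_
  rw [Real.log_exp]
  linarith

end Subexp

theorem two_pow_div_le_exp (m q : ℕ) : (2 : ℝ) ^ (m / q) ≤ Real.exp ((m : ℝ) / q) := by
  have h : (2 : ℝ) ≤ Real.exp 1 := by have := Real.add_one_le_exp 1; linarith
  calc (2 : ℝ) ^ (m / q) ≤ Real.exp 1 ^ (m / q) := by gcongr
    _ = Real.exp ((m / q : ℕ) : ℝ) := by rw [← Real.exp_nat_mul, mul_one]
    _ ≤ _ := Real.exp_le_exp.2 Nat.cast_div_le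

/-! ### The choice of the parameters -/

theorem primrec_pow : Primrec₂ fun a b : ℕ => a ^ b := Primrec₂.unpaired'.1 Nat.Primrec.pow

/-- A computable sequence of positive integers that agrees with `ρ` up to a factor `3`. -/
theorem exists_computable_bound {ρ : ℕ → ℝ} (h₁ : ∀ k : ℕ, 1 ≤ k → 1 ≤ ρ k)
    (h : IsComputableRealSeq ρ) : ∃ b : ℕ → ℕ, Computable b ∧ (∀ k, 0 < b k) ∧
      ∀ k, 1 ≤ k → ρ k ≤ b k ∧ (b k : ℝ) ≤ 3 * ρ k := by
  obtain ⟨a, ha, hρ⟩ := h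
  -- A nonnegative integer z has encoding 2z, so the witness is `a k 0 + 1` for k ≥ 1. As `a k 0` is
  -- within 1 of `ρ k`, it lies between `ρ k` and `ρ k + 2`, which is at most `3 * ρ k`.
  refine ⟨fun k => Encodable.encode (a k 0) / 2 + 1, ?_, fun k => Nat.succ_pos _, fun k hk => ?_⟩
  · have h₂ : Computable fun k => a k 0 := ha.comp Computable.id (Computable.const 0)
    have h₃ : Primrec fun z : ℤ => Encodable.encode z / 2 + 1 :=
      Primrec.succ.comp (Primrec.nat_div.comp Primrec.encode (Primrec.const 2))
    exact h₃.to_comp.comp h₂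
  · have h₂ := hρ k 0
    have h₃ := h₁ k hk
    simp only [Nat.cast_zero, zero_add, div_one, abs_le] at h₂
    have h₄ : 0 ≤ a k 0 := by
      have : (0 : ℝ) ≤ a k 0 := by linarith
      exact_mod_cast this
    obtain ⟨z, hz⟩ := Int.eq_ofNat_of_zero_le h₄
    have h₅ : Encodable.encode (a k 0) / 2 = z := by
      rw [hz]
      exact Nat.mul_div_cancel_left z (by norm_num : 0 < 2)
    simp only [hz, Int.cast_natCast] at h₂
    dsimp only
    rw [h₅, Nat.cast_add, Nat.cast_one]
    constructor <;> linarith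

/-- Both requirements on q are met because `Q k` is k/ρ(k) up to constant factors: small enough for
the soundness threshold 2D(q - 1), large enough that o(k/ρ(k)) is o(q). Then in (2 ^ (2Cn/q)) ^
|g(k)| the exponent is o(n). -/
theorem exists_params {ρ : ℕ → ℝ} (hρ₁ : ∀ k : ℕ, 1 ≤ k → 1 ≤ ρ k) (hc : IsComputableRealSeq ρ)
    (hρ : ρ =o[atTop] (fun k : ℕ => (k : ℝ))) (C : ℕ) {D : ℕ} (hD : 0 < D) {f : ℕ → ℕ}
    (hf : Computable f) {g : ℕ → ℝ} (hg : g =o[atTop] (fun k : ℕ => (k : ℝ) / ρ k)) :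
    ∃ κ : ℕ → ℕ × ℕ, (∃ c₁ c₂, κ = params c₁ c₂) ∧
      (∀ n, 1 ≤ (κ n).1 ∧ 0 < (κ n).2 ∧ (n = 0 ∨ (κ n).2 ^ (κ n).1 ≤ n) ∧
        ∀ m : ℕ, ((κ n).1 : ℝ) / ρ (κ n).1 ≤ m → 0 < m ∧ 2 * D * ((κ n).2 - 1) ≤ m) ∧
      Subexp (fun n => ((κ n).1 : ℝ) * 2 ^ (2 * C * n / (κ n).2)) ∧
      Subexp (fun n => (f (κ n).1 : ℝ) *
        (((κ n).1 : ℝ) * 2 ^ (2 * C * n / (κ n).2)) ^ |g (κ n).1|) := by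
  obtain ⟨b, hb, hb₀, hbρ⟩ := exists_computable_bound hρ₁ hc
  set Q : ℕ → ℕ := fun k => k / (2 * D * b k) with hQdef
  have hQ : Computable Q := Primrec.nat_div.to_comp.comp Computable.id
    (Primrec.nat_mul.to_comp.comp (Computable.const (2 * D)) hb)
  -- The condition `Φ k ≤ n` gives three bounds at once: on f(k), on k^k and hence on k ^ |g(k)|,
  -- and on q^k as the digit count requires.
  set Φ : ℕ → ℕ := fun k => f k + (k ^ k + Q k ^ k) with hΦdef
  have hΦ : Computable Φ := Primrec.nat_add.to_comp.comp hf (Primrec.nat_add.to_comp.comp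
    (primrec_pow.to_comp.comp Computable.id Computable.id)
    (primrec_pow.to_comp.comp hQ Computable.id))
  obtain ⟨c₁, h₁⟩ := exists_code_of_computable hΦ
  obtain ⟨c₂, h₂⟩ := exists_code_of_computable hQ
  have hD' : (0 : ℝ) < D := by exact_mod_cast hD
  have hQt : Tendsto Q atTop atTop := by
    refine tendsto_atTop.2 fun m => ?_
    filter_upwards [hρ.def (c := 1 / (6 * D * (m + 1))) (by positivity), eventually_ge_atTop 1]
      with k hk hk₁
    have h₃ := hρ₁ k hk₁
    rw [Real.norm_of_nonneg (by linarith), Real.norm_of_nonneg (by positivity), one_div,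
      inv_mul_eq_div, le_div_iff₀ (by positivity)] at hk
    rw [hQdef, Nat.le_div_iff_mul_le (by have := hb₀ k; positivity)]
    have h₄ : (m : ℝ) * (2 * D * b k) ≤ k := by
      calc (m : ℝ) * (2 * D * b k) ≤ (m + 1) * (2 * D * (3 * ρ k)) := by
            gcongr
            · linarith
            · exact (hbρ k hk₁).2
        _ = ρ k * (6 * D * (m + 1)) := by ring
        _ ≤ k := hk
    exact_mod_cast h₄
  have hev := eventually_params h₁ h₂ hQt
  have hlow : ∀ k, 1 ≤ k → (2 * D * Q k : ℝ) ≤ k / ρ k := by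
    intro k hk
    have h₃ := hρ₁ k hk
    rw [le_div_iff₀ (by linarith)]
    calc (2 * D * Q k : ℝ) * ρ k ≤ 2 * D * Q k * b k := by
          gcongr
          exact (hbρ k hk).1
      _ = ((Q k * (2 * D * b k) : ℕ) : ℝ) := by push_cast; ring
      _ ≤ k := by exact_mod_cast Nat.div_mul_le_self k _
  have hupp : ∀ k, 1 ≤ k → 1 ≤ Q k → (k : ℝ) / ρ k ≤ 12 * D * Q k := by
    intro k hk hQk
    have h₃ := hρ₁ k hk
    rw [div_le_iff₀ (by linarith)]
    have h₄ : k < (Q k + 1) * (2 * D * b k) := by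
      have := Nat.lt_div_mul_add (a := k) (b := 2 * D * b k) (by have := hb₀ k; positivity)
      rw [add_mul, one_mul]; exact this
    have h₅ : (1 : ℝ) ≤ Q k := by exact_mod_cast hQk
    calc (k : ℝ) ≤ (Q k + 1) * (2 * D * b k) := by exact_mod_cast h₄.le
      _ ≤ (2 * Q k) * (2 * D * (3 * ρ k)) := by
          gcongr
          · linarith
          · exact (hbρ k hk).2
      _ = 12 * D * Q k * ρ k := by ring
  have hE : Subexp fun n => (2 : ℝ) ^ (2 * C * n / (params c₁ c₂ n).2) := by
    intro δ hδ
    obtain ⟨K, hK⟩ := eventually_atTop.1 (hQt.eventually_ge_atTop ⌈2 * C / δ⌉₊)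
    filter_upwards [hev K] with n ⟨k, hk, hkn, _, hQk, hk₁⟩
    refine (two_pow_div_le_exp _ _).trans (Real.exp_le_exp.2 ?_)
    have h₃ : 2 * C / δ ≤ Q k := (Nat.le_ceil _).trans (by exact_mod_cast hK k hk)
    have h₅ : (1 : ℝ) ≤ Q k := by exact_mod_cast hQk
    rw [div_le_iff₀ hδ] at h₃
    rw [hkn, div_le_iff₀ (by positivity)]
    push_cast
    nlinarith [Nat.cast_nonneg (α := ℝ) n]
  have hself : ∀ k, 1 ≤ k → k ≤ k ^ k := fun k hk => Nat.le_self_pow (by omega) k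
  refine ⟨params c₁ c₂, ⟨c₁, c₂, rfl⟩, fun n => ?_, ?_, ?_⟩
  · rcases params_spec h₁ h₂ n with h | ⟨k, h, hΦk, hQk, hk⟩
    · rw [h]
      -- For the default parameters the threshold 2D(q - 1) is zero, and m > 0 follows from 1/ρ(1) >
      -- 0.
      refine ⟨le_rfl, one_pos, by simp only [one_pow]; omega, fun m hm => ⟨?_, by simp⟩⟩
      have h₃ := hρ₁ 1 le_rfl
      have : (0 : ℝ) < m := lt_of_lt_of_le (by push_cast; positivity) hm
      exact_mod_cast this
    · rw [h]
      refine ⟨hk, hQk, Or.inr (by simp only [hΦdef] at hΦk; dsimp only; omega), fun m hm => ?_⟩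
      have h₃ := (hlow k hk).trans hm
      have h₄ : 2 * D * Q k ≤ m := by exact_mod_cast h₃
      have h₅ : 0 < 2 * D * Q k := by positivity
      exact ⟨by omega, le_trans (Nat.mul_le_mul_left _ (Nat.sub_le _ _)) h₄⟩
  · refine (Subexp.natCast.mul hE fun n => by positivity).mono ?_
    filter_upwards [hev 0] with n ⟨k, _, hkn, hΦk, hQk, hk₁⟩
    rw [hkn]
    have := hself k hk₁
    have h₃ : k ≤ n := by simp only [hΦdef] at hΦk; omega
    gcongr
  · have hW : Subexp fun n => (2 ^ (2 * C * n / (params c₁ c₂ n).2) : ℝ) ^ |g (params c₁ c₂ n).1| := by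
      intro δ hδ
      -- The exponent is at most (2Cn/q) * η * 12Dq = 24CDηn. The summand 1 keeps the denominator
      -- positive when C = 0.
      set η : ℝ := δ / (24 * C * D + 1) with hη
      obtain ⟨K, hK⟩ := eventually_atTop.1 (hg.def (c := η) (by positivity))
      filter_upwards [hev K] with n ⟨k, hk, hkn, _, hQk, hk₁⟩
      have h₃ := hK k hk
      have h₄ := hρ₁ k hk₁
      have h₅ : (1 : ℝ) ≤ Q k := by exact_mod_cast hQk
      rw [Real.norm_eq_abs, Real.norm_of_nonneg (by positivity)] at h₃
      rw [hkn]
      dsimp only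
      refine (Real.rpow_le_rpow (by positivity) (two_pow_div_le_exp _ _) (abs_nonneg _)).trans ?_
      rw [← Real.exp_mul, Real.exp_le_exp]
      have h₆ : |g k| ≤ η * (12 * D * Q k) := h₃.trans (by gcongr; exact hupp k hk₁ hQk)
      push_cast
      calc 2 * (C : ℝ) * n / Q k * |g k| ≤ 2 * (C : ℝ) * n / Q k * (η * (12 * D * Q k)) := by gcongr
        _ = (24 * C * D) * η * n := by field_simp; ring
        _ ≤ (24 * C * D + 1) * η * n := by
            gcongr
            linarith
        _ = δ * n := by rw [hη]; field_simp
    refine ((Subexp.natCast.mul Subexp.natCast fun n => by positivity).mul hW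
      fun n => by positivity).mono ?_
    obtain ⟨K, hK⟩ := eventually_atTop.1 (hg.def (c := 1) one_pos)
    filter_upwards [hev K] with n ⟨k, hk, hkn, hΦk, hQk, hk₁⟩
    have h₃ := hK k hk
    have h₄ := hρ₁ k hk₁
    have hk₁' : (1 : ℝ) ≤ k := by exact_mod_cast hk₁
    rw [Real.norm_eq_abs, Real.norm_of_nonneg (by positivity), one_mul] at h₃
    rw [hkn]
    dsimp only
    rw [Real.mul_rpow (by positivity) (by positivity), ← mul_assoc]
    have h₅ : |g k| ≤ k := h₃.trans (div_le_self (by positivity) h₄)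
    have h₆ : (k : ℝ) ^ |g k| ≤ n := by
      calc (k : ℝ) ^ |g k| ≤ (k : ℝ) ^ (k : ℝ) := Real.rpow_le_rpow_of_exponent_le hk₁' h₅
        _ = ((k ^ k : ℕ) : ℝ) := by rw [Real.rpow_natCast]; push_cast; rfl
        _ ≤ n := by exact_mod_cast (by simp only [hΦdef] at hΦk; omega)
    have h₇ : (f k : ℝ) ≤ n := by exact_mod_cast (by simp only [hΦdef] at hΦk; omega)
    gcongr

/-! ### The algorithm for the gap problem -/

theorem OutputsWithin.mono {M : Machine} {x : List (Option Bool)} {y : List Bool} {T T' : ℝ}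
    (h : OutputsWithin M x y T) (hT : T ≤ T') : OutputsWithin M x y T' := by
  obtain ⟨m, hm, h⟩ := h
  exact ⟨m, hm.trans hT, h⟩

theorem OutputsWithin.floor {M : Machine} {x : List (Option Bool)} {y : List Bool} {T : ℝ}
    (h : OutputsWithin M x y T) : OutputsWithin M x y (⌊T⌋₊ : ℕ) := by
  obtain ⟨m, hm, h⟩ := h
  exact ⟨m, by exact_mod_cast Nat.le_floor hm, h⟩

theorem length_encodeVertexSet {N : ℕ} (S : Finset (Fin N)) : (encodeVertexSet S).length = N := by
  simp [encodeVertexSet]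

theorem reduction_eq (c₁ c₂ : ToPartrec.Code) {n N : ℕ} (G : SimpleGraph (Fin N))
    (group : Fin N → Fin n) {I : Inst} (h : parseInst (encodeGroupedInput G group) = I) :
    reduction c₁ c₂ (encodeGroupedInput G group) =
      (encodeCliqueInput (params c₁ c₂ n).1 (newGraph I (queryVertices
        (newVertices I (params c₁ c₂ n).1 (params c₁ c₂ n).2))), I,
        newVertices I (params c₁ c₂ n).1 (params c₁ c₂ n).2) := by
  have hI : I.1 = n := h ▸ (represents_parseInst G group).1
  rw [← newInput_eq]
  simp only [reduction, parseVertices, h, hI, queryVertices]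

/-- The common part of both conclusions: hypothesis `H` isolates what the decision and the
approximation versions do differently, namely the answer and its decoding. -/
theorem gapGroupedCliqueInSubexpTime_of_query {ρ : ℕ → ℝ} (hρ₁ : ∀ k : ℕ, 1 ≤ k → 1 ≤ ρ k)
    (hc : IsComputableRealSeq ρ) (hρ : ρ =o[atTop] (fun k : ℕ => (k : ℝ))) (C : ℕ) {ε : ℝ}
    {T : ℕ → ℕ → ℝ} (hT : IsParamTimeBound ρ T) {D : ℕ} (hD : 0 < D) {M : Machine}
    {dec : List Bool × Inst × List (ℕ × List Bool) → Bool} (hdec : PolyTime M.tm dec)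
    (H : ∀ (n N : ℕ) (G : SimpleGraph (Fin N)) (group : Fin N → Fin n) (I : Inst) (k q : ℕ),
      Represents I G group → IsGrouping C G group → 1 ≤ k → 0 < q → (n = 0 ∨ q ^ k ≤ n) →
      (∀ m : ℕ, (k : ℝ) / ρ k ≤ m → 0 < m ∧ 2 * D * (q - 1) ≤ m) →
      ∃ y : List Bool, y.length ≤ (queryVertices (newVertices I k q)).length ∧
        OutputsWithin M (encodeCliqueInput k (newGraph I (queryVertices (newVertices I k q)))) y
          (T k (queryVertices (newVertices I k q)).length) ∧
        (HasCliqueOfSize G n → dec (y, I, newVertices I k q) = true) ∧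
        (¬ HasCliqueOfSizeAtLeast G (ε * n) → dec (y, I, newVertices I k q) = false)) :
    GapGroupedCliqueInSubexpTime C ε := by
  obtain ⟨f, g, hf, hg, hT⟩ := hT
  obtain ⟨κ, ⟨c₁, c₂, hκ⟩, hκ₁, hZ, hU⟩ := exists_params hρ₁ hc hρ C hD hf hg
  obtain ⟨M', p, hM'⟩ := exists_machine_of_query M (eff_reduction c₁ c₂) hdec
  set Z : ℕ → ℝ := fun n => ((κ n).1 : ℝ) * 2 ^ (2 * C * n / (κ n).2) with hZdef
  set U : ℕ → ℝ := fun n => (f (κ n).1 : ℝ) * Z n ^ |g (κ n).1|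
  have hZ₀ : ∀ n, 0 ≤ Z n := fun n => by positivity
  have hU₀ : ∀ n, 0 ≤ U n := fun n => mul_nonneg (Nat.cast_nonneg _) (Real.rpow_nonneg (hZ₀ n) _)
  -- The summands follow the bound in `exists_machine_of_query`: the cost of the reduction (input
  -- size plus subsets, the first Z), the time U of the query, the length of the answer (the second
  -- Z), and 2.
  set W : ℕ → ℝ := fun n => 6 * ((C + 1) * n + 2) ^ 2 + 1 + Z n + U n + Z n + 2
  have hW₁ : ∀ n, 1 ≤ W n := fun n => by
    have h₁ := hZ₀ n
    have h₂ := hU₀ n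
    have h₃ : (0 : ℝ) ≤ 6 * ((C + 1) * n + 2) ^ 2 := by positivity
    simp only [W]
    linarith
  have hW : Subexp W := by
    refine ((((Subexp.add ?_ (Subexp.const 1)).add hZ).add hU).add hZ).add (Subexp.const 2)
    refine ((Subexp.const 6).mul ((((Subexp.const (C + 1)).mul Subexp.natCast
      fun n => by positivity).add (Subexp.const 2)).pow (fun n => by positivity) 2)
      fun n => by positivity)
  refine ⟨M', fun n => Real.logb 2 (W n ^ p),
    (hW.pow (fun n => by linarith [hW₁ n]) p).isLittleO_logb fun n => one_le_pow₀ (hW₁ n), ?_⟩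
  intro n N G group hG
  obtain ⟨hk, hq, hn, hr⟩ := hκ₁ n
  have hI := represents_parseInst G group
  obtain ⟨I, hxI⟩ : ∃ I, parseInst (encodeGroupedInput G group) = I := ⟨_, rfl⟩
  rw [hxI] at hI
  obtain ⟨y, hy, hout, h₁, h₂⟩ := H n N G group I (κ n).1 (κ n).2 hI hG hk hq hn hr
  have hred := reduction_eq c₁ c₂ G group hxI
  rw [← hκ] at hred
  set vs := newVertices I (κ n).1 (κ n).2
  have hsum := sum_two_pow_count_le hI hG (k := (κ n).1) hq hn
  have hlen : (queryVertices vs).length ≤ (κ n).1 * 2 ^ (2 * C * n / (κ n).2) :=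
    (length_queryVertices_le vs).trans (max_le (Nat.succ_le_of_lt (by positivity))
      ((length_newVertices_le I _ _).trans hsum))
  have hlenZ : ((queryVertices vs).length : ℝ) ≤ Z n := by
    simp only [hZdef]
    exact_mod_cast hlen
  have hlen₁ : (1 : ℝ) ≤ (queryVertices vs).length := by
    exact_mod_cast List.length_pos_iff.2 (queryVertices_ne_nil vs)
  have hTU : T (κ n).1 (queryVertices vs).length ≤ U n := by
    rw [hT]
    -- The exponent g(k) may be negative. Since the queried graph is nonempty, replacing it by its
    -- absolute value only increases the power, which is then monotone in the number of vertices.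
    refine mul_le_mul_of_nonneg_left ?_ (Nat.cast_nonneg _)
    exact (Real.rpow_le_rpow_of_exponent_le hlen₁ (le_abs_self _)).trans
      (Real.rpow_le_rpow (by positivity) hlenZ (abs_nonneg _))
  have hcost : (reductionCost c₁ c₂ (encodeGroupedInput G group) : ℝ) ≤
      6 * ((C + 1) * n + 2) ^ 2 + 1 + Z n := by
    have h₃ : reductionCost c₁ c₂ (encodeGroupedInput G group) ≤
        6 * ((C + 1) * n + 2) ^ 2 + 1 + (κ n).1 * 2 ^ (2 * C * n / (κ n).2) := by
      rw [reductionCost, hxI, hI.1, ← hκ]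
      exact Nat.add_le_add (tsize_encodeGroupedInput_le hG) hsum
    simp only [hZdef]
    exact_mod_cast h₃
  refine ⟨dec (y, I, vs), ?_, h₁, h₂⟩
  have hrun := hM' (encodeGroupedInput G group) y _ (by rw [hred]; exact hout.floor)
  rw [hred] at hrun
  refine hrun.mono ?_
  rw [Real.rpow_logb (by norm_num) (by norm_num) (pow_pos (one_pos.trans_le (hW₁ n)) p)]
  have h₃ : ((⌊T (κ n).1 (queryVertices vs).length⌋₊ : ℕ) : ℝ) ≤ U n :=
    (Nat.cast_le.2 (Nat.floor_le_floor hTU)).trans (Nat.floor_le (hU₀ n))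
  have h₄ : (y.length : ℝ) ≤ Z n := le_trans (by exact_mod_cast hy) hlenZ
  rw [Nat.cast_pow]
  refine pow_le_pow_left₀ (Nat.cast_nonneg _) ?_ p
  simp only [W, Nat.cast_add, Nat.cast_ofNat]
  linarith

theorem exists_gap_denominator {ε : ℝ} (hε : ε < 1) : ∃ D : ℕ, 0 < D ∧ ε ≤ 1 - 1 / D := by
  obtain ⟨D, hD⟩ := exists_nat_one_div_lt (sub_pos.2 hε)
  refine ⟨D + 1, Nat.succ_pos D, ?_⟩
  push_cast
  linarith

end

/-! ### The main theorem -/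

theorem mainTheorem5
    (hgap : ∃ (C : ℕ) (ε : ℝ), 0 < ε ∧ ε < 1 ∧ ¬ GapGroupedCliqueInSubexpTime C ε)
    (ρ : ℕ → ℝ) (hρ_one : ∀ k : ℕ, 1 ≤ k → 1 ≤ ρ k) (hρ_comp : IsComputableRealSeq ρ)
    (hρ : ρ =o[atTop] (fun k : ℕ => (k : ℝ))) :
    ¬ CliqueApproximable ρ ∧ ¬ CliqueGapDecidable ρ := by
  obtain ⟨C, ε, -, hε, hgap⟩ := hgap
  obtain ⟨D, hD, hDε⟩ := exists_gap_denominator hε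
  refine ⟨fun ⟨M, T, hT, hM⟩ => hgap ?_, fun ⟨M, T, hT, hM⟩ => hgap ?_⟩
  · refine gapGroupedCliqueInSubexpTime_of_query hρ_one hρ_comp hρ C hT hD
      (polyTime_decodeSet (M := M.tm) D) fun n N G group I k q hI hG hk hq hn hr => ?_
    obtain ⟨S, hS, hS'⟩ := hM k _ (List.length_pos_iff.2 (queryVertices_ne_nil _))
      (newGraph I (queryVertices (newVertices I k q)))
    exact ⟨encodeVertexSet S, (length_encodeVertexSet S).le, hS,
      decodeSet_correct hI hG hD hDε hk hq hn hr hS'⟩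
  · refine gapGroupedCliqueInSubexpTime_of_query hρ_one hρ_comp hρ C hT hD
      (polyTime_decodeBit (M := M.tm)) fun n N G group I k q hI hG hk hq hn hr => ?_
    have hlen := List.length_pos_iff.2 (queryVertices_ne_nil (newVertices I k q))
    obtain ⟨b, hb, hb₁, hb₂⟩ := hM k _ hlen (newGraph I (queryVertices (newVertices I k q)))
    exact ⟨[b], hlen, hb, decodeBit_correct hI hG hD hDε hk hq hn hr hb₁ hb₂⟩
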